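/- A parameterized problem is a set $\Pi\subseteq\{0,1\}^*\times\mathbb N$ of pairs (instance, parameter). A parameterized reduction from $\Pi$ to $\Pi'$ is an algorithm (a multi-stack Turing machine) that on every input $(I,k)$ runs in time $f(k)\cdot\mathrm{poly}(|I|)$ for a computable function $f$ and outputs a pair $(I',k')$ with $k'\le g(k)$ for a computable function $g$, such that $(I,k)\in\Pi$ if and only if $(I',k')\in\Pi'$. $\mathsf{W}[2]$ is the class of all parameterized problems that have a parameterized reduction to Weighted CNF-Satisfiability: given a Boolean formula in conjunctive normal form and a positive integer $k$ (the parameter), is there a satisfying assignment with exactly $k$ variables of the formula set to true? A problem is $\mathsf{W}[2]$-complete if it is in $\mathsf{W}[2]$ and every problem in $\mathsf{W}[2]$ has a parameterized reduction to it. A relational database $\mathfrak r$ over a non-empty finite set $R$ of attributes is a finite set of rows $r=(r[a])_{a\in R}$. A set $U\subseteq R$ is a unique column combination of $\mathfrak r$ if any two distinct rows of $\mathfrak r$ differ in some attribute of $U$. For $X\subseteq R$ and $a\in R$, the functional dependency $X\to a$ is valid in $\mathfrak r$ if any two rows of $\mathfrak r$ that agree on $X$ agree on $a$; it is non-trivial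 if $a\notin X$; $X$ is its left-hand side and $a$ its right-hand side. Theorem. The following problems, parameterized by the non-negative integer $k$ (where databases are encoded as bit strings by listing their rows, whose entries are bit strings), are $\mathsf{W}[2]$-complete: 1. given a database $\mathfrak r$ and $k$, is there a unique column combination of $\mathfrak r$ of size $k$? 2. given a database $\mathfrak r$ and $k$, is there a valid, non-trivial functional dependency $X\to a$ in $\mathfrak r$ with $|X|\le k$? 3. given a database $\mathfrak r$, an attribute $a$ and $k$, is there a valid, non-trivial functional dependency $X\to a$ in $\mathfrak r$ with $|X|\le k$ and this right-hand side $a$? The problems 2 and 3 are also $\mathsf{W}[2]$-complete if $|X|\le k$ is replaced by $|X|=k$. -/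

import Mathlib

/-! ### Relational databases

A schema is a set `R` of attributes, a row over `R` is a function `R → V`, and a database over `R`
is a set of rows. -/

namespace RelDB

/-- `U` is a unique column combination of the database `r`: any two distinct rows of `r` differ in
some attribute of `U`. -/
def IsUCC {R V : Type} (r : Set (R → V)) (U : Finset R) : Prop :=
  ∀ s ∈ r, ∀ t ∈ r, s ≠ t → ∃ a ∈ U, s a ≠ t a

/-- The functional dependency `X → a` holds in the database `r`: any two rows of `r` that agree
on `X` agree on `a`. -/
def FDHolds {R V : Type} (r : Set (R → V)) (X : Finset R) (a : R) : Prop :=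
  ∀ s ∈ r, ∀ t ∈ r, (∀ b ∈ X, s b = t b) → s a = t a

end RelDB

/-! ### Parameterized problems and parameterized reductions -/

namespace ParamComplexity

/-- A parameterized problem: a set of pairs (instance, parameter), instances being bit strings. -/
abbrev Problem : Type := Set (List Bool × ℕ)

/-- The number `m` in unary, followed by a delimiter. -/
def unary (m : ℕ) : List Bool := List.replicate m true ++ [false]

/-- The string on the input (or output) stack of a machine that is given (or returns) the
instance `x.1` with parameter `x.2`. -/
def inputString (x : List Bool × ℕ) : List Bool := unary x.2 ++ x.1

/-- `P` has a parameterized reduction to `Q`: a Turing machine computes a map `red` on pairs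
(instance, parameter) within `f k * p |I|` steps on every pair `(I, k)`, where `f` is a computable
function and `p` a polynomial; the new parameter is at most `g k` for a computable function `g`;
and yes-instances are exactly the pairs that are mapped to yes-instances. -/
def Reducible (P Q : Problem) : Prop :=
  ∃ (red : List Bool × ℕ → List Bool × ℕ) (M : Turing.TM2ComputableAux Bool Bool)
    (f g : ℕ → ℕ) (p : Polynomial ℕ),
    Computable f ∧ Computable g ∧
    (∀ x, Nonempty (Turing.TM2OutputsInTime M.tm
      ((inputString x).map M.inputAlphabet.invFun)
      (some ((inputString (red x)).map M.outputAlphabet.invFun))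
      (f x.2 * p.eval x.1.length))) ∧
    (∀ x, (red x).2 ≤ g x.2) ∧
    (∀ x, x ∈ P ↔ red x ∈ Q)

/-! #### Encoding of tables -/

/-- A bit string as a table entry: every bit is preceded by `0`, and the entry ends in `10`. -/
def encodeEntry (s : List Bool) : List Bool := s.flatMap (fun b => [false, b]) ++ [true, false]

/-- A line of a table: its entries in order, followed by `11`. -/
def encodeLine (l : List (List Bool)) : List Bool := l.flatMap encodeEntry ++ [true, true]

/-- A table: its lines in order. -/
def encodeTable (t : List (List (List Bool))) : List Bool := t.flatMap encodeLine

/-! #### Weighted satisfiability of CNF formulas and the class W[2] -/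

/-- A literal: its sign (`true` for a positive literal) and its variable, named by a bit string. -/
abbrev Literal : Type := Bool × List Bool

/-- A formula in conjunctive normal form (that is, a `2`-normalized formula): a conjunction of
clauses, each of them a disjunction of literals. -/
abbrev CNF : Type := List (List Literal)

namespace CNF

/-- The set of the variables that occur in the formula. -/
def vars (φ : CNF) : Finset (List Bool) := (φ.flatten.map Prod.snd).toFinset

/-- The assignment that sets exactly the variables in `A` to true satisfies the formula. -/
def Satisfies (A : Finset (List Bool)) (φ : CNF) : Prop :=
  ∀ C ∈ φ, ∃ l ∈ C, (l.1 = true ↔ l.2 ∈ A)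

/-- The formula as a bit string. -/
def encode (φ : CNF) : List Bool := encodeTable (φ.map (fun C => C.map (fun l => l.1 :: l.2)))

end CNF

/-- Given a CNF formula and a positive integer `k`, is there a satisfying assignment that sets
exactly `k` variables of the formula to true?  The parameter is `k`. -/
def WeightedCNFSat : Problem :=
  {x | ∃ φ : CNF, x.1 = φ.encode ∧ 0 < x.2 ∧
    ∃ A : Finset (List Bool), A ⊆ φ.vars ∧ A.card = x.2 ∧ φ.Satisfies A}

/-- The class W[2]. -/
def W2 : Set Problem := {P | Reducible P WeightedCNFSat}

/-- `P` is W[2]-hard under parameterized reductions. -/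
def W2Hard (P : Problem) : Prop := ∀ Q ∈ W2, Reducible Q P

/-- `P` is W[2]-complete under parameterized reductions. -/
def W2Complete (P : Problem) : Prop := P ∈ W2 ∧ W2Hard P

/-! #### Detection problems in relational databases -/

/-- A database as it is given in the input: a non-empty schema with attributes `0, …, n - 1` and
a list of the rows (in any order), whose entries are bit strings. -/
structure Database where
  /-- the number of attributes -/
  n : ℕ
  n_pos : 0 < n
  /-- the list of the rows -/
  rows : List (Fin n → List Bool)

namespace Database

/-- The database proper: the set of its rows. -/
def rowSet (D : Database) : Set (Fin D.n → List Bool) := {r | r ∈ D.rows}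

/-- The database as a bit string: the number of attributes, followed by the table of the rows. -/
def encode (D : Database) : List Bool := unary D.n ++ encodeTable (D.rows.map List.ofFn)

end Database

/-- Given a database and `k`, is there a unique column combination of size `k`?
The parameter is `k`. -/
def UniqueColumnCombination : Problem :=
  {x | ∃ D : Database, x.1 = D.encode ∧
    ∃ U : Finset (Fin D.n), U.card = x.2 ∧ RelDB.IsUCC D.rowSet U}

/-- Given a database, an attribute `a` and `k`, is there a set `X` of `k` attributes with `a ∉ X`
such that `X → a` holds?  The parameter is `k`. -/
def FDFixedRHS : Problem :=
  {x | ∃ (D : Database) (a : Fin D.n), x.1 = unary a ++ D.encode ∧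
    ∃ X : Finset (Fin D.n), X.card = x.2 ∧ a ∉ X ∧ RelDB.FDHolds D.rowSet X a}

/-- The same as `FDFixedRHS`, for a set `X` of at most `k` attributes. -/
def FDFixedRHSAtMost : Problem :=
  {x | ∃ (D : Database) (a : Fin D.n), x.1 = unary a ++ D.encode ∧
    ∃ X : Finset (Fin D.n), X.card ≤ x.2 ∧ a ∉ X ∧ RelDB.FDHolds D.rowSet X a}

/-- Given a database and `k`, are there a set `X` of `k` attributes and an attribute `a ∉ X`
such that `X → a` holds?  The parameter is `k`. -/
def FunctionalDependency : Problem :=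
  {x | ∃ D : Database, x.1 = D.encode ∧
    ∃ (X : Finset (Fin D.n)) (a : Fin D.n), X.card = x.2 ∧ a ∉ X ∧ RelDB.FDHolds D.rowSet X a}

/-- The same as `FunctionalDependency`, for a set `X` of at most `k` attributes. -/
def FunctionalDependencyAtMost : Problem :=
  {x | ∃ D : Database, x.1 = D.encode ∧
    ∃ (X : Finset (Fin D.n)) (a : Fin D.n), X.card ≤ x.2 ∧ a ∉ X ∧ RelDB.FDHolds D.rowSet X a}

end ParamComplexity

/-!
The theorem has two sides: explicit constructions with formulas and databases, and a proof that
these constructions are carried out by Turing machines in polynomial time.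

*Machines.*  `StackProg` is a small structured language for stacks of bits.  Its programs are
compiled to labelled statements, and can be appended to an arbitrary machine, using its output stack
as stack `0` (`hostTM`).  Hence a parameterized reduction can be followed by a polynomial-time stack
program (`Reducible.trans_prog`): the length of the intermediate result is at most the length of the
input plus a constant times the running time, so the new time bound is again of the form
`f k * p |I|`.  A function between types of tree-like data is `PolyTime` if a stack program computes
it on the codes of the trees.  These functions are closed under pairing, case distinction and folds
whose state grows by a polynomial amount per step (`PolyTime.foldl`); from these, a library of list
functions is built, and `fun_prop` proves that the constructions below are `PolyTime`.

*Membership.*  The weighted satisfying assignments of `fdCNF` are the valid non-trivial functional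
dependencies with right-hand side in a given list: a variable for every attribute of the left-hand
side and of the right-hand side, and for every pair of rows that differ in the right-hand side a
clause saying that they differ in the left-hand side.  Free dummy variables turn `|X| ≤ k` into
`|X| + d = k` with `d ≤ k`.  A unique column combination is the left-hand side of a functional
dependency whose right-hand side is an additional column that identifies the rows
(`hasFD_identity_iff`).

*Hardness.*  Weighted CNF satisfiability is reduced to the hitting set problem: an assignment with
`k` true variables is described by its `k + 1` gaps, the intervals between consecutive true
variables and two sentinels.  A negative literal holds iff its variable lies strictly inside a gap,
a positive one iff its variable is the end of a gap, so that a clause asks for one gap out of a set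
of gaps.  That successive gaps fit together is a hitting condition as well, since "gap `r` does not
end in `v`" can be expressed by the other gaps with number `r` (`hitMatrix`).  As `k + 1` gaps are
necessary, it does not matter whether the size of the hitting set is `k + 1` or at most `k + 1`.
Finally, hitting sets become unique column combinations of `uccRows`, and left-hand sides of
functional dependencies of `fdRows`, where additional rows exclude all but one right-hand side.
-/

open Turing Function

namespace ParamComplexity

/-! ### A structured language for stack machines -/

/-- Programs that act on stacks of bits, which are indexed by `ℕ`. -/
inductive StackProg : Type
  /-- do nothing -/
  | skip
  /-- push the bit `b` on stack `i` -/
  | push (i : ℕ) (b : Bool)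
  /-- run one program after the other -/
  | seq (p q : StackProg)
  /-- pop stack `i` and continue according to the result -/
  | sel (i : ℕ) (body : Option Bool → StackProg)
  /-- as long as stack `i` is non-empty, pop it and run the body for the bit found -/
  | loop (i : ℕ) (body : Bool → StackProg)

namespace StackProg

/-- `Runs p S t S'`: the program `p`, started with stacks `S`, ends after `t` steps with
stacks `S'`. -/
inductive Runs : StackProg → (ℕ → List Bool) → ℕ → (ℕ → List Bool) → Prop
  | skip (S) : Runs skip S 1 S
  | push (S i b) : Runs (push i b) S 1 (update S i (b :: S i))
  | seq {p q S t S' t' S''} : Runs p S t S' → Runs q S' t' S'' → Runs (seq p q) S (t + t') S''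
  | sel {i body S t S'} : Runs (body (S i).head?) (update S i (S i).tail) t S' →
      Runs (sel i body) S (t + 1) S'
  | loop_nil {i body S} : S i = [] → Runs (loop i body) S 1 S
  | loop_cons {i body S b l t S' t' S''} : S i = b :: l → Runs (body b) (update S i l) t S' →
      Runs (loop i body) S' t' S'' → Runs (loop i body) S (t + t' + 1) S''

theorem Runs.length_le {p S t S'} (h : Runs p S t S') (i : ℕ) :
    (S' i).length ≤ (S i).length + t := by
  induction h with
  | skip S => omega
  | push S j b =>
    by_cases hij : i = j
    · subst hij; simp
    · simp [update_of_ne hij]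
  | seq _ _ ih1 ih2 => omega
  | @sel j body S t S' _ ih =>
    by_cases hij : i = j
    · subst hij; simp at ih; omega
    · rw [update_of_ne hij] at ih; omega
  | loop_nil _ => omega
  | @loop_cons j body S b l t S' t' S'' h1 _ _ ih1 ih2 =>
    by_cases hij : i = j
    · subst hij; simp at ih1; simp [h1]; omega
    · rw [update_of_ne hij] at ih1; omega

/-- The program with all stack indices increased by `m`. -/
def shift (m : ℕ) : StackProg → StackProg
  | skip => skip
  | push i b => push (i + m) b
  | seq p q => seq (p.shift m) (q.shift m)
  | sel i body => sel (i + m) (fun o => (body o).shift m)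
  | loop i body => loop (i + m) (fun b => (body b).shift m)

/-- A shifted program acts on the shifted stacks and leaves the first `m` stacks alone. -/
theorem Runs.shift {p S t S'} (h : Runs p S t S') (m : ℕ) (U : ℕ → List Bool)
    (hU : ∀ i, U (i + m) = S i) :
    Runs (p.shift m) U t (fun i => if i < m then U i else S' (i - m)) := by
  induction h generalizing U with
  | skip S =>
    convert Runs.skip U using 1
    · rfl
    funext i
    by_cases hi : i < m
    · simp [hi]
    · simp only [hi, if_false, ← hU]; congr 1; omega
  | push S j b =>
    convert Runs.push U (j + m) b using 1
    · rfl
    funext i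
    by_cases hi : i < m
    · simp only [hi, if_true]; rw [update_of_ne (by omega)]
    · obtain ⟨i, rfl⟩ : ∃ i', i = i' + m := ⟨i - m, by omega⟩
      by_cases hij : i = j
      · subst hij; simp [hU]
      · rw [update_of_ne (by omega), update_of_ne (by omega)]; simp [hU]
  | @seq p q S t S' t' S'' _ _ ih1 ih2 =>
    refine Runs.seq (ih1 U hU) ?_
    convert ih2 (fun i => if i < m then U i else S' (i - m)) (by intro i; simp) using 1
    funext i
    by_cases hi : i < m <;> simp [hi]
  | @sel j body S t S' _ ih =>
    refine Runs.sel ?_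
    rw [hU]
    convert ih (update U (j + m) (S j).tail) ?_ using 1
    · funext i
      by_cases hi : i < m
      · simp only [hi, if_true]; rw [update_of_ne (by omega)]
      · simp [hi]
    · intro i
      by_cases hij : i = j
      · subst hij; simp
      · rw [update_of_ne (by omega), update_of_ne hij, hU]
  | @loop_nil j body S h =>
    convert Runs.loop_nil (S := U) (i := j + m) (body := fun b => (body b).shift m)
      (by rw [hU, h]) using 1
    · rfl
    funext i
    by_cases hi : i < m
    · simp [hi]
    · simp only [hi, if_false, ← hU]; congr 1; omega
  | @loop_cons j body S b l t S' t' S'' h1 _ _ ih1 ih2 =>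
    refine Runs.loop_cons (b := b) (l := l) (S' := fun i => if i < m then U i else S' (i - m))
      (by rw [hU, h1]) ?_ ?_
    · convert ih1 (update U (j + m) l) ?_ using 1
      · funext i
        by_cases hi : i < m
        · simp only [hi, if_true]; rw [update_of_ne (by omega)]
        · simp [hi]
      · intro i
        by_cases hij : i = j
        · subst hij; simp
        · rw [update_of_ne (by omega), update_of_ne hij, hU]
    · convert ih2 (fun i => if i < m then U i else S' (i - m)) (by intro i; simp) using 1
      · rfl
      funext i
      by_cases hi : i < m <;> simp [hi]

/-- All stack indices of the program are smaller than `N`. -/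
def IndicesLT (N : ℕ) : StackProg → Prop
  | skip => True
  | push i _ => i < N
  | seq p q => p.IndicesLT N ∧ q.IndicesLT N
  | sel i body => i < N ∧ ∀ o, (body o).IndicesLT N
  | loop i body => i < N ∧ ∀ b, (body b).IndicesLT N

theorem IndicesLT.mono {p : StackProg} {N N' : ℕ} (hN : N ≤ N') (h : p.IndicesLT N) :
    p.IndicesLT N' := by
  induction p with
  | skip => trivial
  | push i b => exact lt_of_lt_of_le h hN
  | seq p q ihp ihq => exact ⟨ihp h.1, ihq h.2⟩
  | sel i body ih => exact ⟨lt_of_lt_of_le h.1 hN, fun o => ih o (h.2 o)⟩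
  | loop i body ih => exact ⟨lt_of_lt_of_le h.1 hN, fun o => ih o (h.2 o)⟩

theorem exists_indicesLT (p : StackProg) : ∃ N, p.IndicesLT N := by
  induction p with
  | skip => exact ⟨0, trivial⟩
  | push i b => exact ⟨i + 1, Nat.lt_succ_self i⟩
  | seq p q ihp ihq =>
    obtain ⟨N, hN⟩ := ihp
    obtain ⟨N', hN'⟩ := ihq
    exact ⟨N + N', hN.mono (by omega), hN'.mono (by omega)⟩
  | sel i body ih =>
    choose N hN using ih
    refine ⟨i + 1 + ∑ o, N o, by omega, fun o => (hN o).mono ?_⟩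
    have := Finset.single_le_sum (f := N) (fun _ _ => Nat.zero_le _) (Finset.mem_univ o)
    omega
  | loop i body ih =>
    choose N hN using ih
    refine ⟨i + 1 + ∑ o, N o, by omega, fun o => (hN o).mono ?_⟩
    have := Finset.single_le_sum (f := N) (fun _ _ => Nat.zero_le _) (Finset.mem_univ o)
    omega

/-! ### Compilation of stack programs to labelled statements -/

/-- The labels of a program: its control points. -/
def Label : StackProg → Type
  | skip => Unit
  | push _ _ => Unit
  | seq p q => p.Label ⊕ q.Label
  | sel _ body => Option (Σ o, (body o).Label)
  | loop _ body => Option (Σ b, (body b).Label)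

/-- The control point at which a program starts. -/
def entry : (p : StackProg) → p.Label
  | skip => ()
  | push _ _ => ()
  | seq p _ => .inl p.entry
  | sel _ _ => none
  | loop _ _ => none

/-- There are finitely many control points. -/
@[reducible]
noncomputable def labelFintype : (p : StackProg) → Fintype p.Label
  | skip => inferInstanceAs (Fintype Unit)
  | push _ _ => inferInstanceAs (Fintype Unit)
  | seq p q =>
    letI := p.labelFintype
    letI := q.labelFintype
    inferInstanceAs (Fintype (p.Label ⊕ q.Label))
  | sel _ body =>
    letI := fun o => (body o).labelFintype
    inferInstanceAs (Fintype (Option (Σ o, (body o).Label)))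
  | loop _ body =>
    letI := fun b => (body b).labelFintype
    inferInstanceAs (Fintype (Option (Σ b, (body b).Label)))

section Compile

variable {K : Type} {Γ : K → Type} {Λ σ : Type}

/-- The statement for a control point of a program, inside a machine whose stack `κ i` serves as
stack `i` of the program (by way of the bijection `e i`) and whose state has a component that holds
the result of the last `pop`.  The control points are embedded into the labels of the machine by
`emb`, and the machine goes on with the label `exit` when the program ends. -/
def code (κ : ℕ → K) (e : ∀ i, Γ (κ i) ≃ Bool) : (p : StackProg) → (emb : p.Label → Λ) →
    (exit : Λ) → p.Label → TM2.Stmt Γ Λ (σ × Option Bool)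
  | skip, _, exit, _ => .goto fun _ => exit
  | push i b, _, exit, _ => .push (κ i) (fun _ => (e i).symm b) (.goto fun _ => exit)
  | seq p q, emb, exit, l =>
    match l with
    | .inl l => p.code κ e (fun l => emb (.inl l)) (emb (.inr q.entry)) l
    | .inr l => q.code κ e (fun l => emb (.inr l)) exit l
  | sel i body, emb, exit, l =>
    match l with
    | none => .pop (κ i) (fun s o => (s.1, o.map (e i)))
        (.goto fun s => emb (some ⟨s.2, (body s.2).entry⟩))
    | some ⟨o, l⟩ => (body o).code κ e (fun l => emb (some ⟨o, l⟩)) exit l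
  | loop i body, emb, exit, l =>
    match l with
    | none => .pop (κ i) (fun s o => (s.1, o.map (e i)))
        (.goto fun s => match s.2 with
          | none => exit
          | some b => emb (some ⟨b, (body b).entry⟩))
    | some ⟨b, l⟩ => (body b).code κ e (fun l => emb (some ⟨b, l⟩)) (emb none) l

variable [DecidableEq K]

/-- `n` steps of the machine lead from the configuration `a` to `b`. -/
def StepsTo (M : Λ → TM2.Stmt Γ Λ σ) (n : ℕ) (a b : TM2.Cfg Γ Λ σ) : Prop :=
  (flip bind (TM2.step M))^[n] (some a) = some b

theorem StepsTo.one {M : Λ → TM2.Stmt Γ Λ σ} {a b} (h : TM2.step M a = some b) :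
    StepsTo M 1 a b := h

theorem StepsTo.trans {M : Λ → TM2.Stmt Γ Λ σ} {m n a b c} (h₁ : StepsTo M m a b)
    (h₂ : StepsTo M n b c) : StepsTo M (m + n) a c := by
  unfold StepsTo at *
  rw [add_comm, Function.iterate_add_apply, h₁, h₂]

theorem stepsTo_succ {M : Λ → TM2.Stmt Γ Λ σ} {n a c} (h : StepsTo M (n + 1) a c) :
    ∃ b, TM2.step M a = some b ∧ StepsTo M n b c := by
  unfold StepsTo at h
  rw [Function.iterate_succ_apply] at h
  cases hs : TM2.step M a with
  | none =>
    have h1 : ∀ n, (flip bind (TM2.step M))^[n] none = none := by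
      intro n
      exact Function.iterate_fixed rfl n
    change (flip bind (TM2.step M))^[n] (TM2.step M a) = _ at h
    rw [hs, h1] at h
    cases h
  | some b =>
    change (flip bind (TM2.step M))^[n] (TM2.step M a) = _ at h
    rw [hs] at h
    exact ⟨b, rfl, h⟩

/-- The first `N` stacks of a program, as they are represented by the stacks of a machine. -/
def Represents (κ : ℕ → K) (e : ∀ i, Γ (κ i) ≃ Bool) (N : ℕ) (stk : ∀ k, List (Γ k))
    (S : ℕ → List Bool) : Prop :=
  ∀ i < N, (stk (κ i)).map (e i) = S i

theorem Represents.update {κ : ℕ → K} {e : ∀ i, Γ (κ i) ≃ Bool} {N : ℕ}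
    (hκ : ∀ i < N, ∀ j < N, κ i = κ j → i = j) {stk : ∀ k, List (Γ k)} {S : ℕ → List Bool}
    (h : Represents κ e N stk S) {i : ℕ} (hi : i < N) {l : List (Γ (κ i))} {l' : List Bool}
    (hl : l.map (e i) = l') :
    Represents κ e N (Function.update stk (κ i) l) (Function.update S i l') := by
  intro j hj
  by_cases hij : j = i
  · subst hij; simp [hl]
  · rw [update_of_ne (fun hh => hij (hκ j hj i hi hh)), update_of_ne hij]
    exact h j hj

/-- The compiled program does what the program does, in as many steps, and does not touch the
stacks of the machine that do not belong to the program. -/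
theorem Runs.stepsTo {κ : ℕ → K} {e : ∀ i, Γ (κ i) ≃ Bool} {N : ℕ}
    (hκ : ∀ i < N, ∀ j < N, κ i = κ j → i = j) {M : Λ → TM2.Stmt Γ Λ (σ × Option Bool)}
    {p S t S'} (h : Runs p S t S') (emb : p.Label → Λ) (exit : Λ)
    (hM : ∀ l, M (emb l) = p.code κ e emb exit l) (hp : p.IndicesLT N)
    (v : σ) (o : Option Bool) (stk : ∀ k, List (Γ k)) (hS : Represents κ e N stk S) :
    ∃ o' stk', StepsTo M t ⟨some (emb p.entry), (v, o), stk⟩ ⟨some exit, (v, o'), stk'⟩ ∧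
      Represents κ e N stk' S' ∧ ∀ k, (∀ i < N, κ i ≠ k) → stk' k = stk k := by
  induction h generalizing exit o stk with
  | skip S =>
    refine ⟨o, stk, StepsTo.one ?_, hS, fun _ _ => rfl⟩
    rw [TM2.step.eq_2, hM]; rfl
  | push S i b =>
    refine ⟨o, Function.update stk (κ i) ((e i).symm b :: stk (κ i)), StepsTo.one ?_,
      hS.update hκ hp (by simp [hS i hp]), fun k hk => update_of_ne (hk i hp).symm _ _⟩
    rw [TM2.step.eq_2, hM]; rfl
  | @seq p q S t S' t' S'' _ _ ih1 ih2 =>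
    obtain ⟨o1, stk1, h1, hr1, hf1⟩ := ih1 (fun l => emb (.inl l)) (emb (.inr q.entry))
      (fun l => hM (Sum.inl l : p.Label ⊕ q.Label)) hp.1 o stk hS
    obtain ⟨o2, stk2, h2, hr2, hf2⟩ := ih2 (fun l => emb (.inr l)) exit
      (fun l => hM (Sum.inr l : p.Label ⊕ q.Label)) hp.2 o1 stk1 hr1
    exact ⟨o2, stk2, h1.trans h2, hr2, fun k hk => (hf2 k hk).trans (hf1 k hk)⟩
  | @sel i body S t S' _ ih =>
    have hh : (stk (κ i)).head?.map (e i) = (S i).head? := by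
      rw [← hS i hp.1, List.head?_map]
    obtain ⟨o1, stk1, h1, hr1, hf1⟩ := ih (fun l => emb (some ⟨_, l⟩)) exit
      (fun l => hM (some ⟨_, l⟩ : Option (Σ o, (body o).Label))) (hp.2 _) (S i).head?
      (Function.update stk (κ i) (stk (κ i)).tail)
      (hS.update hκ hp.1 (by rw [← hS i hp.1, List.map_tail]))
    refine ⟨o1, stk1, ?_, hr1, fun k hk => ?_⟩
    · rw [add_comm]
      refine StepsTo.trans (StepsTo.one ?_) h1
      rw [TM2.step.eq_2, hM]
      simp only [entry, code, TM2.stepAux, hh]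
      rw [hh]
    · rw [hf1 k hk, update_of_ne (hk i hp.1).symm]
  | @loop_nil i body S h =>
    have hnil : stk (κ i) = [] := by
      have := hS i hp.1
      rw [h] at this
      simpa using this
    refine ⟨none, stk, StepsTo.one ?_, hS, fun _ _ => rfl⟩
    rw [TM2.step.eq_2, hM]
    simp only [entry, code, TM2.stepAux, hnil]
    simp [hnil]
  | @loop_cons i body S b l t S' t' S'' hb _ _ ih1 ih2 =>
    have hS' := hS i hp.1
    rw [hb] at hS'
    obtain ⟨x, l', hx, hxb, hl'⟩ : ∃ x l', stk (κ i) = x :: l' ∧ e i x = b ∧ l'.map (e i) = l := by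
      cases hst : stk (κ i) with
      | nil => rw [hst] at hS'; cases hS'
      | cons x l' =>
        rw [hst] at hS'
        simp only [List.map_cons, List.cons.injEq] at hS'
        exact ⟨x, l', rfl, hS'.1, hS'.2⟩
    obtain ⟨o1, stk1, h1, hr1, hf1⟩ := ih1 (fun l => emb (some ⟨b, l⟩)) (emb none)
      (fun l => hM (some ⟨b, l⟩ : Option (Σ o, (body o).Label))) (hp.2 _) (some b)
      (Function.update stk (κ i) l') (hS.update hκ hp.1 hl')
    obtain ⟨o2, stk2, h2, hr2, hf2⟩ := ih2 emb exit hM hp o1 stk1 hr1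
    refine ⟨o2, stk2, ?_, hr2, fun k hk => ?_⟩
    · have h0 : StepsTo M 1 ⟨some (emb (loop i body).entry), (v, o), stk⟩
          ⟨some (emb (some ⟨b, (body b).entry⟩)), (v, some b), Function.update stk (κ i) l'⟩ := by
        refine StepsTo.one ?_
        rw [TM2.step.eq_2, hM]
        simp only [entry, code, TM2.stepAux, hx]
        simp [hxb]
      have := (h0.trans h1).trans h2
      rwa [show t + t' + 1 = 1 + t + t' by ring]
    · rw [hf2 k hk, hf1 k hk, update_of_ne (hk i hp.1).symm]

end Compile

end StackProg

/-! ### Running a stack program after a Turing machine -/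

/-- The length of the string on the output stack grows by a bounded amount in every step. -/
theorem exists_stepAux_length_le {K : Type} {Γ : K → Type} {Λ σ : Type} [DecidableEq K]
    (q : TM2.Stmt Γ Λ σ) : ∃ c, ∀ v S k,
      ((TM2.stepAux q v S).stk k).length ≤ (S k).length + c := by
  induction q with
  | push k f q ih =>
    obtain ⟨c, hc⟩ := ih
    refine ⟨c + 1, fun v S k' => ?_⟩
    refine (hc v _ k').trans ?_
    by_cases h : k' = k
    · subst h; simp; omega
    · rw [update_of_ne h]; omega
  | peek k f q ih =>
    obtain ⟨c, hc⟩ := ih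
    exact ⟨c, fun v S k' => hc _ _ _⟩
  | pop k f q ih =>
    obtain ⟨c, hc⟩ := ih
    refine ⟨c, fun v S k' => ?_⟩
    refine (hc _ _ k').trans ?_
    by_cases h : k' = k
    · subst h; simp
    · rw [update_of_ne h]
  | load a q ih =>
    obtain ⟨c, hc⟩ := ih
    exact ⟨c, fun v S k' => hc _ _ _⟩
  | branch f q₁ q₂ ih₁ ih₂ =>
    obtain ⟨c₁, hc₁⟩ := ih₁
    obtain ⟨c₂, hc₂⟩ := ih₂
    refine ⟨c₁ + c₂, fun v S k' => ?_⟩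
    have h1 := hc₁ v S k'
    have h2 := hc₂ v S k'
    rw [TM2.stepAux]
    cases f v <;> simp only [cond_true, cond_false] <;> omega
  | goto f => exact ⟨0, fun v S k' => by simp⟩
  | halt => exact ⟨0, fun v S k' => by simp⟩

theorem exists_stepsTo_length_le (tm : FinTM2) : ∃ c, ∀ n (a b : tm.Cfg),
    StackProg.StepsTo tm.m n a b → ∀ k, (b.stk k).length ≤ (a.stk k).length + n * c := by
  have := tm.ΛFin
  choose c hc using fun l => exists_stepAux_length_le (tm.m l)
  refine ⟨∑ l, c l, fun n => ?_⟩
  induction n with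
  | zero =>
    intro a b h k
    cases h
    simp
  | succ n ih =>
    intro a b h k
    obtain ⟨a', h1, h2⟩ := StackProg.stepsTo_succ h
    have h3 := ih a' b h2 k
    have h4 : (a'.stk k).length ≤ (a.stk k).length + ∑ l, c l := by
      obtain ⟨l, v, S⟩ := a
      cases l with
      | none => cases h1
      | some l =>
        cases h1
        have := Finset.single_le_sum (f := c) (fun _ _ => Nat.zero_le _) (Finset.mem_univ l)
        have := hc l v S k
        simp only at this ⊢
        omega
    rw [Nat.succ_mul]
    omega

/-- The stacks of a machine, together with `N` additional stacks of bits. -/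
abbrev ExtΓ {K : Type} (Γ : K → Type) (N : ℕ) : K ⊕ Fin N → Type := Sum.elim Γ fun _ => Bool

/-- A statement of a machine, as a statement of a machine with additional labels, additional stacks
and an additional component of the state.  Instead of halting, it goes on with the label `exit`. -/
def liftStmt {K : Type} {Γ : K → Type} {Λ Λ' σ τ : Type} {N : ℕ} (exit : Λ') :
    TM2.Stmt Γ Λ σ → TM2.Stmt (ExtΓ Γ N) (Λ ⊕ Λ') (σ × τ)
  | .push k f q => .push (.inl k) (fun s => f s.1) (liftStmt exit q)
  | .peek k f q => .peek (.inl k) (fun s o => (f s.1 o, s.2)) (liftStmt exit q)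
  | .pop k f q => .pop (.inl k) (fun s o => (f s.1 o, s.2)) (liftStmt exit q)
  | .load a q => .load (fun s => (a s.1, s.2)) (liftStmt exit q)
  | .branch f q₁ q₂ => .branch (fun s => f s.1) (liftStmt exit q₁) (liftStmt exit q₂)
  | .goto f => .goto (fun s => .inl (f s.1))
  | .halt => .goto (fun _ => .inr exit)

/-- A configuration of a machine, as a configuration of the extended machine. -/
def liftCfg {K : Type} {Γ : K → Type} {Λ Λ' σ τ : Type} {N : ℕ} (exit : Λ') (x : τ)
    (c : TM2.Cfg Γ Λ σ) : TM2.Cfg (ExtΓ Γ N) (Λ ⊕ Λ') (σ × τ) where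
  l := match c.l with
    | none => some (.inr exit)
    | some l => some (.inl l)
  var := (c.var, x)
  stk k := match k with
    | .inl k => c.stk k
    | .inr _ => []

theorem stepAux_liftStmt {K : Type} {Γ : K → Type} {Λ Λ' σ τ : Type} {N : ℕ} [DecidableEq K]
    (exit : Λ') (x : τ) (q : TM2.Stmt Γ Λ σ) (l : Option Λ) (v : σ) (S : ∀ k, List (Γ k)) :
    TM2.stepAux (liftStmt (N := N) exit q) (v, x) (liftCfg (N := N) exit x ⟨l, v, S⟩).stk =
      liftCfg exit x (TM2.stepAux q v S) := by
  have key : ∀ (S : ∀ k, List (Γ k)) (v v' : σ) (l l' : Option Λ) (k : K) (w : List (Γ k)),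
      update (liftCfg (N := N) exit x ⟨l, v, S⟩).stk (.inl k) w =
        (liftCfg (N := N) exit x ⟨l', v', update S k w⟩).stk := by
    intro S v v' l l' k w
    funext j
    rcases j with j | j
    · by_cases h : j = k
      · subst h
        exact (update_self _ _ _).trans (update_self (β := fun k => List (Γ k)) j w S).symm
      · exact (update_of_ne (fun h' => h (Sum.inl_injective h')) _ _).trans
          (update_of_ne h _ _).symm
    · exact update_of_ne Sum.inr_ne_inl _ _
  induction q generalizing v S l with
  | push k f q ih =>
    exact (congrArg (TM2.stepAux (liftStmt exit q) _) (key S v v l none k _)).trans (ih _ _ _)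
  | peek k f q ih =>
    exact ih l _ S
  | pop k f q ih =>
    exact (congrArg (TM2.stepAux (liftStmt exit q) _) (key S v v l none k _)).trans (ih none _ _)
  | load a q ih =>
    exact ih l _ S
  | branch f q₁ q₂ ih₁ ih₂ =>
    simp only [liftStmt, TM2.stepAux]
    cases f v <;> simp only [cond_true, cond_false, ih₁, ih₂]
  | goto f => rfl
  | halt => rfl

theorem stepsTo_liftCfg {K : Type} {Γ : K → Type} {Λ Λ' σ τ : Type} {N : ℕ} [DecidableEq K]
    {exit : Λ'} {x : τ} {M : Λ → TM2.Stmt Γ Λ σ}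
    {M' : Λ ⊕ Λ' → TM2.Stmt (ExtΓ Γ N) (Λ ⊕ Λ') (σ × τ)}
    (hM : ∀ l, M' (.inl l) = liftStmt exit (M l)) {n : ℕ} {a b : TM2.Cfg Γ Λ σ}
    (h : StackProg.StepsTo M n a b) :
    StackProg.StepsTo M' n (liftCfg exit x a) (liftCfg exit x b) := by
  induction n generalizing a with
  | zero => cases h; rfl
  | succ n ih =>
    obtain ⟨a', h1, h2⟩ := StackProg.stepsTo_succ h
    rw [add_comm]
    refine StackProg.StepsTo.trans (StackProg.StepsTo.one ?_) (ih h2)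
    obtain ⟨l, v, S⟩ := a
    cases l with
    | none => cases h1
    | some l =>
      cases h1
      have : TM2.step M' (liftCfg exit x ⟨some l, v, S⟩) =
        some (TM2.stepAux (M' (.inl l)) (v, x) (liftCfg (N := N) exit x ⟨some l, v, S⟩).stk) := rfl
      rw [this, hM, stepAux_liftStmt]

section Host

variable (M : TM2ComputableAux Bool Bool) (p : StackProg) (N : ℕ)

/-- The stack of the combined machine that is stack `i` of the program: stack `0` is the output
stack of the first machine, the other ones are new. -/
def hostStack : ℕ → M.tm.K ⊕ Fin (N + 1)
  | 0 => .inl M.tm.k₁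
  | i + 1 => .inr (Fin.ofNat (N + 1) i)

/-- The bits on the stacks of the program, as symbols of the combined machine. -/
def hostEquiv : ∀ i, ExtΓ M.tm.Γ (N + 1) (hostStack M N i) ≃ Bool
  | 0 => M.outputAlphabet
  | _ + 1 => Equiv.refl Bool

theorem hostStack_injOn : ∀ i < N + 2, ∀ j < N + 2, hostStack M N i = hostStack M N j → i = j := by
  intro i hi j hj h
  rcases i with _ | i <;> rcases j with _ | j
  · rfl
  · simp [hostStack] at h
  · simp [hostStack] at h
  · simp only [hostStack, Sum.inr.injEq, Fin.ext_iff, Fin.val_ofNat] at h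
    rw [Nat.mod_eq_of_lt (by omega), Nat.mod_eq_of_lt (by omega)] at h
    omega

/-- The machine that runs the given machine, and then the program on its output. -/
noncomputable def hostTM : FinTM2 :=
  letI := M.tm.kDecidableEq
  letI := M.tm.kFin
  letI := M.tm.ΛFin
  letI := M.tm.σFin
  letI := p.labelFintype
  { K := M.tm.K ⊕ Fin (N + 1)
    k₀ := .inl M.tm.k₀
    k₁ := .inl M.tm.k₁
    Γ := ExtΓ M.tm.Γ (N + 1)
    Λ := M.tm.Λ ⊕ Option p.Label
    main := .inl M.tm.main
    σ := M.tm.σ × Option Bool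
    initialState := (M.tm.initialState, none)
    Γk₀Fin := M.tm.Γk₀Fin
    m := fun l => match l with
      | .inl l => liftStmt (some p.entry) (M.tm.m l)
      | .inr (some l) =>
        p.code (hostStack M N) (hostEquiv M N) (fun l => .inr (some l)) (.inr none) l
      | .inr none => .load (fun s => (s.1, none)) .halt }

theorem haltList_stk_self (tm : FinTM2) (s : List (tm.Γ tm.k₁)) :
    (haltList tm s).stk tm.k₁ = s := by
  simp [haltList]

theorem haltList_stk_of_ne (tm : FinTM2) (s : List (tm.Γ tm.k₁)) {k : tm.K} (hk : k ≠ tm.k₁) :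
    (haltList tm s).stk k = [] := by
  simp [haltList, hk]

theorem eq_haltList {tm : FinTM2} {s : List (tm.Γ tm.k₁)} {c : tm.Cfg} (hl : c.l = none)
    (hv : c.var = tm.initialState) (h : c.stk tm.k₁ = s) (h' : ∀ k, k ≠ tm.k₁ → c.stk k = []) :
    c = haltList tm s := by
  obtain ⟨l, v, S⟩ := c
  simp only at hl hv h h'
  subst hl hv
  have : S = (haltList tm s).stk := by
    funext k
    by_cases hk : k = tm.k₁
    · subst hk; rw [h, haltList_stk_self]
    · rw [h' k hk, haltList_stk_of_ne tm s hk]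
  rw [this]; rfl

theorem initList_stk_self (tm : FinTM2) (s : List (tm.Γ tm.k₀)) :
    (initList tm s).stk tm.k₀ = s := by
  simp [initList]

theorem initList_stk_of_ne (tm : FinTM2) (s : List (tm.Γ tm.k₀)) {k : tm.K} (hk : k ≠ tm.k₀) :
    (initList tm s).stk k = [] := by
  simp [initList, hk]

/-- Stacks that are empty, up to the string `l` on stack `0`. -/
def onlyFirst (l : List Bool) : ℕ → List Bool := fun i => if i = 0 then l else []

theorem liftCfg_initList (s : List (M.tm.Γ M.tm.k₀)) :
    liftCfg (some p.entry) none (initList M.tm s) = initList (hostTM M p N) s := by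
  have : (liftCfg (N := N + 1) (some p.entry) (none : Option Bool) (initList M.tm s)).stk =
      (initList (hostTM M p N) s).stk := by
    funext k
    by_cases hk : k = .inl M.tm.k₀
    · subst hk
      refine Eq.trans ?_ (initList_stk_self (hostTM M p N) s).symm
      exact initList_stk_self M.tm s
    · refine Eq.trans ?_ (initList_stk_of_ne (hostTM M p N) s hk).symm
      rcases k with k | k
      · exact initList_stk_of_ne M.tm s (by rintro rfl; exact hk rfl)
      · rfl
  have h2 : (liftCfg (N := N + 1) (some p.entry) (none : Option Bool) (initList M.tm s)) =
    ⟨some (.inl M.tm.main), (M.tm.initialState, none),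
      (liftCfg (N := N + 1) (some p.entry) (none : Option Bool) (initList M.tm s)).stk⟩ := rfl
  rw [h2, this]; rfl

theorem map_invFun_map {α β : Type} (e : α ≃ β) (l : List α) : (l.map e).map e.invFun = l := by
  simp

theorem hostTM_stepsTo {N : ℕ} (hp : p.IndicesLT (N + 2)) {n t : ℕ} {s : List (M.tm.Γ M.tm.k₀)}
    {l l' : List Bool}
    (h1 : StackProg.StepsTo M.tm.m n (initList M.tm s)
      (haltList M.tm (l.map M.outputAlphabet.invFun)))
    (h2 : p.Runs (onlyFirst l) t (onlyFirst l')) :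
    StackProg.StepsTo (hostTM M p N).m (n + t + 1) (initList (hostTM M p N) s)
      (haltList (hostTM M p N) (l'.map M.outputAlphabet.invFun)) := by
  have a1 := stepsTo_liftCfg (N := N + 1) (x := (none : Option Bool)) (exit := some p.entry)
    (M' := (hostTM M p N).m) (fun l => rfl) h1
  rw [liftCfg_initList] at a1
  have hS : StackProg.Represents (hostStack M N) (hostEquiv M N) (N + 2)
      (liftCfg (N := N + 1) (some p.entry) (none : Option Bool)
        (haltList M.tm (l.map M.outputAlphabet.invFun))).stk (onlyFirst l) := by
    intro i _
    rcases i with _ | i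
    · change List.map M.outputAlphabet ((haltList M.tm _).stk M.tm.k₁) = l
      rw [haltList_stk_self, List.map_map]
      simp
    · rfl
  obtain ⟨o, stk, a2, hr, hf⟩ := h2.stepsTo (M := (hostTM M p N).m) (κ := hostStack M N)
    (e := hostEquiv M N) (hostStack_injOn M N) (fun l => .inr (some l)) (.inr none) (fun l => rfl)
    hp M.tm.initialState none
    _ hS
  have a3 : StackProg.StepsTo (hostTM M p N).m 1
      ⟨some (.inr none), (M.tm.initialState, o), stk⟩
      (haltList (hostTM M p N) (l'.map M.outputAlphabet.invFun)) := by
    refine StackProg.StepsTo.one (congrArg some (eq_haltList rfl rfl ?_ ?_))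
    · have := hr 0 (by omega)
      change stk (.inl M.tm.k₁) = _
      change (stk (.inl M.tm.k₁)).map M.outputAlphabet = l' at this
      rw [← this]
      exact (map_invFun_map M.outputAlphabet _).symm
    · intro k hk
      change stk k = []
      rcases k with k | k
      · rw [hf]
        · refine haltList_stk_of_ne _ _ (fun h => hk (h ▸ rfl))
        · intro i hi
          rcases i with _ | i
          · exact fun h => hk h.symm
          · simp [hostStack]
      · have := hr (k + 1) (by omega)
        have hk : hostStack M N (k + 1) = .inr k := by
          simp [hostStack]
        have h3 : stk (hostStack M N (k + 1)) = [] := by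
          simpa [onlyFirst] using this
        rwa [hk] at h3
  exact (a1.trans a2).trans a3

end Host

/-- A stack program transforms strings into strings within polynomial time. -/
def ProgComputes (p : StackProg) (h : List Bool → List Bool) : Prop :=
  ∃ q : Polynomial ℕ, ∀ l, ∃ t ≤ q.eval l.length, p.Runs (onlyFirst l) t (onlyFirst (h l))

/-! ### Time bounds -/

theorem eval_mono (q : Polynomial ℕ) {m n : ℕ} (h : m ≤ n) : q.eval m ≤ q.eval n := by
  rw [Polynomial.eval_eq_sum, Polynomial.eval_eq_sum]
  exact Finset.sum_le_sum fun i _ => Nat.mul_le_mul_left _ (Nat.pow_le_pow_left h i)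

theorem eval_mul_le (q : Polynomial ℕ) (a b : ℕ) : q.eval (a * b) ≤ q.eval a * q.eval b := by
  rw [Polynomial.eval_eq_sum, Polynomial.eval_eq_sum, Polynomial.eval_eq_sum]
  simp only [Polynomial.sum]
  rw [Finset.sum_mul]
  refine Finset.sum_le_sum fun i hi => ?_
  have h1 : q.coeff i * b ^ i ≤ ∑ j ∈ q.support, q.coeff j * b ^ j :=
    Finset.single_le_sum (f := fun j => q.coeff j * b ^ j) (fun _ _ => Nat.zero_le _) hi
  have h2 : 1 ≤ q.coeff i := Nat.one_le_iff_ne_zero.2 (Polynomial.mem_support_iff.1 hi)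
  calc q.coeff i * (a * b) ^ i = q.coeff i * a ^ i * (1 * b ^ i) := by rw [mul_pow]; ring
    _ ≤ q.coeff i * a ^ i * (q.coeff i * b ^ i) := by gcongr
    _ ≤ _ := Nat.mul_le_mul_left _ h1

theorem computable_eval (q : Polynomial ℕ) : Computable fun n => q.eval n := by
  refine Primrec.to_comp ?_
  induction q using Polynomial.induction_on' with
  | add p q hp hq =>
    simp only [Polynomial.eval_add]
    exact Primrec.nat_add.comp hp hq
  | monomial i a =>
    simp only [Polynomial.eval_monomial]
    refine Primrec.nat_mul.comp (Primrec.const a) ?_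
    induction i with
    | zero => simpa using Primrec.const 1
    | succ i ih =>
      simp only [pow_succ]
      exact Primrec.nat_mul.comp ih Primrec.id

theorem length_inputString (x : List Bool × ℕ) :
    (inputString x).length = x.2 + 1 + x.1.length := by
  simp [inputString, unary]
  omega

/-- A parameterized reduction can be followed by a reduction that is computed by a polynomial-time
stack program. -/
theorem Reducible.trans_prog {Q P P' : Problem} (hQ : Reducible Q P)
    {red' : List Bool × ℕ → List Bool × ℕ} {h : List Bool → List Bool} {p : StackProg}
    (hp : ProgComputes p h) (hred : ∀ x, h (inputString x) = inputString (red' x))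
    {g' : ℕ → ℕ} (hg' : Computable g') (hmono : Monotone g') (hk : ∀ x, (red' x).2 ≤ g' x.2)
    (hiff : ∀ x, x ∈ P ↔ red' x ∈ P') : Reducible Q P' := by
  obtain ⟨red, M, f, g, r, hf, hg, hM, hred1, hiff1⟩ := hQ
  obtain ⟨q, hq⟩ := hp
  obtain ⟨N, hN⟩ := p.exists_indicesLT
  obtain ⟨c, hc⟩ := exists_stepsTo_length_le M.tm
  refine ⟨fun x => red' (red x), ⟨hostTM M p N, M.inputAlphabet, M.outputAlphabet⟩,
    fun k => f k + q.eval (k + 2 + c * f k) + 1, fun k => g' (g k),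
    r + q.comp (Polynomial.X + 1 + r) + 1, ?_, hg'.comp hg, ?_,
    fun x => (hk _).trans (hmono (hred1 x)), fun x => (hiff1 x).trans (hiff _)⟩
  · have hadd : Computable₂ ((· + ·) : ℕ → ℕ → ℕ) := Primrec.nat_add.to_comp
    have hmul : Computable₂ ((· * ·) : ℕ → ℕ → ℕ) := Primrec.nat_mul.to_comp
    exact Computable.succ.comp (hadd.comp hf ((computable_eval q).comp (hadd.comp
      (Computable.succ.comp Computable.succ) (hmul.comp (Computable.const c) hf))))
  · intro x
    obtain ⟨⟨⟨n, hn⟩, hle⟩⟩ := hM x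
    have h1 : StackProg.StepsTo M.tm.m n
      (initList M.tm ((inputString x).map M.inputAlphabet.invFun))
      (haltList M.tm ((inputString (red x)).map M.outputAlphabet.invFun)) := hn
    simp only at hle
    obtain ⟨t, ht, h2⟩ := hq (inputString (red x))
    rw [hred] at h2
    have h3 := hostTM_stepsTo M p (N := N) (hN.mono (by omega)) h1 h2
    refine ⟨⟨⟨n + t + 1, h3⟩, ?_⟩⟩
    have h4 : (inputString (red x)).length ≤ (inputString x).length + n * c := by
      have := hc n _ _ h1 M.tm.k₁
      rw [haltList_stk_self, List.length_map] at this
      refine this.trans ?_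
      gcongr
      by_cases hk : M.tm.k₁ = M.tm.k₀
      · rw [hk]
        rw [initList_stk_self, List.length_map]
      · rw [initList_stk_of_ne _ _ hk]; simp
    rw [length_inputString x] at h4
    set k := x.2
    set m := x.1.length
    set T := r.eval m
    have h5 : (inputString (red x)).length ≤ (k + 2 + c * f k) * (m + 1 + T) := by
      refine h4.trans ?_
      have : n * c ≤ c * f k * T := by
        calc n * c ≤ (f k * T) * c := by gcongr
          _ = _ := by ring
      nlinarith [Nat.zero_le (k * m), Nat.zero_le (k * T), Nat.zero_le (c * f k * m),
        Nat.zero_le (c * f k)]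
    have h6 : t ≤ q.eval (k + 2 + c * f k) * q.eval (m + 1 + T) :=
      ht.trans ((eval_mono q h5).trans (eval_mul_le q _ _))
    have h7 : (r + q.comp (Polynomial.X + 1 + r) + 1).eval m = T + q.eval (m + 1 + T) + 1 := by
      simp [Polynomial.eval_comp, T]
    change n + t + 1 ≤ (f k + q.eval (k + 2 + c * f k) + 1) * _
    rw [h7]
    set A := q.eval (k + 2 + c * f k)
    set B := q.eval (m + 1 + T)
    nlinarith [Nat.zero_le (f k * B), Nat.zero_le (f k), Nat.zero_le (A * T), Nat.zero_le A,
      Nat.zero_le T, Nat.zero_le B]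

theorem Reducible.refl (P : Problem) : Reducible P P := by
  refine ⟨id, ⟨idComputer Bool, Equiv.refl Bool, Equiv.refl Bool⟩, fun _ => 1, id, 1,
    Computable.const 1, Computable.id, fun x => ⟨⟨⟨1, ?_⟩, ?_⟩⟩, fun _ => le_rfl, fun _ => Iff.rfl⟩
  · rfl
  · simp

/-! ### Trees, and programs that handle their codes -/

/-- Binary trees, into which all data are encoded. -/
inductive Data : Type
  | nil
  | pair (x y : Data)

/-- The prefix code of a tree. -/
def Data.code : Data → List Bool
  | nil => [false]
  | pair x y => true :: (x.code ++ y.code)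

/-- A type whose elements are encoded as trees.  Nothing is required of the encoding; the instances
below are injective. -/
class TreeCoded (α : Type) where
  /-- the tree that encodes an element -/
  tree : α → Data

namespace StackProg

/-- The program ends within `n` steps. -/
def RunsIn (p : StackProg) (S : ℕ → List Bool) (n : ℕ) (S' : ℕ → List Bool) : Prop :=
  ∃ t ≤ n, p.Runs S t S'

theorem RunsIn.mono {p S m n S'} (h : RunsIn p S m S') (hmn : m ≤ n) : RunsIn p S n S' :=
  let ⟨t, ht, hr⟩ := h
  ⟨t, ht.trans hmn, hr⟩

theorem RunsIn.cast {p S n S' S''} (h : RunsIn p S n S') (hS : S' = S'') : RunsIn p S n S'' :=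
  hS ▸ h

theorem RunsIn.seq {p q S m S' n S''} (h₁ : RunsIn p S m S') (h₂ : RunsIn q S' n S'') :
    RunsIn (.seq p q) S (m + n) S'' :=
  let ⟨t, ht, hr⟩ := h₁
  let ⟨t', ht', hr'⟩ := h₂
  ⟨t + t', add_le_add ht ht', hr.seq hr'⟩

theorem RunsIn.skip (S) : RunsIn .skip S 1 S := ⟨1, le_rfl, .skip S⟩

theorem RunsIn.push (S i b) : RunsIn (.push i b) S 1 (update S i (b :: S i)) :=
  ⟨1, le_rfl, .push S i b⟩

theorem RunsIn.sel {i body S n S'} (o : Option Bool) (l : List Bool) (ho : (S i).head? = o)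
    (hl : (S i).tail = l) (h : RunsIn (body o) (update S i l) n S') :
    RunsIn (.sel i body) S (n + 1) S' := by
  subst ho hl
  exact let ⟨t, ht, hr⟩ := h; ⟨t + 1, Nat.succ_le_succ ht, hr.sel⟩

theorem RunsIn.loop_nil {i body S} (h : S i = []) : RunsIn (.loop i body) S 1 S :=
  ⟨1, le_rfl, .loop_nil h⟩

theorem RunsIn.loop_cons {i body S b l m S' n S''} (h : S i = b :: l)
    (h₁ : RunsIn (body b) (update S i l) m S') (h₂ : RunsIn (.loop i body) S' n S'') :
    RunsIn (.loop i body) S (m + n + 1) S'' :=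
  let ⟨t, ht, hr⟩ := h₁
  let ⟨t', ht', hr'⟩ := h₂
  ⟨t + t' + 1, Nat.succ_le_succ (add_le_add ht ht'), .loop_cons h hr hr'⟩

/-- The first stacks are listed, the other ones are empty. -/
def st (L : List (List Bool)) : ℕ → List Bool := fun i => L.getD i []

theorem st_apply (L : List (List Bool)) (i : ℕ) : st L i = L.getD i [] := rfl

theorem update_st (L : List (List Bool)) (i : ℕ) (l : List Bool) (hi : i < L.length) :
    update (st L) i l = st (L.set i l) := by
  funext j
  by_cases h : j = i
  · subst h; simp [st, hi]
  · rw [update_of_ne h]; simp [st, Ne.symm h]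

theorem st_append_nil (L : List (List Bool)) : st (L ++ [[]]) = st L := by
  funext j
  simp only [st, List.getD_eq_getElem?_getD, List.getElem?_append]
  split
  · rfl
  · rename_i h
    rw [List.getElem?_eq_none (l := L) (by omega)]
    cases j - L.length <;> simp

theorem onlyFirst_eq (l : List Bool) : onlyFirst l = st [l] := by
  funext i
  rcases i with _ | i <;> simp [st, onlyFirst]

/-- A shifted program works on the last one of the listed stacks. -/
theorem RunsIn.call {p n x y} (h : RunsIn p (st [x]) n (st [y])) (L : List (List Bool)) :
    RunsIn (p.shift L.length) (st (L ++ [x])) n (st (L ++ [y])) := by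
  obtain ⟨t, ht, hr⟩ := h
  refine ⟨t, ht, ?_⟩
  convert hr.shift L.length (st (L ++ [x])) ?_ using 1
  · funext i
    simp only [st, List.getD_eq_getElem?_getD, List.getElem?_append]
    split <;> rfl
  · intro i
    simp [st, List.getElem?_append]

/-- Move the contents of stack `i` to stack `j`, in reverse order. -/
def move (i j : ℕ) : StackProg := .loop i fun b => .push j b

theorem move_runs (i j : ℕ) (hij : i ≠ j) (l S) (hS : S i = l) :
    RunsIn (move i j) S (2 * l.length + 1) (update (update S j (l.reverse ++ S j)) i []) := by
  induction l generalizing S with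
  | nil =>
    refine (RunsIn.loop_nil hS).cast ?_
    funext k
    simp only [update_apply]
    split_ifs <;> simp_all
  | cons b l ih =>
    refine ((RunsIn.loop_cons hS (.push _ _ _) (ih _ ?_)).mono ?_).cast ?_
    · rw [update_of_ne hij, update_self]
    · simp; omega
    · rw [update_comm hij, update_of_ne hij.symm]
      funext k
      simp only [update_apply]
      split_ifs <;> simp_all

theorem move_st (i j : ℕ) (L : List (List Bool)) (hij : i ≠ j) (hi : i < L.length)
    (hj : j < L.length) (n : ℕ) (hn : (L.getD i []).length ≤ n) :
    RunsIn (move i j) (st L) (2 * n + 1)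
      (st ((L.set j ((L.getD i []).reverse ++ L.getD j [])).set i [])) := by
  refine ((move_runs i j hij _ (st L) rfl).mono (by rw [st_apply]; omega)).cast ?_
  rw [update_st _ _ _ hj, update_st _ _ _ (by simpa using hi)]
  rfl

/-- Empty stack `i`. -/
def clear (i : ℕ) : StackProg := .loop i fun _ => .skip

theorem clear_st (i : ℕ) (L : List (List Bool)) (hi : i < L.length)
    (n : ℕ) (hn : (L.getD i []).length ≤ n) :
    RunsIn (clear i) (st L) (2 * n + 1) (st (L.set i [])) := by
  have key : ∀ l S, S i = l → RunsIn (clear i) S (2 * l.length + 1) (update S i []) := by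
    intro l
    induction l with
    | nil =>
      intro S hS
      refine (RunsIn.loop_nil hS).cast ?_
      simp [← hS]
    | cons b l ih =>
      intro S hS
      refine ((RunsIn.loop_cons hS (.skip _) (ih _ ?_)).mono ?_).cast ?_
      · rw [update_self]
      · simp; omega
      · simp
  refine ((key _ (st L) rfl).mono (by rw [st_apply]; omega)).cast ?_
  rw [update_st _ _ _ hi]

/-- Move the contents of stack `i` to both stacks `j` and `k`, in reverse order. -/
def move₂ (i j k : ℕ) : StackProg := .loop i fun b => .seq (.push j b) (.push k b)

theorem move₂_st (i j k : ℕ) (L : List (List Bool)) (hij : i ≠ j) (hik : i ≠ k) (hjk : j ≠ k)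
    (hi : i < L.length) (hj : j < L.length) (hk : k < L.length)
    (n : ℕ) (hn : (L.getD i []).length ≤ n) :
    RunsIn (move₂ i j k) (st L) (3 * n + 1)
      (st (((L.set j ((L.getD i []).reverse ++ L.getD j [])).set k
        ((L.getD i []).reverse ++ L.getD k [])).set i [])) := by
  have key : ∀ l S, S i = l → RunsIn (move₂ i j k) S (3 * l.length + 1)
      (update (update (update S j (l.reverse ++ S j)) k (l.reverse ++ S k)) i []) := by
    intro l
    induction l with
    | nil =>
      intro S hS
      refine (RunsIn.loop_nil hS).cast ?_
      funext m
      simp only [update_apply]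
      split_ifs <;> simp_all
    | cons b l ih =>
      intro S hS
      refine ((RunsIn.loop_cons hS ((RunsIn.push _ _ _).seq (.push _ _ _)) (ih _ ?_)).mono ?_).cast
        ?_
      · rw [update_of_ne hik, update_of_ne hij, update_self]
      · simp; omega
      · funext m
        simp only [update_apply]
        split_ifs <;> simp_all
  refine ((key _ (st L) rfl).mono (by rw [st_apply]; omega)).cast ?_
  rw [update_st _ _ _ hj, update_st _ _ _ (by simpa using hk), update_st _ _ _ (by simpa using hi)]
  rfl

/-- Move as many trees as there are symbols on stack `c` from stack `i` to stack `j`, reversing the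
order of the bits.  The stack `c` counts the subtrees that are still to be read. -/
def takeTrees (c i j : ℕ) : StackProg :=
  .loop c fun _ => .sel i fun o => match o with
    | none => .skip
    | some b => .seq (.push j b) (bif b then .seq (.push c true) (.push c true) else .skip)

theorem takeTrees_cons {c i j : ℕ} (hci : c ≠ i) (hcj : c ≠ j) (hij : i ≠ j) (t : Data)
    (S : ℕ → List Bool) (cs rest d : List Bool) {n S''}
    (h : RunsIn (takeTrees c i j)
      (update (update (update S c cs) i rest) j (t.code.reverse ++ d)) n S'') :
    RunsIn (takeTrees c i j)
      (update (update (update S c (true :: cs)) i (t.code ++ rest)) j d)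
      (5 * t.code.length + n) S'' := by
  induction t generalizing cs rest d n with
  | nil =>
    refine (RunsIn.loop_cons (b := true) (l := cs) (m := 3) ?_ ?_ h).mono ?_
    · simp [hci, hcj]
    · refine (RunsIn.sel (some false) rest ?_ ?_ ((RunsIn.push _ _ _).seq (.skip _))).cast ?_
      · simp [hci.symm, hij, Data.code]
      · simp [hci.symm, hij, Data.code]
      · funext m
        simp only [update_apply, Data.code]
        split_ifs <;> simp_all
    · simp [Data.code]
  | pair x y ihx ihy =>
    have h1 : RunsIn (takeTrees c i j) _ _ _ := ihx (true :: cs) (y.code ++ rest) (true :: d)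
      (ihy cs rest (x.code.reverse ++ true :: d) (by simpa [Data.code] using h))
    refine (RunsIn.loop_cons (b := true) (l := cs) (m := 4) ?_ ?_ h1).mono ?_
    · simp [hci, hcj]
    · refine (RunsIn.sel (some true) (x.code ++ (y.code ++ rest)) ?_ ?_ ((RunsIn.push _ _ _).seq
        ((RunsIn.push _ _ _).seq (.push _ _ _)))).cast ?_
      · simp [hci.symm, hij, Data.code]
      · simp [hci.symm, hij, Data.code]
      · funext m
        simp only [update_apply]
        split_ifs <;> simp_all
    · simp [Data.code]; omega

/-- Move one tree from stack `i` to stack `j`. -/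
theorem takeTrees_one {c i j : ℕ} (hci : c ≠ i) (hcj : c ≠ j) (hij : i ≠ j) (L : List (List Bool))
    (hc : c < L.length) (hi : i < L.length) (hj : j < L.length) (t : Data) (rest : List Bool)
    (hLc : L.getD c [] = [true]) (hLi : L.getD i [] = t.code ++ rest)
    (n : ℕ) (hn : t.code.length ≤ n) :
    RunsIn (takeTrees c i j) (st L) (5 * n + 1)
      (st (((L.set c []).set i rest).set j (t.code.reverse ++ L.getD j []))) := by
  have h := takeTrees_cons hci hcj hij t (st L) [] rest (st L j)
    (RunsIn.loop_nil (by simp [hci, hcj]))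
  have h0 : update (update (update (st L) c [true]) i (t.code ++ rest)) j (st L j) = st L := by
    rw [← hLc, ← hLi, ← st_apply, ← st_apply]
    simp
  rw [h0] at h
  refine (h.mono (by omega)).cast ?_
  rw [update_st _ _ _ hc, update_st _ _ _ (by simpa using hi), update_st _ _ _ (by simpa using hj)]
  rfl

end StackProg

/-! ### Polynomial-time functions on tree-like data -/

open StackProg

/-- The code of an element, as a bit string. -/
def bits {α : Type} [TreeCoded α] (a : α) : List Bool := (TreeCoded.tree a).code

/-- The length of the code of an element. -/
def size {α : Type} [TreeCoded α] (a : α) : ℕ := (bits a).length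

theorem Data.one_le_length_code (t : Data) : 1 ≤ t.code.length := by
  cases t <;> simp [Data.code]

theorem one_le_size {α : Type} [TreeCoded α] (a : α) : 1 ≤ size a := Data.one_le_length_code _

/-- The function is computed by a stack program within a number of steps that is polynomial in the
size of the input. -/
@[fun_prop]
def PolyTime {α β : Type} [TreeCoded α] [TreeCoded β] (f : α → β) : Prop :=
  ∃ (p : StackProg) (q : Polynomial ℕ), ∀ a,
    RunsIn p (st [bits a]) (q.eval (size a)) (st [bits (f a)])

/-- A numerical function of an element is bounded by a polynomial in the size of the element. -/
def PolyBounded {α : Type} [TreeCoded α] (h : α → ℕ) : Prop :=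
  ∃ q : Polynomial ℕ, ∀ a, h a ≤ q.eval (size a)

section Basic

variable {α β γ δ : Type} [TreeCoded α] [TreeCoded β] [TreeCoded γ] [TreeCoded δ]

theorem PolyBounded.mono {h h' : α → ℕ} (hh : PolyBounded h) (hle : ∀ a, h' a ≤ h a) :
    PolyBounded h' :=
  let ⟨q, hq⟩ := hh
  ⟨q, fun a => (hle a).trans (hq a)⟩

theorem PolyBounded.add {h h' : α → ℕ} (hh : PolyBounded h) (hh' : PolyBounded h') :
    PolyBounded fun a => h a + h' a :=
  let ⟨q, hq⟩ := hh
  let ⟨q', hq'⟩ := hh'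
  ⟨q + q', fun a => by rw [Polynomial.eval_add]; exact add_le_add (hq a) (hq' a)⟩

theorem PolyBounded.mul {h h' : α → ℕ} (hh : PolyBounded h) (hh' : PolyBounded h') :
    PolyBounded fun a => h a * h' a :=
  let ⟨q, hq⟩ := hh
  let ⟨q', hq'⟩ := hh'
  ⟨q * q', fun a => by rw [Polynomial.eval_mul]; exact Nat.mul_le_mul (hq a) (hq' a)⟩

theorem PolyBounded.const (n : ℕ) : PolyBounded fun _ : α => n :=
  ⟨Polynomial.C n, fun a => by simp⟩

theorem PolyBounded.self : PolyBounded (size : α → ℕ) := ⟨Polynomial.X, fun a => by simp⟩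

theorem PolyBounded.eval {h : α → ℕ} (hh : PolyBounded h) (q : Polynomial ℕ) :
    PolyBounded fun a => q.eval (h a) :=
  let ⟨r, hr⟩ := hh
  ⟨q.comp r, fun a => by rw [Polynomial.eval_comp]; exact eval_mono q (hr a)⟩

theorem PolyTime.size_le {f : α → β} (hf : PolyTime f) : PolyBounded fun a => size (f a) := by
  obtain ⟨p, q, hp⟩ := hf
  refine (PolyBounded.self.add (PolyBounded.self.eval q)).mono fun a => ?_
  obtain ⟨t, ht, hr⟩ := hp a
  have h1 : (bits (f a)).length ≤ (bits a).length + t := hr.length_le 0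
  exact h1.trans (Nat.add_le_add_left ht _)

/-- A function is computable in polynomial time, if there is a program for it whose running time is
bounded by a polynomial. -/
theorem PolyTime.of_runsIn {f : α → β} (p : StackProg) {h : α → ℕ} (hh : PolyBounded h)
    (hp : ∀ a, RunsIn p (st [bits a]) (h a) (st [bits (f a)])) : PolyTime f :=
  let ⟨q, hq⟩ := hh
  ⟨p, q, fun a => (hp a).mono (hq a)⟩

/-- Changes of the type that do not change the code cost nothing. -/
theorem PolyTime.of_tree_eq {f : α → β} (h : ∀ a, TreeCoded.tree (f a) = TreeCoded.tree a) :
    PolyTime f := by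
  refine .of_runsIn .skip (.const 1) fun a => ?_
  rw [bits, bits, h]
  exact .skip _

@[fun_prop]
theorem PolyTime.id : PolyTime fun a : α => a := .of_tree_eq fun _ => rfl

@[fun_prop]
theorem PolyTime.comp {g : β → γ} {f : α → β} (hg : PolyTime g) (hf : PolyTime f) :
    PolyTime fun a => g (f a) := by
  have hs := hf.size_le
  obtain ⟨p, q, hp⟩ := hf
  obtain ⟨p', q', hp'⟩ := hg
  exact .of_runsIn (.seq p p') ((PolyBounded.self.eval q).add (hs.eval q'))
    fun a => (hp a).seq (hp' (f a))

theorem st_pad (l : List Bool) (n : ℕ) : st ([l] ++ List.replicate n []) = st [l] := by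
  induction n with
  | zero => rfl
  | succ n ih => rw [List.replicate_succ', ← List.append_assoc, st_append_nil, ih]

theorem PolyTime.of_tree_nil {f : α → β} (h : ∀ a, TreeCoded.tree (f a) = .nil) :
    PolyTime f := by
  refine .of_runsIn (.seq (clear 0) (.push 0 false))
    (((PolyBounded.const 2).mul .self).add (.const 2)) fun a => ?_
  refine ((clear_st 0 [bits a] (by simp) (size a) le_rfl).seq (.push _ _ _)).cast ?_
  rw [update_st _ _ _ (by simp), bits, bits, h]
  rfl

/-- The program that duplicates the input, runs both programs and pairs the results. -/
theorem PolyTime.of_tree_pair {f : α → β} {g : α → γ} {h : α → δ} (hf : PolyTime f)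
    (hg : PolyTime g)
    (hh : ∀ a, TreeCoded.tree (h a) = .pair (TreeCoded.tree (f a)) (TreeCoded.tree (g a))) :
    PolyTime h := by
  have hsf := hf.size_le
  have hsg := hg.size_le
  obtain ⟨p, q, hp⟩ := hf
  obtain ⟨p', q', hp'⟩ := hg
  have hself : PolyBounded (size : α → ℕ) := .self
  obtain ⟨B, hB⟩ : ∃ B : α → ℕ, B = fun a => size a + size (f a) + size (g a) := ⟨_, rfl⟩
  have hBb : PolyBounded B := hB ▸ (hself.add hsf).add hsg
  refine .of_runsIn (.seq (move 0 1) <| .seq (move₂ 1 0 2) <| .seq (p.shift 2) <|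
    .seq (move 2 1) <| .seq (move 0 2) <| .seq (move 2 3) <| .seq (p'.shift 3) <|
    .seq (move 3 2) <| .seq (move 2 0) <| .seq (move 1 0) <| .push 0 true)
    (h := fun a => 17 * B a + 10 + q.eval (size a) + q'.eval (size a))
    (((((PolyBounded.const 17).mul hBb).add (.const 10)).add (hself.eval q)).add
      (hself.eval q')) fun a => ?_
  have b1 : (bits a).length ≤ B a := by rw [hB]; simp only [size]; omega
  have b2 : (bits (f a)).length ≤ B a := by rw [hB]; simp only [size]; omega
  have b3 : (bits (g a)).length ≤ B a := by rw [hB]; simp only [size]; omega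
  have e1 : RunsIn (move 0 1) (st [bits a]) (2 * B a + 1)
      (st [[], (bits a).reverse ++ [], [], []]) :=
    st_pad (bits a) 3 ▸ move_st 0 1 [bits a, [], [], []] (by simp) (by simp) (by simp) (B a) b1
  have e2 : RunsIn (move₂ 1 0 2) (st [[], (bits a).reverse ++ [], [], []]) (3 * B a + 1)
      (st [bits a, [], bits a]) := by
    refine (move₂_st 1 0 2 [[], (bits a).reverse ++ [], [], []] (by simp) (by simp) (by simp)
      (by simp) (by simp) (by simp) (B a) (by simpa using b1)).cast ?_
    simpa using st_append_nil [bits a, [], bits a]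
  have e3 : RunsIn (p.shift 2) (st [bits a, [], bits a]) _ (st [bits a, [], bits (f a)]) :=
    (hp a).call [bits a, []]
  have e4 : RunsIn (move 2 1) (st [bits a, [], bits (f a)]) (2 * B a + 1)
      (st [bits a, (bits (f a)).reverse ++ [], []]) :=
    move_st 2 1 [bits a, [], bits (f a)] (by simp) (by simp) (by simp) (B a) b2
  have e5 : RunsIn (move 0 2) (st [bits a, (bits (f a)).reverse ++ [], []]) (2 * B a + 1)
      (st [[], (bits (f a)).reverse, (bits a).reverse, []]) := by
    refine (move_st 0 2 [bits a, (bits (f a)).reverse ++ [], []] (by simp) (by simp) (by simp)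
      (B a) b1).cast ?_
    simpa using (st_append_nil [[], (bits (f a)).reverse, (bits a).reverse]).symm
  have e6 : RunsIn (move 2 3) (st [[], (bits (f a)).reverse, (bits a).reverse, []]) (2 * B a + 1)
      (st [[], (bits (f a)).reverse, [], bits a]) := by
    refine (move_st 2 3 [[], (bits (f a)).reverse, (bits a).reverse, []] (by simp) (by simp)
      (by simp) (B a) (by simpa using b1)).cast ?_
    simp
  have e7 : RunsIn (p'.shift 3) (st [[], (bits (f a)).reverse, [], bits a]) _
      (st [[], (bits (f a)).reverse, [], bits (g a)]) :=
    (hp' a).call [[], (bits (f a)).reverse, []]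
  have e8 : RunsIn (move 3 2) (st [[], (bits (f a)).reverse, [], bits (g a)]) (2 * B a + 1)
      (st [[], (bits (f a)).reverse, (bits (g a)).reverse ++ [], []]) :=
    move_st 3 2 [[], (bits (f a)).reverse, [], bits (g a)] (by simp) (by simp) (by simp) (B a) b3
  have e9 : RunsIn (move 2 0) (st [[], (bits (f a)).reverse, (bits (g a)).reverse ++ [], []])
      (2 * B a + 1) (st [bits (g a), (bits (f a)).reverse, [], []]) := by
    refine (move_st 2 0 [[], (bits (f a)).reverse, (bits (g a)).reverse ++ [], []] (by simp)
      (by simp) (by simp) (B a) (by simpa using b3)).cast ?_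
    simp
  have e10 : RunsIn (move 1 0) (st [bits (g a), (bits (f a)).reverse, [], []]) (2 * B a + 1)
      (st [bits (f a) ++ bits (g a)]) := by
    refine (move_st 1 0 [bits (g a), (bits (f a)).reverse, [], []] (by simp)
      (by simp) (by simp) (B a) (by simpa using b2)).cast ?_
    simpa using st_pad (bits (f a) ++ bits (g a)) 3
  have e11 : RunsIn (.push 0 true) (st [bits (f a) ++ bits (g a)]) 1 (st [bits (h a)]) := by
    refine (RunsIn.push _ _ _).cast ?_
    rw [update_st _ _ _ (by simp)]
    rw [bits, bits, bits, hh]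
    rfl
  refine (e1.seq <| e2.seq <| e3.seq <| e4.seq <| e5.seq <| e6.seq <| e7.seq <| e8.seq <|
    e9.seq <| e10.seq e11).mono ?_
  omega

/-- The program that reads the first subtree and drops the rest. -/
theorem PolyTime.of_tree_fst {f : α → β}
    (h : ∀ a, ∃ y, TreeCoded.tree a = .pair (TreeCoded.tree (f a)) y) : PolyTime f := by
  have hself : PolyBounded (size : α → ℕ) := .self
  refine .of_runsIn (.sel 0 fun _ => .seq (.push 1 true) <| .seq (takeTrees 1 0 2) <|
    .seq (clear 0) (move 2 0)) (h := fun a => 9 * size a + 5)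
    (((PolyBounded.const 9).mul hself).add (.const 5)) fun a => ?_
  obtain ⟨y, hy⟩ := h a
  have hb : bits a = true :: (bits (f a) ++ y.code) := by rw [bits, hy]; rfl
  have hl : size a = 1 + ((bits (f a)).length + y.code.length) := by simp [size, hb]; omega
  have e0 : RunsIn (.push 1 true) (st [bits (f a) ++ y.code, [], []]) 1
      (st [bits (f a) ++ y.code, [true], []]) := by
    refine (RunsIn.push _ _ _).cast ?_
    rw [update_st _ _ _ (by simp)]
    rfl
  have e1 : RunsIn (takeTrees 1 0 2) (st [bits (f a) ++ y.code, [true], []]) (5 * size a + 1)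
      (st [y.code, [], (bits (f a)).reverse ++ []]) :=
    takeTrees_one (by simp) (by simp) (by simp) [bits (f a) ++ y.code, [true], []] (by simp)
      (by simp) (by simp) _ y.code rfl rfl (size a) (by simp only [bits] at hl; omega)
  have e2 : RunsIn (clear 0) (st [y.code, [], (bits (f a)).reverse ++ []]) (2 * size a + 1)
      (st [[], [], (bits (f a)).reverse ++ []]) :=
    clear_st 0 [y.code, [], (bits (f a)).reverse ++ []] (by simp) (size a) (by simp; omega)
  have e3 : RunsIn (move 2 0) (st [[], [], (bits (f a)).reverse ++ []]) (2 * size a + 1)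
      (st [bits (f a)]) := by
    refine (move_st 2 0 [[], [], (bits (f a)).reverse ++ []] (by simp) (by simp) (by simp)
      (size a) (by simp; omega)).cast ?_
    simpa using st_pad (bits (f a)) 2
  refine (RunsIn.sel (some true) (bits (f a) ++ y.code) (by simp [st, hb]) (by simp [st, hb]) ?_
    (n := 9 * size a + 4))
  rw [update_st _ _ _ (by simp)]
  refine RunsIn.mono (st_pad (bits (f a) ++ y.code) 2 ▸ e0.seq (e1.seq (e2.seq e3))) ?_
  omega

/-- The program that drops the first subtree. -/
theorem PolyTime.of_tree_snd {f : α → β}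
    (h : ∀ a, ∃ x, TreeCoded.tree a = .pair x (TreeCoded.tree (f a))) : PolyTime f := by
  have hself : PolyBounded (size : α → ℕ) := .self
  refine .of_runsIn (.sel 0 fun _ => .seq (.push 1 true) <| .seq (takeTrees 1 0 2) <|
    clear 2) (h := fun a => 7 * size a + 4)
    (((PolyBounded.const 7).mul hself).add (.const 4)) fun a => ?_
  obtain ⟨x, hx⟩ := h a
  have hb : bits a = true :: (x.code ++ bits (f a)) := by rw [bits, hx]; rfl
  have hl : size a = 1 + (x.code.length + (bits (f a)).length) := by simp [size, hb]; omega
  have e0 : RunsIn (.push 1 true) (st [x.code ++ bits (f a), [], []]) 1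
      (st [x.code ++ bits (f a), [true], []]) := by
    refine (RunsIn.push _ _ _).cast ?_
    rw [update_st _ _ _ (by simp)]
    rfl
  have e1 : RunsIn (takeTrees 1 0 2) (st [x.code ++ bits (f a), [true], []]) (5 * size a + 1)
      (st [bits (f a), [], x.code.reverse ++ []]) :=
    takeTrees_one (by simp) (by simp) (by simp) [x.code ++ bits (f a), [true], []] (by simp)
      (by simp) (by simp) _ _ rfl rfl (size a) (by omega)
  have e2 : RunsIn (clear 2) (st [bits (f a), [], x.code.reverse ++ []]) (2 * size a + 1)
      (st [bits (f a)]) := by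
    refine (clear_st 2 [bits (f a), [], x.code.reverse ++ []] (by simp) (size a)
      (by simp; omega)).cast ?_
    simpa using st_pad (bits (f a)) 2
  refine (RunsIn.sel (some true) (x.code ++ bits (f a)) (by simp [st, hb]) (by simp [st, hb]) ?_
    (n := 7 * size a + 3))
  rw [update_st _ _ _ (by simp)]
  refine RunsIn.mono (st_pad (x.code ++ bits (f a)) 2 ▸ e0.seq (e1.seq e2)) ?_
  omega

/-- The program that branches according to whether the first subtree is `nil`. -/
theorem PolyTime.of_tree_cases {g : β → δ} {h : γ → δ} (hg : PolyTime g) (hh : PolyTime h)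
    {f : α → δ}
    (hf : ∀ a, (∃ b, TreeCoded.tree a = .pair .nil (TreeCoded.tree b) ∧ f a = g b) ∨
      (∃ x y z c, TreeCoded.tree a = .pair (.pair x y) z ∧ TreeCoded.tree c = TreeCoded.tree a ∧
        f a = h c)) : PolyTime f := by
  obtain ⟨p, q, hp⟩ := hg
  obtain ⟨p', q', hp'⟩ := hh
  have hself : PolyBounded (size : α → ℕ) := .self
  refine .of_runsIn (.sel 0 fun _ => .sel 0 fun o => match o with
    | some true => .seq (.push 0 true) (.seq (.push 0 true) p')
    | _ => p) (h := fun a => q.eval (size a) + q'.eval (size a) + 4)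
    (((hself.eval q).add (hself.eval q')).add (.const 4)) fun a => ?_
  rcases hf a with ⟨b, hb, hfb⟩ | ⟨x, y, z, c, hc, hca, hfc⟩
  · have hba : bits a = true :: false :: bits b := by rw [bits, hb]; rfl
    have hle : size b ≤ size a := by simp [size, hba]; omega
    have := eval_mono q hle
    refine (RunsIn.sel (some true) (false :: bits b) (by simp [st, hba]) (by simp [st, hba])
      (RunsIn.sel (some false) (bits b) (by simp) (by simp) ?_
        (n := q.eval (size a)))).mono (by omega)
    rw [hfb, update_st _ _ _ (by simp), update_st _ _ _ (by simp)]
    exact (hp b).mono this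
  · have hba : bits a = true :: true :: (x.code ++ y.code ++ z.code) := by rw [bits, hc]; rfl
    have hcb : bits c = bits a := by rw [bits, hca]; rfl
    have hs : size c = size a := by rw [size, hcb]; rfl
    refine (RunsIn.sel (some true) (true :: (x.code ++ y.code ++ z.code)) (by simp [st, hba])
      (by simp [st, hba])
      (RunsIn.sel (some true) (x.code ++ y.code ++ z.code) (by simp) (by simp)
        ((RunsIn.push _ _ _).seq ((RunsIn.push _ _ _).seq ?_ (n := q'.eval (size a)))))).mono
      (by omega)
    have := hp' c
    rw [hcb, hs, ← hfc, hba] at this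
    rw [update_st _ _ _ (by simp), update_st _ _ _ (by simp), update_st _ _ _ (by simp),
      update_st _ _ _ (by simp)]
    exact this

end Basic

/-! ### Encodings of the basic types -/

instance : TreeCoded Unit := ⟨fun _ => .nil⟩

instance : TreeCoded Bool := ⟨fun b => bif b then .pair .nil .nil else .nil⟩

instance {α β : Type} [TreeCoded α] [TreeCoded β] : TreeCoded (α × β) :=
  ⟨fun p => .pair (TreeCoded.tree p.1) (TreeCoded.tree p.2)⟩

/-- The tree of a list: its right spine consists of the cells of the list. -/
def listTree {α : Type} [TreeCoded α] : List α → Data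
  | [] => .nil
  | a :: l => .pair (TreeCoded.tree a) (listTree l)

instance {α : Type} [TreeCoded α] : TreeCoded (List α) := ⟨listTree⟩

/-- Natural numbers are encoded in unary. -/
instance : TreeCoded ℕ := ⟨fun n => listTree (List.replicate n ())⟩

section

variable {α β γ δ : Type} [TreeCoded α] [TreeCoded β] [TreeCoded γ] [TreeCoded δ]

@[simp] theorem bits_nil : bits ([] : List α) = [false] := rfl

@[simp] theorem bits_cons (a : α) (l : List α) : bits (a :: l) = true :: (bits a ++ bits l) := rfl

@[simp] theorem bits_prod (a : α) (b : β) : bits (a, b) = true :: (bits a ++ bits b) := rfl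

@[simp] theorem size_nil : size ([] : List α) = 1 := rfl

@[simp] theorem size_cons (a : α) (l : List α) : size (a :: l) = size a + size l + 1 := by
  simp [size]

@[simp] theorem size_prod (a : α) (b : β) : size (a, b) = size a + size b + 1 := by
  simp [size]

theorem size_nat (n : ℕ) : size n = 2 * n + 1 := by
  induction n with
  | zero => rfl
  | succ n ih =>
    have : bits (n + 1) = true :: (bits () ++ bits n) := rfl
    have h1 : (bits ()).length = 1 := rfl
    simp only [size] at ih ⊢
    rw [this]
    simp only [List.length_cons, List.length_append, ih, h1]
    omega

theorem size_bool_le (b : Bool) : size b ≤ 3 := by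
  cases b <;> simp [size, bits, TreeCoded.tree, Data.code]

theorem size_append (l l' : List α) : size (l ++ l') + 1 = size l + size l' := by
  induction l with
  | nil => simp; omega
  | cons a l ih => simp; omega

theorem length_lt_size (l : List α) : l.length < size l := by
  induction l with
  | nil => simp
  | cons a l ih => have := one_le_size a; simp; omega

theorem size_le_of_mem {a : α} {l : List α} (h : a ∈ l) : size a ≤ size l := by
  induction l with
  | nil => cases h
  | cons b l ih =>
    rcases List.mem_cons.1 h with rfl | h
    · simp; omega
    · have := ih h; simp; omega

theorem size_le_mul (l : List α) (B : ℕ) (h : ∀ a ∈ l, size a ≤ B) :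
    size l ≤ l.length * (B + 1) + 1 := by
  induction l with
  | nil => simp
  | cons a l ih =>
    have h1 := ih fun b hb => h b (List.mem_cons_of_mem _ hb)
    have h2 := h a List.mem_cons_self
    simp only [size_cons, List.length_cons, Nat.succ_mul]
    omega

/-! ### Pairs, cases and folds -/

@[fun_prop]
theorem PolyTime.pair {f : α → β} {g : α → γ} (hf : PolyTime f) (hg : PolyTime g) :
    PolyTime fun a => (f a, g a) := .of_tree_pair hf hg fun _ => rfl

@[fun_prop]
theorem PolyTime.fst {f : α → β × γ} (hf : PolyTime f) : PolyTime fun a => (f a).1 :=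
  (PolyTime.of_tree_fst (f := Prod.fst) fun _ => ⟨_, rfl⟩).comp hf

@[fun_prop]
theorem PolyTime.snd {f : α → β × γ} (hf : PolyTime f) : PolyTime fun a => (f a).2 :=
  (PolyTime.of_tree_snd (f := Prod.snd) fun _ => ⟨_, rfl⟩).comp hf

theorem PolyTime.nil : PolyTime fun _ : α => ([] : List β) := .of_tree_nil fun _ => rfl

@[fun_prop]
theorem PolyTime.cons {f : α → β} {g : α → List β} (hf : PolyTime f) (hg : PolyTime g) :
    PolyTime fun a => f a :: g a := .of_tree_pair hf hg fun _ => rfl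

theorem PolyTime.list_cases {l : α → List β} {g : α → γ} {h : α → β → List β → γ}
    (hl : PolyTime l) (hg : PolyTime g)
    (hh : PolyTime fun p : α × β × List β => h p.1 p.2.1 p.2.2) :
    PolyTime fun a => match l a with
      | [] => g a
      | b :: t => h a b t := by
  refine (PolyTime.of_tree_cases (f := fun p : List β × α => match p.1 with
    | [] => g p.2
    | b :: t => h p.2 b t) (h := fun p : (β × List β) × α => h p.2 p.1.1 p.1.2) hg
    (hh.comp (.pair (.snd .id) (.pair (.fst (.fst .id)) (.snd (.fst .id))))) ?_).comp
    (.pair hl .id)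
  rintro ⟨_ | ⟨b, t⟩, a⟩
  · exact .inl ⟨a, rfl, rfl⟩
  · exact .inr ⟨_, _, _, ((b, t), a), rfl, rfl, rfl⟩

@[fun_prop]
theorem PolyTime.cond {c : α → Bool} {f g : α → β} (hc : PolyTime c) (hf : PolyTime f)
    (hg : PolyTime g) : PolyTime fun a => bif c a then f a else g a := by
  have h := PolyTime.list_cases (l := fun a => bif c a then [()] else []) (h := fun a _ _ => f a)
    (PolyTime.comp (f := c) (g := fun b => bif b then [()] else [])
      (.of_tree_eq fun b => by cases b <;> rfl) hc) hg (hf.comp (.fst .id))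
  convert h using 2 with a
  cases c a <;> rfl

/-- The program that folds a function over a list.  Stack `1` holds the rest of the list, stack `4`
holds the current state. -/
def foldProg (p : StackProg) : StackProg :=
  .sel 0 fun _ => .seq (.push 2 true) <| .seq (takeTrees 2 0 3) <| .seq (move 3 1) <|
    .seq (move 0 3) <| .seq (move 3 4) <| .seq
      (.loop 1 fun b => bif b then
          .seq (.push 2 true) <| .seq (takeTrees 2 1 3) <| .seq (move 3 4) <|
          .seq (.push 4 true) (p.shift 4)
        else .skip) <|
    .seq (move 4 3) (move 3 0)

theorem foldProg_loop {g : γ → β → γ} {p : StackProg} {q : Polynomial ℕ}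
    (hp : ∀ x : β × γ, RunsIn p (st [bits x]) (q.eval (size x)) (st [bits (g x.2 x.1)]))
    (m B : ℕ) (l : List β) (s : γ) (hm : ∀ b ∈ l, size b ≤ m)
    (hB : ∀ l', l' <+: l → size (l'.foldl g s) ≤ B) :
    RunsIn (.loop 1 fun b => bif b then
          .seq (.push 2 true) <| .seq (takeTrees 2 1 3) <| .seq (move 3 4) <|
          .seq (.push 4 true) (p.shift 4)
        else .skip)
      (st [[], bits l, [], [], bits s]) (l.length * (7 * m + 5 + q.eval (m + B + 1)) + 3)
      (st [[], [], [], [], bits (l.foldl g s)]) := by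
  induction l generalizing s with
  | nil =>
    refine (RunsIn.loop_cons (b := false) (l := []) rfl (.skip _) (.loop_nil ?_)).mono
      (by simp) |>.cast ?_
    · simp
    · rw [update_st _ _ _ (by simp)]; rfl
  | cons b l ih =>
    have e0 : RunsIn (.push 2 true) (st [[], bits b ++ bits l, [], [], bits s]) 1
        (st [[], bits b ++ bits l, [true], [], bits s]) := by
      refine (RunsIn.push _ _ _).cast ?_
      rw [update_st _ _ _ (by simp)]
      rfl
    have hb := hm b List.mem_cons_self
    have e1 : RunsIn (takeTrees 2 1 3) (st [[], bits b ++ bits l, [true], [], bits s]) (5 * m + 1)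
        (st [[], bits l, [], (bits b).reverse ++ [], bits s]) :=
      takeTrees_one (by simp) (by simp) (by simp) [[], bits b ++ bits l, [true], [], bits s]
        (by simp) (by simp) (by simp) _ _ rfl rfl m hb
    have e2 : RunsIn (move 3 4) (st [[], bits l, [], (bits b).reverse ++ [], bits s]) (2 * m + 1)
        (st [[], bits l, [], [], bits b ++ bits s]) := by
      refine (move_st 3 4 [[], bits l, [], (bits b).reverse ++ [], bits s] (by simp) (by simp)
        (by simp) m (by simpa [size] using hb)).cast ?_
      simp
    have e3 : RunsIn (.push 4 true) (st [[], bits l, [], [], bits b ++ bits s]) 1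
        (st [[], bits l, [], [], bits (b, s)]) := by
      refine (RunsIn.push _ _ _).cast ?_
      rw [update_st _ _ _ (by simp)]
      rfl
    have e4 : RunsIn (p.shift 4) (st [[], bits l, [], [], bits (b, s)]) (q.eval (m + B + 1))
        (st [[], bits l, [], [], bits (g s b)]) := by
      refine ((hp (b, s)).call [[], bits l, [], []]).mono (eval_mono q ?_)
      have := hB [] List.nil_prefix
      simp only [size_prod, List.foldl_nil] at this ⊢
      omega
    have e5 := ih (g s b) (fun c hc => hm c (List.mem_cons_of_mem _ hc)) fun l' hl' =>
      hB (b :: l') (List.cons_prefix_cons.2 ⟨rfl, hl'⟩)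
    refine (RunsIn.loop_cons (b := true) (l := bits b ++ bits l) rfl ?_ e5
      (m := 1 + (5 * m + 1 + (2 * m + 1 + (1 + q.eval (m + B + 1)))))).mono ?_
    · rw [update_st _ _ _ (by simp)]
      exact e0.seq (e1.seq (e2.seq (e3.seq e4)))
    · simp only [List.length_cons, Nat.succ_mul]
      omega

theorem foldProg_runs {g : γ → β → γ} {p : StackProg} {q : Polynomial ℕ}
    (hp : ∀ x : β × γ, RunsIn p (st [bits x]) (q.eval (size x)) (st [bits (g x.2 x.1)]))
    (B : ℕ) (l : List β) (s : γ) (hB : ∀ l', l' <+: l → size (l'.foldl g s) ≤ B) :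
    RunsIn (foldProg p) (st [bits (l, s)])
      (size l * (7 * size l + 5 + q.eval (size l + B + 1)) + 7 * size l + 8 * B + 11)
      (st [bits (l.foldl g s)]) := by
  have hs : (bits s).length ≤ B := hB [] List.nil_prefix
  have hf : (bits (l.foldl g s)).length ≤ B := hB l List.prefix_rfl
  have e0 : RunsIn (.push 2 true) (st [bits l ++ bits s, [], [], [], []]) 1
      (st [bits l ++ bits s, [], [true], [], []]) := by
    refine (RunsIn.push _ _ _).cast ?_
    rw [update_st _ _ _ (by simp)]
    rfl
  have e1 : RunsIn (takeTrees 2 0 3) (st [bits l ++ bits s, [], [true], [], []]) (5 * size l + 1)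
      (st [bits s, [], [], (bits l).reverse ++ [], []]) :=
    takeTrees_one (by simp) (by simp) (by simp) [bits l ++ bits s, [], [true], [], []]
      (by simp) (by simp) (by simp) _ _ rfl rfl (size l) le_rfl
  have e2 : RunsIn (move 3 1) (st [bits s, [], [], (bits l).reverse ++ [], []]) (2 * size l + 1)
      (st [bits s, bits l, [], [], []]) := by
    refine (move_st 3 1 [bits s, [], [], (bits l).reverse ++ [], []] (by simp) (by simp)
      (by simp) (size l) (by simp [size])).cast ?_
    simp
  have e3 : RunsIn (move 0 3) (st [bits s, bits l, [], [], []]) (2 * B + 1)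
      (st [[], bits l, [], (bits s).reverse ++ [], []]) :=
    move_st 0 3 [bits s, bits l, [], [], []] (by simp) (by simp) (by simp) B hs
  have e4 : RunsIn (move 3 4) (st [[], bits l, [], (bits s).reverse ++ [], []]) (2 * B + 1)
      (st [[], bits l, [], [], bits s]) := by
    refine (move_st 3 4 [[], bits l, [], (bits s).reverse ++ [], []] (by simp) (by simp)
      (by simp) B (by simpa using hs)).cast ?_
    simp
  have e5 := foldProg_loop hp (size l) B l s (fun b hb => size_le_of_mem hb) hB
  have e6 : RunsIn (move 4 3) (st [[], [], [], [], bits (l.foldl g s)]) (2 * B + 1)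
      (st [[], [], [], (bits (l.foldl g s)).reverse ++ [], []]) :=
    move_st 4 3 [[], [], [], [], bits (l.foldl g s)] (by simp) (by simp) (by simp) B hf
  have e7 : RunsIn (move 3 0) (st [[], [], [], (bits (l.foldl g s)).reverse ++ [], []]) (2 * B + 1)
      (st [bits (l.foldl g s)]) := by
    refine (move_st 3 0 [[], [], [], (bits (l.foldl g s)).reverse ++ [], []] (by simp) (by simp)
      (by simp) B (by simpa using hf)).cast ?_
    simpa using st_pad (bits (l.foldl g s)) 4
  refine (RunsIn.sel (some true) (bits l ++ bits s) rfl rfl ?_).mono le_rfl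
  rw [update_st _ _ _ (by simp)]
  refine RunsIn.mono (st_pad (bits l ++ bits s) 4 ▸
    e0.seq (e1.seq (e2.seq (e3.seq (e4.seq (e5.seq (e6.seq e7))))))) ?_
  have := Nat.mul_le_mul_right (7 * size l + 5 + q.eval (size l + B + 1)) (length_lt_size l).le
  omega

/-- Folds are computable in polynomial time, if the states that occur are of polynomial size. -/
theorem PolyTime.foldl_of_bounded {g : γ → β → γ} (hg : PolyTime fun x : γ × β => g x.1 x.2)
    {l : α → List β} {s : α → γ} (hl : PolyTime l) (hs : PolyTime s) {B : α → ℕ}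
    (hBb : PolyBounded B) (hB : ∀ a l', l' <+: l a → size (l'.foldl g (s a)) ≤ B a) :
    PolyTime fun a => (l a).foldl g (s a) := by
  have hg' : PolyTime fun x : β × γ => g x.2 x.1 :=
    hg.comp (f := fun x : β × γ => (x.2, x.1)) (.pair (.snd .id) (.fst .id))
  have hls := hl.pair hs
  have hsl := hl.size_le
  have hsls := hls.size_le
  obtain ⟨p, q, hp⟩ := hg'
  obtain ⟨p', q', hp'⟩ := hls
  refine .of_runsIn (.seq p' (foldProg p)) ?_ fun a =>
    (hp' a).seq (foldProg_runs hp (B a) (l a) (s a) (hB a))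
  exact (PolyBounded.self.eval q').add <| (((hsl.mul ((((PolyBounded.const 7).mul hsl).add
    (.const 5)).add (((hsl.add hBb).add (.const 1)).eval q))).add ((PolyBounded.const 7).mul
    hsl)).add ((PolyBounded.const 8).mul hBb)).add (.const 11)

/-- Folds with a parameter `a` are computable in polynomial time, if every step increases the size
of the state by at most a polynomial in the size of `a`. -/
theorem PolyTime.foldl {g : α → γ → β → γ} (hg : PolyTime fun x : α × γ × β => g x.1 x.2.1 x.2.2)
    {l : α → List β} {s : α → γ} (hl : PolyTime l) (hs : PolyTime s) {B : α → ℕ}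
    (hBb : PolyBounded B) (hB : ∀ a s, ∀ b ∈ l a, size (g a s b) ≤ size s + B a) :
    PolyTime fun a => (l a).foldl (g a) (s a) := by
  have key : ∀ (a : α) (l' : List β) (t : γ),
      (l'.foldl (fun (x : γ × α) b => (g x.2 x.1 b, x.2)) (t, a)) = (l'.foldl (g a) t, a) := by
    intro a l'
    induction l' with
    | nil => intro t; rfl
    | cons b l' ih => intro t; exact ih _
  have h := PolyTime.foldl_of_bounded (g := fun (x : γ × α) b => (g x.2 x.1 b, x.2)) (l := l)
    (s := fun a => (s a, a)) (α := α)
    (.pair (hg.comp (.pair (.snd (.fst .id)) (.pair (.fst (.fst .id)) (.snd .id))))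
      (.snd (.fst .id))) hl (hs.pair .id)
    (((hs.size_le.add (hl.size_le.mul hBb)).add PolyBounded.self).add (.const 1)) ?_
  · simp only [key] at h
    exact h.fst
  · intro a l' hl'
    rw [key, size_prod]
    have h2 : ∀ (l' : List β) (t : γ), l' ⊆ l a →
        size (l'.foldl (g a) t) ≤ size t + l'.length * B a := by
      intro l'
      induction l' with
      | nil => intro t _; simp
      | cons b l' ih =>
        intro t hsub
        have h3 := ih (g a t b) fun c hc => hsub (List.mem_cons_of_mem _ hc)
        have h4 := hB a t b (hsub List.mem_cons_self)
        simp only [List.foldl_cons, List.length_cons, Nat.succ_mul]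
        omega
    have h5 := h2 l' (s a) hl'.subset
    have h6 : l'.length * B a ≤ size (l a) * B a :=
      Nat.mul_le_mul_right _ (hl'.length_le.trans (length_lt_size _).le)
    omega

end

/-! ### A library of polynomial-time functions -/

namespace PolyTime

variable {α β γ δ : Type} [TreeCoded α] [TreeCoded β] [TreeCoded γ] [TreeCoded δ]

instance : TreeCoded Data := ⟨fun t => t⟩

@[fun_prop]
theorem const (c : β) : PolyTime fun _ : α => c := by
  have h : ∀ t : Data, PolyTime fun _ : α => t := by
    intro t
    induction t with
    | nil => exact .of_tree_nil fun _ => rfl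
    | pair x y ihx ihy => exact .of_tree_pair ihx ihy fun _ => rfl
  obtain ⟨p, q, hp⟩ := h (TreeCoded.tree c)
  exact ⟨p, q, hp⟩

/-! #### Lists -/

@[fun_prop]
theorem reverse {l : α → List β} (hl : PolyTime l) : PolyTime fun a => (l a).reverse := by
  have h := foldl (g := fun (_ : α) (acc : List β) b => b :: acc)
    (.cons (.snd (.snd .id)) (.fst (.snd .id))) hl (.nil)
    (B := fun a => size (l a) + 1) (hl.size_le.add (.const 1)) ?_
  · convert h using 2 with a
    simp
  · intro a s b hb
    have := size_le_of_mem hb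
    simp
    omega

@[fun_prop]
theorem append {l l' : α → List β} (hl : PolyTime l) (hl' : PolyTime l') :
    PolyTime fun a => l a ++ l' a := by
  have h := foldl (g := fun (_ : α) (acc : List β) b => b :: acc)
    (.cons (.snd (.snd .id)) (.fst (.snd .id))) hl.reverse hl'
    (B := fun a => size (l a) + 1) (hl.size_le.add (.const 1)) ?_
  · convert h using 2 with a
    simp
  · intro a s b hb
    have := size_le_of_mem (List.mem_reverse.1 hb)
    simp
    omega

@[fun_prop]
theorem map {l : α → List β} {f : α → β → γ} (hl : PolyTime l)
    (hf : PolyTime fun x : α × β => f x.1 x.2) : PolyTime fun a => (l a).map (f a) := by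
  obtain ⟨q, hq⟩ := hf.size_le
  have h := foldl (g := fun a (acc : List γ) b => f a b :: acc)
    (.cons (hf.comp (.pair (.fst .id) (.snd (.snd .id)))) (.fst (.snd .id))) hl (.nil)
    (B := fun a => q.eval (size a + size (l a) + 1) + 1)
    ((((PolyBounded.self.add hl.size_le).add (.const 1)).eval q).add (.const 1)) ?_
  · convert h.reverse using 2 with a
    have : ∀ (l : List β) acc, l.foldl (fun (acc : List γ) b => f a b :: acc) acc =
        (l.map (f a)).reverse ++ acc := by
      intro l
      induction l with
      | nil => simp
      | cons b l ih => intro acc; simp [ih]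
    simp [this]
  · intro a s b hb
    have h1 := size_le_of_mem hb
    have h2 := (hq (a, b)).trans (eval_mono q (n := size a + size (l a) + 1) (by simp; omega))
    simp only [size_cons] at h2 ⊢
    omega

@[fun_prop]
theorem flatten {l : α → List (List β)} (hl : PolyTime l) : PolyTime fun a => (l a).flatten := by
  have h := foldl (g := fun (_ : α) (acc b : List β) => acc ++ b)
    (.append (.fst (.snd .id)) (.snd (.snd .id))) hl (.nil)
    (B := fun a => size (l a)) hl.size_le ?_
  · convert h using 2 with a
    have : ∀ (L : List (List β)) acc, L.foldl (fun (acc b : List β) => acc ++ b) acc =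
        acc ++ L.flatten := by
      intro L
      induction L with
      | nil => simp
      | cons b L ih => intro acc; simp [ih]
    simp [this]
  · intro a s b hb
    have h1 := size_le_of_mem hb
    have h2 := size_append s b
    omega

@[fun_prop]
theorem flatMap {l : α → List β} {f : α → β → List γ} (hl : PolyTime l)
    (hf : PolyTime fun x : α × β => f x.1 x.2) : PolyTime fun a => (l a).flatMap (f a) := by
  convert (hl.map hf).flatten using 2 with a
  exact List.flatMap_def

@[fun_prop]
theorem not {c : α → Bool} (hc : PolyTime c) : PolyTime fun a => !c a := by
  convert hc.cond (.const false) (.const true) using 2 with a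
  cases c a <;> rfl

@[fun_prop]
theorem and {c d : α → Bool} (hc : PolyTime c) (hd : PolyTime d) :
    PolyTime fun a => c a && d a := by
  convert hc.cond hd (.const false) using 2 with a
  cases c a <;> rfl

@[fun_prop]
theorem or {c d : α → Bool} (hc : PolyTime c) (hd : PolyTime d) :
    PolyTime fun a => c a || d a := by
  convert hc.cond (.const true) hd using 2 with a
  cases c a <;> rfl

@[fun_prop]
theorem filter {l : α → List β} {f : α → β → Bool} (hl : PolyTime l)
    (hf : PolyTime fun x : α × β => f x.1 x.2) : PolyTime fun a => (l a).filter (f a) := by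
  convert hl.flatMap (f := fun a b => bif f a b then [b] else [])
    (hf.cond (.cons (.snd .id) .nil) .nil) using 2 with a
  induction l a with
  | nil => rfl
  | cons b l ih =>
    rw [List.filter_cons, List.flatMap_cons, ih]
    cases f a b <;> simp

@[fun_prop]
theorem isEmpty {l : α → List β} (hl : PolyTime l) : PolyTime fun a => (l a).isEmpty := by
  convert list_cases (h := fun _ _ _ => false) hl (.const true) (.const false) using 2 with a
  cases l a <;> rfl

@[fun_prop]
theorem any {l : α → List β} {f : α → β → Bool} (hl : PolyTime l)
    (hf : PolyTime fun x : α × β => f x.1 x.2) : PolyTime fun a => (l a).any (f a) := by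
  convert (hl.filter hf).isEmpty.not using 2 with a
  rw [Bool.eq_iff_iff]
  simp

@[fun_prop]
theorem all {l : α → List β} {f : α → β → Bool} (hl : PolyTime l)
    (hf : PolyTime fun x : α × β => f x.1 x.2) : PolyTime fun a => (l a).all (f a) := by
  convert (hl.any (f := fun a b => !f a b) hf.not).not using 2 with a
  rw [Bool.eq_iff_iff]
  simp

@[fun_prop]
theorem tail {l : α → List β} (hl : PolyTime l) : PolyTime fun a => (l a).tail := by
  convert list_cases (h := fun _ _ t => t) hl .nil (.snd (.snd .id)) using 2 with a
  cases l a <;> rfl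

@[fun_prop]
theorem headD {l : α → List β} {d : α → β} (hl : PolyTime l) (hd : PolyTime d) :
    PolyTime fun a => (l a).headD (d a) := by
  convert list_cases (h := fun _ b _ => b) hl hd (.fst (.snd .id)) using 2 with a
  cases l a <;> rfl

/-! #### Numbers -/

theorem toUnits {n : α → ℕ} (hn : PolyTime n) : PolyTime fun a => List.replicate (n a) () :=
  (of_tree_eq (f := fun n : ℕ => List.replicate n ()) fun _ => rfl).comp hn

@[fun_prop]
theorem length {l : α → List β} (hl : PolyTime l) : PolyTime fun a => (l a).length := by
  have h : PolyTime fun l : List Unit => l.length := by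
    refine of_tree_eq fun l => ?_
    change listTree (List.replicate l.length ()) = listTree l
    congr 1
    exact (List.eq_replicate_of_mem fun _ _ => rfl).symm
  convert h.comp (hl.map (f := fun _ _ => ()) (.const ())) using 2 with a
  simp

@[fun_prop]
theorem succ {n : α → ℕ} (hn : PolyTime n) : PolyTime fun a => n a + 1 := by
  convert (PolyTime.cons (.const ()) hn.toUnits).length using 2 with a
  simp

@[fun_prop]
theorem pred {n : α → ℕ} (hn : PolyTime n) : PolyTime fun a => n a - 1 := by
  convert hn.toUnits.tail.length using 2 with a
  simp

@[fun_prop]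
theorem sub {m n : α → ℕ} (hm : PolyTime m) (hn : PolyTime n) : PolyTime fun a => m a - n a := by
  have h := foldl (g := fun (_ : α) (s : ℕ) (_ : Unit) => s - 1) (.pred (.fst (.snd .id)))
    hn.toUnits hm (B := fun _ => 0) (.const 0) ?_
  · convert h using 2 with a
    have : ∀ n m, (List.replicate n ()).foldl (fun (s : ℕ) _ => s - 1) m = m - n := by
      intro n
      induction n with
      | zero => simp
      | succ n ih => intro m; rw [List.replicate_succ, List.foldl_cons, ih]; omega
    rw [this]
  · intro a s b _
    simp only [size_nat]
    omega

@[fun_prop]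
theorem nat_le {m n : α → ℕ} (hm : PolyTime m) (hn : PolyTime n) :
    PolyTime fun a => decide (m a ≤ n a) := by
  convert (hm.sub hn).toUnits.isEmpty using 2 with a
  rw [Bool.eq_iff_iff]
  simp [Nat.sub_eq_zero_iff_le]

@[fun_prop]
theorem nat_lt {m n : α → ℕ} (hm : PolyTime m) (hn : PolyTime n) :
    PolyTime fun a => decide (m a < n a) := nat_le hm.succ hn

@[fun_prop]
theorem nat_eq {m n : α → ℕ} (hm : PolyTime m) (hn : PolyTime n) :
    PolyTime fun a => decide (m a = n a) := by
  convert (nat_le hm hn).and (nat_le hn hm) using 2 with a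
  rw [Bool.eq_iff_iff]
  simp only [decide_eq_true_eq, Bool.and_eq_true]
  omega

@[fun_prop]
theorem drop {l : α → List β} {n : α → ℕ} (hl : PolyTime l) (hn : PolyTime n) :
    PolyTime fun a => (l a).drop (n a) := by
  have h := foldl (g := fun (_ : α) (s : List β) (_ : Unit) => s.tail) (.tail (.fst (.snd .id)))
    hn.toUnits hl (B := fun _ => 0) (.const 0) ?_
  · convert h using 2 with a
    have : ∀ n (l : List β), (List.replicate n ()).foldl (fun (s : List β) _ => s.tail) l =
        l.drop n := by
      intro n
      induction n with
      | zero => simp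
      | succ n ih => intro l; rw [List.replicate_succ, List.foldl_cons, ih]; simp
    rw [this]
  · intro a s b _
    cases s <;> simp
    omega

@[fun_prop]
theorem getD {l : α → List β} {n : α → ℕ} {d : α → β} (hl : PolyTime l) (hn : PolyTime n)
    (hd : PolyTime d) : PolyTime fun a => (l a).getD (n a) (d a) := by
  convert (hl.drop hn).headD hd using 2 with a
  simp [List.headD_eq_head?_getD]

@[fun_prop]
theorem range {n : α → ℕ} (hn : PolyTime n) : PolyTime fun a => List.range (n a) := by
  have h := foldl (g := fun (a : α) (s : List ℕ) (_ : Unit) => (n a - (s.length + 1)) :: s)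
    (.cons (.sub (hn.comp (.fst .id)) (.succ (.length (.fst (.snd .id))))) (.fst (.snd .id)))
    hn.toUnits (.nil) (B := fun a => size (n a) + 1) (hn.size_le.add (.const 1)) ?_
  · convert h using 2 with a
    have : ∀ j m, (List.replicate j ()).foldl (fun (s : List ℕ) _ => (n a - (s.length + 1)) :: s)
        (List.range' (n a - m) m) = List.range' (n a - (m + j)) (m + j) ∨ n a < m + j := by
      intro j
      induction j with
      | zero => simp
      | succ j ih =>
        intro m
        by_cases hm : n a < m + (j + 1)
        · exact .inr hm
        left
        rw [List.replicate_succ, List.foldl_cons]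
        have h1 := (ih (m + 1)).resolve_right (by omega)
        rw [show m + 1 + j = m + (j + 1) by ring] at h1
        rw [← h1, List.length_range', List.range'_succ]
        congr 3
        omega
    have h2 := (this (n a) 0).resolve_right (by omega)
    simp only [List.range'_zero, zero_add, Nat.sub_self] at h2
    rw [h2, List.range_eq_range']
  · intro a s b _
    simp only [size_nat, size_cons]
    omega

/-! #### Equality tests -/

@[fun_prop]
theorem bool_eq {c d : α → Bool} (hc : PolyTime c) (hd : PolyTime d) :
    PolyTime fun a => decide (c a = d a) := by
  convert hc.cond hd hd.not using 2 with a
  cases c a <;> cases d a <;> rfl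

/-- Lists are compared by a fold over the first one, whose state holds the result so far and the
rest of the second list. -/
theorem list_eq [DecidableEq β] (hβ : PolyTime fun x : β × β => decide (x.1 = x.2))
    {l l' : α → List β} (hl : PolyTime l) (hl' : PolyTime l') :
    PolyTime fun a => decide (l a = l' a) := by
  have h := foldl (g := fun (_ : α) (s : Bool × List β) (b : β) =>
      (s.1 && (s.2.take 1 |>.any fun c => decide (b = c)), s.2.tail))
    (.pair (.and (.fst (.fst (.snd .id))) (.any (?_) (hβ.comp (.pair (.snd (.snd (.fst .id)))
      (.snd .id))))) (.tail (.snd (.fst (.snd .id))))) hl (.pair (.const true) hl')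
    (B := fun _ => 3) (.const 3) ?_
  · convert (h.fst.and h.snd.isEmpty) using 2 with a
    have : ∀ (l l' : List β) (c : Bool),
        (fun s : Bool × List β => s.1 && s.2.isEmpty) (l.foldl (fun (s : Bool × List β) (b : β) =>
          (s.1 && (s.2.take 1 |>.any fun c => decide (b = c)), s.2.tail)) (c, l')) =
          (c && decide (l = l')) := by
      intro l
      induction l with
      | nil => intro l' c; cases l' <;> simp
      | cons b l ih =>
        intro l' c
        rw [List.foldl_cons, ih]
        cases l' with
        | nil => simp
        | cons b' l' =>
          rw [Bool.eq_iff_iff]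
          simp only [List.take_succ_cons, List.take_zero, List.any_cons, List.any_nil,
            Bool.or_false, List.tail_cons, Bool.and_eq_true, decide_eq_true_eq, List.cons.injEq, and_assoc]
          exact and_congr_right fun _ => and_congr_right fun _ => decide_eq_true_iff
    simpa using (this (l a) (l' a) true).symm
  · convert list_cases (l := fun x : α × (Bool × List β) × β => x.2.1.2)
      (h := fun _ b _ => [b]) (.snd (.fst (.snd .id))) .nil
      (.cons (.fst (.snd .id)) .nil) using 2 with a
    cases a.2.1.2 <;> rfl
  · intro a s b _
    have h1 := size_bool_le (s.1 && (s.2.take 1 |>.any fun c => decide (b = c)))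
    have h2 : size s.2.tail ≤ size s.2 := by
      cases s.2 <;> simp
      omega
    have h3 : size s = size s.1 + size s.2 + 1 := size_prod s.1 s.2
    rw [size_prod]
    omega

@[fun_prop]
theorem string_eq {l l' : α → List Bool} (hl : PolyTime l) (hl' : PolyTime l') :
    PolyTime fun a => decide (l a = l' a) :=
  list_eq (bool_eq (.fst .id) (.snd .id)) hl hl'

end PolyTime

/-! ### Conversion of raw bit strings -/

/-- The program that turns a bit string into its code. -/
def encodeProg : StackProg :=
  .seq (move 0 1) <| .seq (.push 0 false) <| .loop 1 fun b => bif b then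
      .seq (.push 0 false) (.seq (.push 0 false) (.seq (.push 0 true) (.push 0 true)))
    else .seq (.push 0 false) (.push 0 true)

theorem encodeProg_runs (l : List Bool) :
    RunsIn encodeProg (st [l]) (7 * l.length + 3) (st [bits l]) := by
  have e1 : RunsIn (move 0 1) (st [l]) (2 * l.length + 1) (st [[], l.reverse ++ []]) :=
    st_pad l 1 ▸ move_st 0 1 [l, []] (by simp) (by simp) (by simp) l.length le_rfl
  have e2 : RunsIn (.push 0 false) (st [[], l.reverse ++ []]) 1
      (st [[false], l.reverse ++ []]) := by
    refine (RunsIn.push _ _ _).cast ?_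
    rw [update_st _ _ _ (by simp)]
    rfl
  have e3 : ∀ l r : List Bool, RunsIn (.loop 1 fun b => bif b then
      .seq (.push 0 false) (.seq (.push 0 false) (.seq (.push 0 true) (.push 0 true)))
      else .seq (.push 0 false) (.push 0 true)) (st [bits r, l]) (5 * l.length + 1)
      (st [bits (l.reverse ++ r)]) := by
    intro l
    induction l with
    | nil => intro r; exact (RunsIn.loop_nil rfl).cast (st_pad (bits r) 1)
    | cons b l ih =>
      intro r
      refine ((RunsIn.loop_cons (b := b) (l := l) rfl ?_ (ih (b :: r)) (m := 4)).mono
        (by simp; omega)).cast (by simp)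
      cases b
      · refine (((RunsIn.push _ _ _).seq (.push _ _ _)).mono (by omega)).cast ?_
        rw [update_st _ _ _ (by simp), update_st _ _ _ (by simp), update_st _ _ _ (by simp)]
        rfl
      · refine (((RunsIn.push _ _ _).seq ((RunsIn.push _ _ _).seq ((RunsIn.push _ _ _).seq
          (.push _ _ _)))).mono (by omega)).cast ?_
        rw [update_st _ _ _ (by simp), update_st _ _ _ (by simp), update_st _ _ _ (by simp),
          update_st _ _ _ (by simp), update_st _ _ _ (by simp)]
        rfl
  refine ((e1.seq (e2.seq (e3 _ []))).mono ?_).cast (by simp)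
  simp
  omega

/-- The program that turns the code of a bit string into the bit string. -/
def decodeProg : StackProg :=
  .seq (.loop 0 fun b => bif b then
      .sel 0 fun o => match o with
        | some true => .sel 0 fun _ => .sel 0 fun _ => .push 1 true
        | _ => .push 1 false
    else .skip) (move 1 0)

theorem decodeProg_runs (l : List Bool) :
    RunsIn decodeProg (st [bits l]) (7 * l.length + 4) (st [l]) := by
  have e1 : ∀ l r : List Bool, RunsIn (.loop 0 fun b => bif b then
      .sel 0 fun o => match o with
        | some true => .sel 0 fun _ => .sel 0 fun _ => .push 1 true
        | _ => .push 1 false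
      else .skip) (st [bits l, r]) (5 * l.length + 3) (st [[], l.reverse ++ r]) := by
    intro l
    induction l with
    | nil =>
      intro r
      refine ((RunsIn.loop_cons (b := false) (l := []) rfl (.skip _) (.loop_nil ?_))).mono
        (by simp) |>.cast ?_
      · simp
      · rw [update_st _ _ _ (by simp)]; rfl
    | cons b l ih =>
      intro r
      refine ((RunsIn.loop_cons (b := true) (l := bits b ++ bits l) rfl ?_ (ih (b :: r))
        (m := 4)).mono (by simp; omega)).cast (by simp)
      rw [update_st _ _ _ (by simp)]
      cases b
      · refine ((RunsIn.sel (some false) (bits l) rfl rfl (RunsIn.push _ _ _)).mono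
          (by omega)).cast ?_
        rw [update_st _ _ _ (by simp), update_st _ _ _ (by simp)]
        rfl
      · refine ((RunsIn.sel (some true) (false :: false :: bits l) rfl rfl ?_)).mono le_rfl
        rw [update_st _ _ _ (by simp)]
        refine ((RunsIn.sel (some false) (false :: bits l) rfl rfl ?_)).mono le_rfl
        rw [update_st _ _ _ (by simp)]
        refine ((RunsIn.sel (some false) (bits l) rfl rfl (RunsIn.push _ _ _))).mono le_rfl |>.cast
          ?_
        rw [update_st _ _ _ (by simp), update_st _ _ _ (by simp)]
        rfl
  have e2 : RunsIn (move 1 0) (st [[], l.reverse]) (2 * l.length + 1) (st [l]) := by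
    refine (move_st 1 0 [[], l.reverse] (by simp) (by simp) (by simp) l.length (by simp)).cast ?_
    simpa using st_pad l 1
  have e3 := e1 l []
  rw [List.append_nil, show st [bits l, []] = st [bits l] from st_pad (bits l) 1] at e3
  exact (e3.seq e2).mono (by omega)

/-- Polynomial-time functions on bit strings are computed by stack programs on raw bit strings. -/
theorem PolyTime.exists_progComputes {h : List Bool → List Bool} (hh : PolyTime h) :
    ∃ p, ProgComputes p h := by
  obtain ⟨Q, hQ⟩ := hh.size_le
  obtain ⟨p, q, hp⟩ := hh
  have hs : ∀ l : List Bool, size l ≤ 4 * l.length + 1 := by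
    intro l
    have := size_le_mul l 3 fun b _ => size_bool_le b
    omega
  refine ⟨.seq encodeProg (.seq p decodeProg), (Polynomial.C 7 * Polynomial.X + Polynomial.C 3) +
    (q.comp (Polynomial.C 4 * Polynomial.X + Polynomial.C 1) +
      (Polynomial.C 7 * Q.comp (Polynomial.C 4 * Polynomial.X + Polynomial.C 1) +
        Polynomial.C 4)), fun l => ?_⟩
  have h1 := (encodeProg_runs l).seq ((hp l).seq (decodeProg_runs (h l)))
  rw [← onlyFirst_eq, ← onlyFirst_eq] at h1
  refine RunsIn.mono h1 ?_
  simp only [Polynomial.eval_add, Polynomial.eval_mul, Polynomial.eval_C, Polynomial.eval_X,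
    Polynomial.eval_comp]
  have h2 := eval_mono q (hs l)
  have h3 := eval_mono Q (hs l)
  have h4 : size (h l) ≤ Q.eval (size l) := hQ l
  have h5 := length_lt_size (h l)
  omega

/-! ### Reading and writing instances in polynomial time -/

section Parse

variable {α β : Type} [TreeCoded α] [TreeCoded β]

@[fun_prop]
theorem PolyTime.unary {n : α → ℕ} (hn : PolyTime n) : PolyTime fun a => unary (n a) := by
  have h : PolyTime fun a => (List.replicate (n a) ()).map (fun _ => true) ++ [false] :=
    (hn.toUnits.map (.const true)).append (.const _)
  simpa only [List.map_replicate, ParamComplexity.unary] using h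

@[fun_prop]
theorem PolyTime.inputString {f : α → List Bool × ℕ} (hf : PolyTime f) :
    PolyTime fun a => inputString (f a) := by
  unfold ParamComplexity.inputString
  fun_prop

@[fun_prop]
theorem PolyTime.encodeEntry {f : α → List Bool} (hf : PolyTime f) :
    PolyTime fun a => encodeEntry (f a) := by
  unfold ParamComplexity.encodeEntry
  fun_prop

@[fun_prop]
theorem PolyTime.encodeTable {f : α → List (List (List Bool))} (hf : PolyTime f) :
    PolyTime fun a => encodeTable (f a) := by
  unfold ParamComplexity.encodeTable ParamComplexity.encodeLine
  fun_prop

/-- One step of `splitUnary`: the state says whether the delimiter has been read, and holds the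
number read and the rest of the string in reverse order. -/
def splitUnaryStep (s : Bool × ℕ × List Bool) (b : Bool) : Bool × ℕ × List Bool :=
  bif s.1 then (true, s.2.1, b :: s.2.2)
  else bif b then (false, s.2.1 + 1, s.2.2) else (true, s.2.1, s.2.2)

/-- Split a number in unary off a string. -/
def splitUnary (l : List Bool) : ℕ × List Bool :=
  let s := l.foldl splitUnaryStep (false, 0, [])
  (s.2.1, s.2.2.reverse)

@[simp]
theorem splitUnary_unary_append (n : ℕ) (l : List Bool) : splitUnary (unary n ++ l) = (n, l) := by
  have h1 : ∀ n m, (unary n ++ l).foldl splitUnaryStep (false, m, []) =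
      l.foldl splitUnaryStep (true, m + n, []) := by
    intro n
    induction n with
    | zero => intro m; rfl
    | succ n ih =>
      intro m
      have : unary (n + 1) = true :: unary n := rfl
      rw [this, List.cons_append, List.foldl_cons]
      refine (ih (m + 1)).trans ?_
      rw [show m + 1 + n = m + (n + 1) by ring]
  have h2 : ∀ (l r : List Bool) m, l.foldl splitUnaryStep (true, m, r) =
      (true, m, l.reverse ++ r) := by
    intro l
    induction l with
    | nil => intro r m; rfl
    | cons b l ih =>
      intro r m
      rw [List.foldl_cons]
      refine (ih (b :: r) m).trans ?_
      simp
  rw [splitUnary, h1, h2]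
  simp

@[fun_prop]
theorem PolyTime.splitUnary {f : α → List Bool} (hf : PolyTime f) :
    PolyTime fun a => splitUnary (f a) := by
  have h := PolyTime.foldl (g := fun (_ : α) s b => splitUnaryStep s b) (l := f)
    (s := fun _ => (false, 0, [])) (by unfold splitUnaryStep; fun_prop) hf (by fun_prop)
    (B := fun _ => 7) (.const _) ?_
  · unfold ParamComplexity.splitUnary
    fun_prop
  · rintro a ⟨s, n, r⟩ b -
    have h1 := size_bool_le b
    have h2 : size false = 1 := rfl
    have h3 : size true = 3 := rfl
    cases s <;> cases b <;> simp [splitUnaryStep, size_nat, h2, h3] <;> omega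

/-- One step of `decodeTable`.  The state holds the first bit of an incomplete token, and the
current entry, the current line and the table so far, all of them in reverse order. -/
def decodeTableStep (s : List Bool × List Bool × List (List Bool) × List (List (List Bool)))
    (b : Bool) : List Bool × List Bool × List (List Bool) × List (List (List Bool)) :=
  bif s.1.isEmpty then ([b], s.2)
  else bif s.1.headD false then
    bif b then ([], s.2.1, [], s.2.2.1.reverse :: s.2.2.2)
    else ([], [], s.2.1.reverse :: s.2.2.1, s.2.2.2)
  else ([], b :: s.2.1, s.2.2)

/-- Read a table; the result is of interest for strings that encode a table only. -/
def decodeTable (l : List Bool) : List (List (List Bool)) :=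
  (l.foldl decodeTableStep ([], [], [], [])).2.2.2.reverse

@[simp]
theorem decodeTable_encodeTable (t : List (List (List Bool))) :
    decodeTable (encodeTable t) = t := by
  have h1 : ∀ (s : List Bool) e L T,
      (s.flatMap (fun b => [false, b])).foldl decodeTableStep ([], e, L, T) =
        ([], s.reverse ++ e, L, T) := by
    intro s
    induction s with
    | nil => intro e L T; rfl
    | cons b s ih =>
      intro e L T
      rw [List.flatMap_cons, List.foldl_append]
      refine (ih (b :: e) L T).trans ?_
      simp
  have h2 : ∀ s L T, (encodeEntry s).foldl decodeTableStep ([], [], L, T) =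
      ([], [], s :: L, T) := by
    intro s L T
    rw [encodeEntry, List.foldl_append, h1]
    simp [decodeTableStep]
  have h3 : ∀ (l : List (List Bool)) L T,
      (l.flatMap encodeEntry).foldl decodeTableStep ([], [], L, T) =
        ([], [], l.reverse ++ L, T) := by
    intro l
    induction l with
    | nil => intro L T; rfl
    | cons s l ih =>
      intro L T
      rw [List.flatMap_cons, List.foldl_append, h2, ih]
      simp
  have h4 : ∀ l T, (encodeLine l).foldl decodeTableStep ([], [], [], T) = ([], [], [], l :: T) := by
    intro l T
    rw [encodeLine, List.foldl_append, h3]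
    simp [decodeTableStep]
  have h5 : ∀ t T, (encodeTable t).foldl decodeTableStep ([], [], [], T) =
      ([], [], [], t.reverse ++ T) := by
    intro t
    induction t with
    | nil => intro T; rfl
    | cons l t ih =>
      intro T
      rw [encodeTable, List.flatMap_cons, List.foldl_append, h4]
      refine (ih (l :: T)).trans ?_
      simp
  rw [decodeTable, h5]
  simp

theorem size_reverse (l : List α) : size l.reverse = size l := by
  induction l with
  | nil => rfl
  | cons a l ih =>
    have := size_append l.reverse [a]
    simp at this ⊢
    omega

@[fun_prop]
theorem PolyTime.decodeTable {f : α → List Bool} (hf : PolyTime f) :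
    PolyTime fun a => decodeTable (f a) := by
  have h := PolyTime.foldl (g := fun (_ : α) s b => decodeTableStep s b) (l := f)
    (s := fun _ => ([], [], [], [])) (by unfold decodeTableStep; fun_prop) hf (by fun_prop)
    (B := fun _ => 7) (.const _) ?_
  · unfold ParamComplexity.decodeTable
    fun_prop
  · rintro a ⟨p, e, L, T⟩ b -
    have h1 := size_bool_le b
    rcases p with _ | ⟨p, p'⟩
    · simp [decodeTableStep]
      omega
    · cases p <;> cases b <;> simp [decodeTableStep, size_reverse] <;> omega

end Parse

/-! ### Polynomial-time many-one reductions -/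

/-- A parameterized reduction can be followed by a polynomial-time map that increases the
parameter by at most one. -/
theorem Reducible.trans_polyTime {Q P P' : Problem} (hQ : Reducible Q P)
    {red : List Bool → ℕ → List Bool × ℕ} (hred : PolyTime fun x : List Bool × ℕ => red x.1 x.2)
    (hk : ∀ I k, (red I k).2 ≤ k + 1) (hiff : ∀ I k, (I, k) ∈ P ↔ red I k ∈ P') :
    Reducible Q P' := by
  have h : PolyTime fun l : List Bool =>
      inputString (red (splitUnary l).2 (splitUnary l).1) :=
    .inputString (hred.comp (f := fun l => ((splitUnary l).2, (splitUnary l).1)) (by fun_prop))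
  obtain ⟨p, hp⟩ := h.exists_progComputes
  refine hQ.trans_prog hp (red' := fun x => red x.1 x.2) (fun x => ?_) (g' := fun k => k + 1)
    Computable.succ (fun _ _ h => Nat.succ_le_succ h) (fun x => hk _ _) fun x => hiff _ _
  have hx : splitUnary (inputString x) = (x.2, x.1) := splitUnary_unary_append _ _
  simp only [hx]

/-! ### Databases as lists of lists -/

/-- `n` attributes and a list of rows with `n` entries each make up a database. -/
def IsTable (n : ℕ) (rows : List (List (List Bool))) : Prop :=
  0 < n ∧ ∀ r ∈ rows, r.length = n

/-- The functional dependency `X → a` holds in the list of rows. -/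
def ListFD (rows : List (List (List Bool))) (X : Finset ℕ) (a : ℕ) : Prop :=
  ∀ s ∈ rows, ∀ t ∈ rows, (∀ b ∈ X, s.getD b [] = t.getD b []) → s.getD a [] = t.getD a []

/-- `U` is a unique column combination of the list of rows. -/
def ListUCC (rows : List (List (List Bool))) (U : Finset ℕ) : Prop :=
  ∀ s ∈ rows, ∀ t ∈ rows, s ≠ t → ∃ b ∈ U, s.getD b [] ≠ t.getD b []

/-- There is a valid, non-trivial functional dependency with right-hand side `a`, the size of whose
left-hand side satisfies `p`. -/
def HasFD (p : ℕ → Prop) (n : ℕ) (rows : List (List (List Bool))) (a : ℕ) : Prop :=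
  ∃ X ⊆ Finset.range n, p X.card ∧ a ∉ X ∧ ListFD rows X a

theorem exists_database_iff {I : List Bool} {p : ℕ → List (List (List Bool)) → Prop} :
    (∃ D : Database, I = D.encode ∧ p D.n (D.rows.map List.ofFn)) ↔
      ∃ n rows, IsTable n rows ∧ I = unary n ++ encodeTable rows ∧ p n rows := by
  constructor
  · rintro ⟨D, hI, hp⟩
    refine ⟨D.n, D.rows.map List.ofFn, ⟨D.n_pos, ?_⟩, hI, hp⟩
    intro r hr
    obtain ⟨s, -, rfl⟩ := List.mem_map.1 hr
    simp
  · rintro ⟨n, rows, ⟨hn, hr⟩, hI, hp⟩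
    have h : (rows.map fun r (i : Fin n) => r.getD i []).map List.ofFn = rows := by
      rw [List.map_map]
      refine (List.map_congr_left fun r hr' => ?_).trans (List.map_id _)
      refine List.ext_getElem (by simp [hr r hr']) fun i h1 h2 => ?_
      rw [id_eq] at h2
      simp [h2]
    exact ⟨⟨n, hn, _⟩, by rw [hI, Database.encode, h], by rwa [h]⟩

theorem getD_ofFn {n : ℕ} (s : Fin n → List Bool) (b : Fin n) :
    (List.ofFn s).getD b [] = s b := by
  simp [List.getD_eq_getElem?_getD]

theorem exists_map_val_eq {n : ℕ} {X : Finset ℕ} (hX : X ⊆ Finset.range n) :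
    ∃ Y : Finset (Fin n), Y.map Fin.valEmbedding = X := by
  refine ⟨Finset.univ.filter fun i => (i : ℕ) ∈ X, ?_⟩
  ext i
  simp only [Finset.mem_map, Finset.mem_filter, Finset.mem_univ, true_and, Fin.valEmbedding_apply]
  constructor
  · rintro ⟨i, h, rfl⟩
    exact h
  · intro h
    exact ⟨⟨i, Finset.mem_range.1 (hX h)⟩, h, rfl⟩

theorem map_val_subset {n : ℕ} (Y : Finset (Fin n)) :
    Y.map Fin.valEmbedding ⊆ Finset.range n := by
  intro i hi
  obtain ⟨j, -, rfl⟩ := Finset.mem_map.1 hi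
  exact Finset.mem_range.2 j.2

theorem fdHolds_iff (D : Database) (X : Finset (Fin D.n)) (a : Fin D.n) :
    RelDB.FDHolds D.rowSet X a ↔
      ListFD (D.rows.map List.ofFn) (X.map Fin.valEmbedding) a := by
  simp only [RelDB.FDHolds, ListFD, Database.rowSet, Set.mem_ofPred_eq, List.forall_mem_map,
    Finset.forall_mem_map, Fin.valEmbedding_apply, getD_ofFn]

theorem isUCC_iff (D : Database) (U : Finset (Fin D.n)) :
    RelDB.IsUCC D.rowSet U ↔ ListUCC (D.rows.map List.ofFn) (U.map Fin.valEmbedding) := by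
  simp only [RelDB.IsUCC, ListUCC, Database.rowSet, Set.mem_ofPred_eq, List.forall_mem_map,
    Finset.mem_map, exists_exists_and_eq_and, Fin.valEmbedding_apply, getD_ofFn, ne_eq,
    List.ofFn_injective.eq_iff]

theorem exists_fdHolds_iff (p : ℕ → Prop) (D : Database) (a : Fin D.n) :
    (∃ X : Finset (Fin D.n), p X.card ∧ a ∉ X ∧ RelDB.FDHolds D.rowSet X a) ↔
      HasFD p D.n (D.rows.map List.ofFn) a := by
  constructor
  · rintro ⟨X, hp, ha, h⟩
    exact ⟨X.map Fin.valEmbedding, map_val_subset X, by simpa using hp,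
      (Finset.mem_map' Fin.valEmbedding).not.2 ha,
      (fdHolds_iff D X a).1 h⟩
  · rintro ⟨X, hX, hp, ha, h⟩
    obtain ⟨Y, rfl⟩ := exists_map_val_eq hX
    exact ⟨Y, by simpa using hp, (Finset.mem_map' Fin.valEmbedding).not.1 ha,
      (fdHolds_iff D Y a).2 h⟩

theorem mem_uniqueColumnCombination_iff {x : List Bool × ℕ} :
    x ∈ UniqueColumnCombination ↔ ∃ n rows, IsTable n rows ∧ x.1 = unary n ++ encodeTable rows ∧
      ∃ U ⊆ Finset.range n, U.card = x.2 ∧ ListUCC rows U := by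
  refine Iff.trans ?_ (exists_database_iff (p := fun n rows =>
    ∃ U ⊆ Finset.range n, U.card = x.2 ∧ ListUCC rows U))
  refine exists_congr fun D => and_congr_right fun _ => ⟨?_, ?_⟩
  · rintro ⟨U, hU, h⟩
    exact ⟨U.map Fin.valEmbedding, map_val_subset U, by simpa using hU, (isUCC_iff D U).1 h⟩
  · rintro ⟨U, hU, hc, h⟩
    obtain ⟨V, rfl⟩ := exists_map_val_eq hU
    exact ⟨V, by simpa using hc, (isUCC_iff D V).2 h⟩

/-- The two versions of the problem with arbitrary right-hand side: `p k` is the condition on the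
size of the left-hand side. -/
def FDProblem (p : ℕ → ℕ → Prop) : Problem :=
  {x | ∃ n rows, IsTable n rows ∧ x.1 = unary n ++ encodeTable rows ∧
    ∃ a < n, HasFD (p x.2) n rows a}

/-- The two versions of the problem with fixed right-hand side: `p k` is the condition on the size
of the left-hand side. -/
def FDFixedProblem (p : ℕ → ℕ → Prop) : Problem :=
  {x | ∃ a n rows, IsTable n rows ∧ x.1 = unary a ++ (unary n ++ encodeTable rows) ∧
    a < n ∧ HasFD (p x.2) n rows a}

theorem exists_fd_iff (p : ℕ → ℕ → Prop) (x : List Bool × ℕ) :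
    (∃ D : Database, x.1 = D.encode ∧ ∃ (X : Finset (Fin D.n)) (a : Fin D.n),
      p x.2 X.card ∧ a ∉ X ∧ RelDB.FDHolds D.rowSet X a) ↔ x ∈ FDProblem p := by
  refine Iff.trans ?_ (exists_database_iff (p := fun n rows => ∃ a < n, HasFD (p x.2) n rows a))
  refine exists_congr fun D => and_congr_right fun _ => ?_
  rw [exists_comm]
  simp only [exists_fdHolds_iff (p x.2)]
  exact ⟨fun ⟨a, h⟩ => ⟨a, a.2, h⟩, fun ⟨a, ha, h⟩ => ⟨⟨a, ha⟩, h⟩⟩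

theorem exists_fdFixed_iff (p : ℕ → ℕ → Prop) (x : List Bool × ℕ) :
    (∃ (D : Database) (a : Fin D.n), x.1 = unary a ++ D.encode ∧ ∃ X : Finset (Fin D.n),
      p x.2 X.card ∧ a ∉ X ∧ RelDB.FDHolds D.rowSet X a) ↔ x ∈ FDFixedProblem p := by
  simp only [exists_fdHolds_iff (p x.2)]
  constructor
  · rintro ⟨D, a, hx, h⟩
    obtain ⟨n, rows, ht, he, hp⟩ := (exists_database_iff (I := D.encode) (p := fun n rows =>
      (a : ℕ) < n ∧ HasFD (p x.2) n rows a)).1 ⟨D, rfl, a.2, h⟩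
    exact ⟨a, n, rows, ht, by rw [hx, he], hp⟩
  · rintro ⟨a, n, rows, ht, hx, hp⟩
    obtain ⟨D, he, ha, h⟩ := (exists_database_iff (p := fun n rows =>
      (a : ℕ) < n ∧ HasFD (p x.2) n rows a)).2 ⟨n, rows, ht, rfl, hp⟩
    exact ⟨D, ⟨a, ha⟩, by rw [hx, he], h⟩

theorem functionalDependency_eq : FunctionalDependency = FDProblem fun k c => c = k :=
  Set.ext fun x => exists_fd_iff (fun k c => c = k) x

theorem functionalDependencyAtMost_eq : FunctionalDependencyAtMost = FDProblem fun k c => c ≤ k :=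
  Set.ext fun x => exists_fd_iff (fun k c => c ≤ k) x

theorem fdFixedRHS_eq : FDFixedRHS = FDFixedProblem fun k c => c = k :=
  Set.ext fun x => exists_fdFixed_iff (fun k c => c = k) x

theorem fdFixedRHSAtMost_eq : FDFixedRHSAtMost = FDFixedProblem fun k c => c ≤ k :=
  Set.ext fun x => exists_fdFixed_iff (fun k c => c ≤ k) x

/-! #### Recognizing encodings of databases -/

/-- The rows of the database that is encoded by a string. -/
def readRows (I : List Bool) : List (List (List Bool)) := decodeTable (splitUnary I).2

/-- Whether the string encodes a database. -/
def isDatabase (I : List Bool) : Bool :=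
  decide (I = unary (splitUnary I).1 ++ encodeTable (readRows I)) &&
    (decide (0 < (splitUnary I).1) &&
      (readRows I).all fun r => decide (r.length = (splitUnary I).1))

section

variable {α : Type} [TreeCoded α]

@[fun_prop]
theorem PolyTime.readRows {f : α → List Bool} (hf : PolyTime f) :
    PolyTime fun a => readRows (f a) := by
  unfold ParamComplexity.readRows
  fun_prop

@[fun_prop]
theorem PolyTime.isDatabase {f : α → List Bool} (hf : PolyTime f) :
    PolyTime fun a => isDatabase (f a) := by
  unfold ParamComplexity.isDatabase
  fun_prop

end

theorem readRows_eq (n : ℕ) (rows : List (List (List Bool))) :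
    readRows (unary n ++ encodeTable rows) = rows := by
  simp [readRows]

theorem exists_table_iff {I : List Bool} {p : ℕ → List (List (List Bool)) → Prop} :
    (∃ n rows, IsTable n rows ∧ I = unary n ++ encodeTable rows ∧ p n rows) ↔
      isDatabase I = true ∧ p (splitUnary I).1 (readRows I) := by
  constructor
  · rintro ⟨n, rows, ⟨hn, hr⟩, rfl, hp⟩
    rw [isDatabase, readRows_eq, splitUnary_unary_append]
    refine ⟨?_, hp⟩
    simpa using ⟨hn, hr⟩
  · rintro ⟨hI, hp⟩
    rw [isDatabase] at hI
    simp only [Bool.and_eq_true, decide_eq_true_eq, List.all_eq_true] at hI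
    exact ⟨_, _, ⟨hI.2.1, hI.2.2⟩, hI.1, hp⟩

/-! ### Membership in W[2] -/

/-- The name of the `i`-th variable of the kind given by two bits. -/
def varName (s t : Bool) (i : ℕ) : List Bool := s :: t :: List.replicate i true

theorem varName_inj {s t s' t' : Bool} {i j : ℕ} :
    varName s t i = varName s' t' j ↔ s = s' ∧ t = t' ∧ i = j := by
  simp only [varName, List.cons.injEq]
  refine and_congr_right fun _ => and_congr_right fun _ => ⟨fun h => ?_, fun h => by rw [h]⟩
  simpa using congrArg List.length h

/-- The variable that says that the attribute `b` is on the left-hand side. -/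
abbrev lhsVar (b : ℕ) : List Bool := varName false false b

/-- The variable that says that the attribute `a` is the right-hand side. -/
abbrev rhsVar (a : ℕ) : List Bool := varName false true a

/-- A variable without any meaning, by which the weight can be increased. -/
abbrev dummyVar (i : ℕ) : List Bool := varName true false i

/-- The formula whose satisfying assignments are the valid functional dependencies with right-hand
side in the list `L`.  Its weight is the size of the left-hand side, plus one for the right-hand
side, plus the number of the dummy variables (out of `m` ones) that are set to true.  The last two
groups of clauses are tautologies, which make sure that all variables occur. -/
def fdCNF (n : ℕ) (rows : List (List (List Bool))) (L : List ℕ) (m : ℕ) : CNF :=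
  [L.map fun a => (true, rhsVar a)] ++
  L.flatMap (fun a => (L.filter fun a' => !decide (a' = a)).map fun a' =>
    [(false, rhsVar a), (false, rhsVar a')]) ++
  L.map (fun a => [(false, rhsVar a), (false, lhsVar a)]) ++
  L.flatMap (fun a => rows.flatMap fun s =>
    (rows.filter fun t => !decide (s.getD a [] = t.getD a [])).map fun t => (false, rhsVar a) ::
      ((List.range n).filter fun b => !decide (s.getD b [] = t.getD b [])).map fun b =>
        (true, lhsVar b)) ++
  (List.range n).map (fun b => [(true, lhsVar b), (false, lhsVar b)]) ++
  (List.range m).map (fun i => [(true, dummyVar i), (false, dummyVar i)])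

theorem fdCNF_satisfies_iff {n : ℕ} {rows : List (List (List Bool))} {L : List ℕ} {m : ℕ}
    {A : Finset (List Bool)} :
    (fdCNF n rows L m).Satisfies A ↔
      (∃ a ∈ L, rhsVar a ∈ A) ∧
      (∀ a ∈ L, ∀ a' ∈ L, a' ≠ a → rhsVar a ∈ A → rhsVar a' ∉ A) ∧
      (∀ a ∈ L, rhsVar a ∈ A → lhsVar a ∉ A) ∧
      (∀ a ∈ L, ∀ s ∈ rows, ∀ t ∈ rows, s.getD a [] ≠ t.getD a [] → rhsVar a ∈ A →
        ∃ b < n, s.getD b [] ≠ t.getD b [] ∧ lhsVar b ∈ A) := by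
  simp only [CNF.Satisfies, fdCNF, List.forall_mem_append, List.forall_mem_singleton,
    List.forall_mem_flatMap, List.forall_mem_map, List.mem_filter]
  simp only [List.mem_map, Prod.exists, Prod.mk.injEq, List.mem_cons,
    List.not_mem_nil, or_false]
  simp
  simp only [← imp_iff_not_or, and_assoc]
  simp only [imp_self, implies_true, and_true]

theorem CNF.mem_vars {φ : CNF} {w : List Bool} : w ∈ φ.vars ↔ ∃ C ∈ φ, ∃ s, (s, w) ∈ C := by
  simp [CNF.vars, and_comm]

theorem mem_vars_fdCNF {n : ℕ} {rows : List (List (List Bool))} {L : List ℕ} {m : ℕ}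
    (hL : ∀ a ∈ L, a < n) {w : List Bool} :
    w ∈ (fdCNF n rows L m).vars ↔
      (∃ b < n, w = lhsVar b) ∨ (∃ a ∈ L, w = rhsVar a) ∨ ∃ i < m, w = dummyVar i := by
  rw [CNF.mem_vars]
  simp only [fdCNF, List.mem_append, List.mem_singleton, List.mem_flatMap, List.mem_map,
    List.mem_filter, List.mem_range]
  constructor
  · rintro ⟨C, ((((rfl | ⟨a, ha, a', ha', rfl⟩) | ⟨a, ha, rfl⟩) | ⟨a, ha, s, hs, t, ht, rfl⟩) |
      ⟨b, hb, rfl⟩) | ⟨i, hi, rfl⟩, v, hv⟩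
    · obtain ⟨a, ha, h⟩ := List.mem_map.1 hv
      cases h
      exact .inr (.inl ⟨a, ha, rfl⟩)
    · rcases List.mem_pair.1 hv with h | h <;> cases h
      · exact .inr (.inl ⟨a, ha, rfl⟩)
      · exact .inr (.inl ⟨a', ha'.1, rfl⟩)
    · rcases List.mem_pair.1 hv with h | h <;> cases h
      · exact .inr (.inl ⟨a, ha, rfl⟩)
      · exact .inl ⟨a, hL a ha, rfl⟩
    · rcases List.mem_cons.1 hv with h | h
      · cases h
        exact .inr (.inl ⟨a, ha, rfl⟩)
      · obtain ⟨b, hb, h⟩ := List.mem_map.1 h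
        cases h
        exact .inl ⟨b, List.mem_range.1 (List.mem_filter.1 hb).1, rfl⟩
    · rcases List.mem_pair.1 hv with h | h <;> cases h <;> exact .inl ⟨b, hb, rfl⟩
    · rcases List.mem_pair.1 hv with h | h <;> cases h <;> exact .inr (.inr ⟨i, hi, rfl⟩)
  · rintro (⟨b, hb, rfl⟩ | ⟨a, ha, rfl⟩ | ⟨i, hi, rfl⟩)
    · exact ⟨_, .inl (.inr ⟨b, hb, rfl⟩), true, List.mem_cons_self⟩
    · exact ⟨_, .inl (.inl (.inl (.inr ⟨a, ha, rfl⟩))), false, List.mem_cons_self⟩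
    · exact ⟨_, .inr ⟨i, hi, rfl⟩, true, List.mem_cons_self⟩

/-- The weighted satisfying assignments of the formula are the functional dependencies. -/
theorem exists_satisfies_fdCNF_iff {n : ℕ} {rows : List (List (List Bool))} {L : List ℕ} {m k : ℕ}
    (hL : ∀ a ∈ L, a < n) :
    (∃ A ⊆ (fdCNF n rows L m).vars, A.card = k + 1 ∧ (fdCNF n rows L m).Satisfies A) ↔
      ∃ a ∈ L, HasFD (fun c => ∃ d ≤ m, c + d = k) n rows a := by
  classical
  constructor
  · rintro ⟨A, hA, hc, hs⟩
    obtain ⟨⟨a, ha, hya⟩, huniq, hxa, hfd⟩ := fdCNF_satisfies_iff.1 hs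
    set X := (Finset.range n).filter fun b => lhsVar b ∈ A with hX
    set D := (Finset.range m).filter fun i => dummyVar i ∈ A with hD
    have hA' : A = insert (rhsVar a) (X.image lhsVar ∪ D.image dummyVar) := by
      ext w
      simp only [Finset.mem_insert, Finset.mem_union, Finset.mem_image, hX, hD, Finset.mem_filter,
        Finset.mem_range]
      constructor
      · intro hw
        rcases (mem_vars_fdCNF hL).1 (hA hw) with ⟨b, hb, rfl⟩ | ⟨a', ha', rfl⟩ | ⟨i, hi, rfl⟩
        · exact .inr (.inl ⟨b, ⟨hb, hw⟩, rfl⟩)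
        · by_cases haa : a' = a
          · exact .inl (by rw [haa])
          · exact absurd hw (huniq a ha a' ha' haa hya)
        · exact .inr (.inr ⟨i, ⟨hi, hw⟩, rfl⟩)
      · rintro (rfl | ⟨b, ⟨_, hw⟩, rfl⟩ | ⟨i, ⟨_, hw⟩, rfl⟩)
        · exact hya
        · exact hw
        · exact hw
    refine ⟨a, ha, X, Finset.filter_subset _ _, ⟨D.card, ?_, ?_⟩, ?_, ?_⟩
    · simpa using Finset.card_filter_le (Finset.range m) fun i => dummyVar i ∈ A
    · rw [hA', Finset.card_insert_of_notMem, Finset.card_union_of_disjoint,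
        Finset.card_image_of_injective, Finset.card_image_of_injective] at hc
      · exact Nat.succ_injective hc
      · exact fun i j h => (varName_inj.1 h).2.2
      · exact fun i j h => (varName_inj.1 h).2.2
      · rw [Finset.disjoint_left]
        simp [varName_inj]
      · simp [varName_inj]
    · exact fun h => hxa a ha hya (Finset.mem_filter.1 h).2
    · intro s hs t ht hst
      by_contra hne
      obtain ⟨b, hb, hne', hbA⟩ := hfd a ha s hs t ht hne hya
      exact hne' (hst b (Finset.mem_filter.2 ⟨Finset.mem_range.2 hb, hbA⟩))
  · rintro ⟨a, ha, X, hX, ⟨d, hd, hc⟩, haX, hfd⟩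
    refine ⟨insert (rhsVar a) (X.image lhsVar ∪ (Finset.range d).image dummyVar), ?_, ?_, ?_⟩
    · intro w hw
      rw [mem_vars_fdCNF hL]
      simp only [Finset.mem_insert, Finset.mem_union, Finset.mem_image, Finset.mem_range] at hw
      rcases hw with rfl | ⟨b, hb, rfl⟩ | ⟨i, hi, rfl⟩
      · exact .inr (.inl ⟨a, ha, rfl⟩)
      · exact .inl ⟨b, Finset.mem_range.1 (hX hb), rfl⟩
      · exact .inr (.inr ⟨i, by omega, rfl⟩)
    · rw [Finset.card_insert_of_notMem, Finset.card_union_of_disjoint,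
        Finset.card_image_of_injective, Finset.card_image_of_injective, Finset.card_range, hc]
      · exact fun i j h => (varName_inj.1 h).2.2
      · exact fun i j h => (varName_inj.1 h).2.2
      · rw [Finset.disjoint_left]
        simp [varName_inj]
      · simp [varName_inj]
    · have hr : ∀ a', rhsVar a' ∈ insert (rhsVar a) (X.image lhsVar ∪ (Finset.range d).image
          dummyVar) ↔ a' = a := by
        intro a'
        simp [varName_inj]
      have hl : ∀ b, lhsVar b ∈ insert (rhsVar a) (X.image lhsVar ∪ (Finset.range d).image
          dummyVar) ↔ b ∈ X := by
        intro b
        simp [varName_inj]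
      rw [fdCNF_satisfies_iff]
      simp only [hr, hl]
      refine ⟨⟨a, ha, rfl⟩, ?_, ?_, ?_⟩
      · rintro _ _ a' _ hne rfl
        exact hne
      · rintro _ _ rfl
        exact haX
      · rintro _ _ s hs t ht hne rfl
        by_contra hcon
        refine hne (hfd s hs t ht fun b hb => ?_)
        by_contra hne'
        exact hcon ⟨b, Finset.mem_range.1 (hX hb), hne', hb⟩

theorem HasFD.congr {p q : ℕ → Prop} (h : ∀ c, p c ↔ q c) {n : ℕ}
    {rows : List (List (List Bool))} {a : ℕ} : HasFD p n rows a ↔ HasFD q n rows a := by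
  simp only [HasFD, h]

section

variable {α : Type} [TreeCoded α]

@[fun_prop]
theorem PolyTime.varName {s t : Bool} {f : α → ℕ} (hf : PolyTime f) :
    PolyTime fun a => varName s t (f a) := by
  have h : PolyTime fun a => s :: t :: (List.replicate (f a) ()).map (fun _ => true) :=
    .cons (.const s) (.cons (.const t) (hf.toUnits.map (.const true)))
  simpa only [List.map_replicate, ParamComplexity.varName] using h

@[fun_prop]
theorem PolyTime.fdCNF {n m : α → ℕ} {rows : α → List (List (List Bool))} {L : α → List ℕ}
    (hn : PolyTime n) (hr : PolyTime rows) (hL : PolyTime L) (hm : PolyTime m) :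
    PolyTime fun a => fdCNF (n a) (rows a) (L a) (m a) := by
  unfold ParamComplexity.fdCNF
  fun_prop

@[fun_prop]
theorem PolyTime.cnfEncode {f : α → CNF} (hf : PolyTime f) : PolyTime fun a => (f a).encode := by
  unfold CNF.encode
  fun_prop

end

theorem encodeTable_injective : Injective encodeTable := fun t t' h => by
  simpa using congrArg decodeTable h

theorem CNF.encode_injective : Injective CNF.encode := by
  refine encodeTable_injective.comp (List.map_injective_iff.2 (List.map_injective_iff.2 ?_))
  rintro ⟨s, w⟩ ⟨s', w'⟩ h
  simpa using h

theorem encode_mem_weightedCNFSat_iff {φ : CNF} {k : ℕ} :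
    (φ.encode, k) ∈ WeightedCNFSat ↔ 0 < k ∧ ∃ A ⊆ φ.vars, A.card = k ∧ φ.Satisfies A := by
  constructor
  · rintro ⟨ψ, h, hk, hA⟩
    obtain rfl := CNF.encode_injective h
    exact ⟨hk, hA⟩
  · rintro ⟨hk, hA⟩
    exact ⟨φ, rfl, hk, hA⟩

/-- A problem is in W[2], if its yes-instances are the ones for which a formula of the form `fdCNF`
that can be computed in polynomial time has a satisfying assignment of weight `k + 1`. -/
theorem mem_W2_of_fdCNF {P : Problem} {c : List Bool → ℕ → Bool} {n m : List Bool → ℕ → ℕ}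
    {rows : List Bool → ℕ → List (List (List Bool))} {L : List Bool → ℕ → List ℕ}
    (hc : PolyTime fun x : List Bool × ℕ => c x.1 x.2)
    (hn : PolyTime fun x : List Bool × ℕ => n x.1 x.2)
    (hr : PolyTime fun x : List Bool × ℕ => rows x.1 x.2)
    (hL : PolyTime fun x : List Bool × ℕ => L x.1 x.2)
    (hm : PolyTime fun x : List Bool × ℕ => m x.1 x.2)
    (hLn : ∀ I k, c I k = true → ∀ a ∈ L I k, a < n I k)
    (hP : ∀ I k, (I, k) ∈ P ↔ c I k = true ∧
      ∃ a ∈ L I k, HasFD (fun s => ∃ d ≤ m I k, s + d = k) (n I k) (rows I k) a) :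
    P ∈ W2 := by
  refine (Reducible.refl P).trans_polyTime (red := fun I k =>
    bif c I k then ((fdCNF (n I k) (rows I k) (L I k) (m I k)).encode, k + 1) else ([], 0))
    (by fun_prop) (fun I k => ?_) fun I k => ?_
  · cases c I k <;> simp
  · rw [hP]
    cases hcI : c I k
    · simp [WeightedCNFSat]
    · simp only [true_and, cond_true]
      rw [encode_mem_weightedCNFSat_iff, exists_satisfies_fdCNF_iff (hLn I k hcI)]
      simp

theorem fdProblem_mem_W2 {p : ℕ → ℕ → Prop} {m : ℕ → ℕ} (hm : PolyTime m)
    (hp : ∀ k s, p k s ↔ ∃ d ≤ m k, s + d = k) : FDProblem p ∈ W2 := by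
  refine mem_W2_of_fdCNF (c := fun I _ => isDatabase I) (n := fun I _ => (splitUnary I).1)
    (m := fun _ k => m k) (rows := fun I _ => readRows I)
    (L := fun I _ => List.range (splitUnary I).1) (by fun_prop) (by fun_prop) (by fun_prop)
    (by fun_prop) (by fun_prop) (fun I k _ a ha => List.mem_range.1 ha) fun I k => ?_
  rw [FDProblem, Set.mem_ofPred_eq, exists_table_iff]
  simp only [HasFD.congr (hp k), List.mem_range]

theorem fdFixedProblem_mem_W2 {p : ℕ → ℕ → Prop} {m : ℕ → ℕ} (hm : PolyTime m)
    (hp : ∀ k s, p k s ↔ ∃ d ≤ m k, s + d = k) : FDFixedProblem p ∈ W2 := by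
  refine mem_W2_of_fdCNF
    (c := fun I _ => decide (I = unary (splitUnary I).1 ++ (splitUnary I).2) &&
      (isDatabase (splitUnary I).2 && decide ((splitUnary I).1 < (splitUnary (splitUnary I).2).1)))
    (n := fun I _ => (splitUnary (splitUnary I).2).1)
    (m := fun _ k => m k) (rows := fun I _ => readRows (splitUnary I).2)
    (L := fun I _ => [(splitUnary I).1]) (by fun_prop) (by fun_prop) (by fun_prop)
    (by fun_prop) (by fun_prop) (fun I k h a ha => ?_) fun I k => ?_
  · simp only [Bool.and_eq_true, decide_eq_true_eq] at h
    rw [List.mem_singleton.1 ha]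
    exact h.2.2
  · simp only [Bool.and_eq_true, decide_eq_true_eq, List.mem_singleton, exists_eq_left,
      ← HasFD.congr (hp k)]
    constructor
    · rintro ⟨a, n, rows, ht, rfl, h⟩
      have := (exists_table_iff (p := fun n rows => a < n ∧ HasFD (p k) n rows a)).1
        ⟨n, rows, ht, rfl, h⟩
      rw [splitUnary_unary_append]
      exact ⟨⟨rfl, this.1, this.2.1⟩, this.2.2⟩
    · rintro ⟨⟨h1, h2, h3⟩, h4⟩
      obtain ⟨n, rows, ht, he, h⟩ := (exists_table_iff (p := fun n rows =>
        (splitUnary I).1 < n ∧ HasFD (p k) n rows (splitUnary I).1)).2 ⟨h2, h3, h4⟩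
      exact ⟨_, n, rows, ht, by rw [← he]; exact h1, h⟩

/-- Unique column combinations are the left-hand sides of the functional dependencies whose
right-hand side is an additional column that identifies the rows. -/
theorem hasFD_identity_iff {p : ℕ → Prop} {n : ℕ} {rows : List (List (List Bool))}
    (ht : ∀ r ∈ rows, r.length = n) :
    HasFD p (n + 1) (rows.map fun s => s ++ [encodeTable [s]]) n ↔
      ∃ U ⊆ Finset.range n, p U.card ∧ ListUCC rows U := by
  have hlast : ∀ s ∈ rows, (s ++ [encodeTable [s]]).getD n [] = encodeTable [s] := by
    intro s hs
    rw [← ht s hs]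
    simp [List.getD_eq_getElem?_getD]
  have hb : ∀ s ∈ rows, ∀ b < n, (s ++ [encodeTable [s]]).getD b [] = s.getD b [] := by
    intro s hs b hb
    rw [List.getD_append _ _ _ _ (by rw [ht s hs]; exact hb)]
  constructor
  · rintro ⟨X, hX, hp, hn, h⟩
    have hX' : X ⊆ Finset.range n := by
      intro b hb
      have := Finset.mem_range.1 (hX hb)
      have : b ≠ n := fun hbn => hn (hbn ▸ hb)
      exact Finset.mem_range.2 (by omega)
    refine ⟨X, hX', hp, fun s hs t ht' hne => ?_⟩
    by_contra hcon
    push Not at hcon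
    have := h _ (List.mem_map_of_mem hs) _ (List.mem_map_of_mem ht') fun b hbX => by
      rw [hb s hs b (Finset.mem_range.1 (hX' hbX)), hb t ht' b (Finset.mem_range.1 (hX' hbX))]
      exact hcon b hbX
    rw [hlast s hs, hlast t ht'] at this
    exact hne (by simpa using encodeTable_injective this)
  · rintro ⟨U, hU, hp, h⟩
    refine ⟨U, hU.trans (Finset.range_mono (Nat.le_succ n)), hp,
      fun hn => Finset.notMem_range_self (hU hn), ?_⟩
    simp only [ListFD, List.forall_mem_map]
    intro s hs t ht' hst
    rw [hlast s hs, hlast t ht']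
    by_contra hne
    obtain ⟨b, hbU, hbne⟩ := h s hs t ht' fun hst' => hne (by rw [hst'])
    refine hbne ?_
    have := hst b hbU
    rwa [hb s hs b (Finset.mem_range.1 (hU hbU)), hb t ht' b (Finset.mem_range.1 (hU hbU))] at this

theorem uniqueColumnCombination_mem_W2 : UniqueColumnCombination ∈ W2 := by
  refine mem_W2_of_fdCNF (c := fun I _ => isDatabase I) (n := fun I _ => (splitUnary I).1 + 1)
    (m := fun _ _ => 0) (rows := fun I _ => (readRows I).map fun s => s ++ [encodeTable [s]])
    (L := fun I _ => [(splitUnary I).1]) (by fun_prop) (by fun_prop) (by fun_prop)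
    (by fun_prop) (by fun_prop) (fun I k _ a ha => ?_) fun I k => ?_
  · rw [List.mem_singleton.1 ha]
    exact Nat.lt_succ_self _
  · rw [mem_uniqueColumnCombination_iff, exists_table_iff]
    refine and_congr_right fun hI => ?_
    simp only [isDatabase, Bool.and_eq_true, decide_eq_true_eq, List.all_eq_true] at hI
    simp only [List.mem_singleton, exists_eq_left]
    rw [hasFD_identity_iff hI.2.2]
    simp

/-! ### From hitting sets to databases -/

/-- A set of columns hits every row of a matrix of bits. -/
def Hits (H : Finset ℕ) (M : List (List Bool)) : Prop :=
  ∀ r ∈ M, ∃ b ∈ H, r.getD b false = true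

/-- A matrix of bits with `N` columns, all of whose rows are non-zero. -/
def IsHitMatrix (N : ℕ) (M : List (List Bool)) : Prop :=
  0 < N ∧ ∀ r ∈ M, r.length = N ∧ true ∈ r

theorem exists_getD_of_mem {N : ℕ} {r : List Bool} (hl : r.length = N) (h : true ∈ r) :
    ∃ b < N, r.getD b false = true := by
  obtain ⟨b, hb, hr⟩ := List.getElem_of_mem h
  exact ⟨b, hl ▸ hb, by rw [List.getD_eq_getElem _ _ hb, hr]⟩

/-- The database whose unique column combinations are the hitting sets of a matrix: a row without
information, and one row for each row `r` of the matrix, in which the ones of `r` are replaced by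
`r` itself, and the zeros by the empty string. -/
def uccRows (N : ℕ) (M : List (List Bool)) : List (List (List Bool)) :=
  List.replicate N [] :: M.map fun r => r.map fun b => bif b then r else []

theorem getD_replicate_nil (n b : ℕ) : (List.replicate n ([] : List Bool)).getD b [] = [] := by
  rw [List.getD_eq_getElem?_getD, List.getElem?_replicate]
  split <;> rfl

theorem getD_uccRow (r r' : List Bool) (b : ℕ) :
    (r.map fun b => bif b then r' else []).getD b [] = bif r.getD b false then r' else [] := by
  rw [← List.getD_map (f := fun b => bif b then r' else [])]
  rfl

theorem isTable_uccRows {N : ℕ} {M : List (List Bool)} (hM : IsHitMatrix N M) :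
    IsTable N (uccRows N M) := by
  refine ⟨hM.1, ?_⟩
  simp only [uccRows, List.forall_mem_cons, List.length_replicate, List.forall_mem_map,
    List.length_map, true_and]
  exact fun r hr => (hM.2 r hr).1

theorem listUCC_uccRows_iff {N : ℕ} {M : List (List Bool)} (hM : IsHitMatrix N M) {U : Finset ℕ} :
    ListUCC (uccRows N M) U ↔ Hits U M := by
  have h0 := getD_replicate_nil N
  have hne : ∀ r ∈ M, r ≠ [] := fun r hr h => by
    have := (hM.2 r hr).2
    rw [h] at this
    cases this
  have hrow : ∀ r ∈ M, Hits U M → ∃ b ∈ U,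
      (r.map fun b => bif b then r else []).getD b [] = r := by
    intro r hr hU
    obtain ⟨b, hb, h⟩ := hU r hr
    exact ⟨b, hb, by rw [getD_uccRow, h]; rfl⟩
  constructor
  · intro h r hr
    have hne' : List.replicate N [] ≠ r.map fun b => bif b then r else [] := by
      intro heq
      obtain ⟨b, -, hb⟩ := exists_getD_of_mem (hM.2 r hr).1 (hM.2 r hr).2
      have := congrArg (fun l : List (List Bool) => l.getD b []) heq
      simp only [h0, getD_uccRow, hb, cond_true] at this
      exact hne r hr this.symm
    obtain ⟨b, hb, hbne⟩ := h _ List.mem_cons_self _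
      (List.mem_cons_of_mem _ (List.mem_map_of_mem hr)) hne'
    refine ⟨b, hb, ?_⟩
    rw [h0, getD_uccRow] at hbne
    by_contra hf
    rw [Bool.not_eq_true] at hf
    rw [hf] at hbne
    exact hbne rfl
  · intro hU s hs t ht hst
    rcases List.mem_cons.1 hs with rfl | hs <;> rcases List.mem_cons.1 ht with rfl | ht
    · exact absurd rfl hst
    · obtain ⟨r, hr, rfl⟩ := List.mem_map.1 ht
      obtain ⟨b, hb, h⟩ := hrow r hr hU
      exact ⟨b, hb, by rw [h0, h]; exact (hne r hr).symm⟩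
    · obtain ⟨r, hr, rfl⟩ := List.mem_map.1 hs
      obtain ⟨b, hb, h⟩ := hrow r hr hU
      exact ⟨b, hb, by rw [h0, h]; exact hne r hr⟩
    · obtain ⟨r, hr, rfl⟩ := List.mem_map.1 hs
      obtain ⟨r', hr', rfl⟩ := List.mem_map.1 ht
      obtain ⟨b, hb, h⟩ := hrow r hr hU
      refine ⟨b, hb, ?_⟩
      rw [h, getD_uccRow]
      cases r'.getD b false
      · exact hne r hr
      · rintro rfl
        exact hst rfl

/-- The database whose functional dependencies are the hitting sets of a matrix with `N` columns,
all of them with right-hand side `N`.  The column `N` separates the rows that come from the matrix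
from the other rows: a row without information and, for every column `b < N`, a row that differs
from it in `b` only and so prevents that `b` is a right-hand side. -/
def fdRows (N : ℕ) (M : List (List Bool)) : List (List (List Bool)) :=
  List.replicate (N + 1) [] ::
    ((List.range N).map (fun b => (List.range (N + 1)).map fun i =>
        bif decide (i = b) then [false] else []) ++
      M.map fun r => (r.map fun b => bif b then [true] else []) ++ [[true]])

theorem isTable_fdRows {N : ℕ} {M : List (List Bool)} (hM : IsHitMatrix N M) :
    IsTable (N + 1) (fdRows N M) := by
  refine ⟨Nat.succ_pos N, ?_⟩
  simp only [fdRows, List.forall_mem_cons, List.length_replicate, List.forall_mem_map,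
    List.length_map, true_and, List.forall_mem_append, List.length_append, List.length_range,
    List.length_singleton, implies_true]
  exact fun r hr => by rw [(hM.2 r hr).1]

theorem getD_fdRow {N : ℕ} {r : List Bool} (hr : r.length = N) {b : ℕ} (hb : b < N) :
    ((r.map fun b => bif b then [true] else []) ++ [[true]]).getD b [] =
      bif r.getD b false then [true] else [] := by
  rw [List.getD_append _ _ _ _ (by simpa [hr] using hb)]
  exact getD_uccRow r [true] b

theorem getD_fdRow_last {N : ℕ} {r : List Bool} (hr : r.length = N) :
    ((r.map fun b => bif b then [true] else []) ++ [[true]]).getD N [] = [true] := by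
  subst hr
  simp [List.getD_eq_getElem?_getD]

theorem getD_unitRow {N b i : ℕ} (hi : i < N + 1) :
    ((List.range (N + 1)).map fun i => bif decide (i = b) then [false] else []).getD i [] =
      bif decide (i = b) then [false] else [] := by
  rw [List.getD_eq_getElem _ _ (by simpa using hi)]
  simp

theorem mem_fdRows {N : ℕ} {M : List (List Bool)} (hM : IsHitMatrix N M) {s : List (List Bool)}
    (hs : s ∈ fdRows N M) :
    (s.getD N [] = [] ∧ ∀ b < N, s.getD b [] ≠ [true]) ∨
      (s.getD N [] = [true] ∧ ∃ r ∈ M, ∀ b < N, s.getD b [] =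
        bif r.getD b false then [true] else []) := by
  rw [fdRows, List.mem_cons, List.mem_append, List.mem_map, List.mem_map] at hs
  rcases hs with rfl | ⟨b, hb, rfl⟩ | ⟨r, hr, rfl⟩
  · left
    simp only [getD_replicate_nil, true_and]
    simp
  · left
    have hb := List.mem_range.1 hb
    refine ⟨?_, fun i hi => ?_⟩
    · rw [getD_unitRow (Nat.lt_succ_self N), decide_eq_false (by omega)]
      rfl
    · rw [getD_unitRow (by omega)]
      cases decide (i = b) <;> simp
  · right
    exact ⟨getD_fdRow_last (hM.2 r hr).1, r, hr, fun b hb => getD_fdRow (hM.2 r hr).1 hb⟩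

theorem hasFD_fdRows_iff {p : ℕ → Prop} {N : ℕ} {M : List (List Bool)} (hM : IsHitMatrix N M)
    {a : ℕ} (ha : a < N + 1) :
    HasFD p (N + 1) (fdRows N M) a ↔ a = N ∧ ∃ H ⊆ Finset.range N, p H.card ∧ Hits H M := by
  have h0 := getD_replicate_nil (N + 1)
  have hmem0 : List.replicate (N + 1) [] ∈ fdRows N M := List.mem_cons_self
  constructor
  · rintro ⟨X, hX, hp, haX, h⟩
    have haN : a = N := by
      by_contra hne
      have := h _ hmem0 _ (List.mem_cons_of_mem _ (List.mem_append_left _ (List.mem_map_of_mem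
        (List.mem_range.2 (show a < N by omega))))) fun b hb => by
          rw [h0, getD_unitRow (Finset.mem_range.1 (hX hb)), decide_eq_false]
          · rfl
          · rintro rfl
            exact haX hb
      rw [h0, getD_unitRow ha, decide_eq_true rfl] at this
      cases this
    subst haN
    have hX' : X ⊆ Finset.range a := by
      intro b hb
      have := Finset.mem_range.1 (hX hb)
      have : b ≠ a := fun hba => haX (hba ▸ hb)
      exact Finset.mem_range.2 (by omega)
    refine ⟨rfl, X, hX', hp, fun r hr => ?_⟩
    by_contra hcon
    push Not at hcon
    have := h _ hmem0 _ (List.mem_cons_of_mem _ (List.mem_append_right _ (List.mem_map_of_mem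
      hr))) fun b hb => by
        rw [h0, getD_fdRow (hM.2 r hr).1 (Finset.mem_range.1 (hX' hb)),
          (Bool.not_eq_true _).mp (hcon b hb)]
        rfl
    rw [h0, getD_fdRow_last (hM.2 r hr).1] at this
    cases this
  · rintro ⟨rfl, H, hH, hp, h⟩
    refine ⟨H, hH.trans (Finset.range_mono (Nat.le_succ a)), hp,
      fun hn => Finset.notMem_range_self (hH hn), ?_⟩
    -- a row from the matrix and a row of another kind differ in a column of the hitting set
    have key : ∀ s t : List (List Bool), (∀ b < a, s.getD b [] ≠ [true]) →
        (∃ r ∈ M, ∀ b < a, t.getD b [] = bif r.getD b false then [true] else []) →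
        ∃ b ∈ H, s.getD b [] ≠ t.getD b [] := by
      rintro s t hs ⟨r, hr, ht⟩
      obtain ⟨b, hb, hrb⟩ := h r hr
      have hb' := Finset.mem_range.1 (hH hb)
      refine ⟨b, hb, ?_⟩
      rw [ht b hb', hrb]
      exact hs b hb'
    intro s hs t ht hst
    rcases mem_fdRows hM hs with ⟨hs1, hs2⟩ | ⟨hs1, hs2⟩ <;>
      rcases mem_fdRows hM ht with ⟨ht1, ht2⟩ | ⟨ht1, ht2⟩
    · rw [hs1, ht1]
    · obtain ⟨b, hb, hne⟩ := key s t hs2 ht2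
      exact absurd (hst b hb) hne
    · obtain ⟨b, hb, hne⟩ := key t s ht2 hs2
      exact absurd (hst b hb).symm hne
    · rw [hs1, ht1]

/-! ### From weighted satisfiability to hitting sets -/

/-- The list without repetitions. -/
def distinct (l : List (List Bool)) : List (List Bool) :=
  l.foldl (fun acc w => bif acc.any (fun v => decide (v = w)) then acc else w :: acc) []

theorem distinct_spec (l : List (List Bool)) :
    (distinct l).Nodup ∧ ∀ w, w ∈ distinct l ↔ w ∈ l := by
  have h : ∀ (l acc : List (List Bool)), acc.Nodup →
      (l.foldl (fun acc w => bif acc.any (fun v => decide (v = w)) then acc else w :: acc)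
        acc).Nodup ∧ ∀ w, w ∈ l.foldl (fun acc w => bif acc.any (fun v => decide (v = w)) then acc
          else w :: acc) acc ↔ w ∈ acc ∨ w ∈ l := by
    intro l
    induction l with
    | nil => intro acc hacc; exact ⟨hacc, fun w => by simp⟩
    | cons w l ih =>
      intro acc hacc
      rw [List.foldl_cons]
      by_cases hw : w ∈ acc
      · have : (acc.any fun v => decide (v = w)) = true := by simpa using hw
        rw [this, cond_true]
        refine ⟨(ih acc hacc).1, fun v => ?_⟩
        rw [(ih acc hacc).2, List.mem_cons]
        constructor
        · rintro (h | h)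
          · exact .inl h
          · exact .inr (.inr h)
        · rintro (h | rfl | h)
          · exact .inl h
          · exact .inl hw
          · exact .inr h
      · have : (acc.any fun v => decide (v = w)) = false := by
          rw [List.any_eq_false]
          rintro v hv h
          exact hw (of_decide_eq_true h ▸ hv)
        rw [this, cond_false]
        have hn : (w :: acc).Nodup := List.nodup_cons.2 ⟨hw, hacc⟩
        refine ⟨(ih _ hn).1, fun v => ?_⟩
        rw [(ih _ hn).2, List.mem_cons, List.mem_cons]
        tauto
  exact ⟨(h l [] List.nodup_nil).1, fun w => ((h l [] List.nodup_nil).2 w).trans (by simp)⟩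

/-- A list of the variables of a formula. -/
def varList (φ : CNF) : List (List Bool) := distinct (φ.flatten.map Prod.snd)

theorem mem_varList {φ : CNF} {w : List Bool} : w ∈ varList φ ↔ w ∈ φ.vars := by
  rw [varList, (distinct_spec _).2, CNF.vars, List.mem_toFinset]

/-- The universe of the hitting set instance.  The variables are numbered `1, …, N`, and the numbers
of the true ones, together with the sentinels `0` and `N + 1`, form an increasing sequence.  The
triple `(r, s, t)` says that the members `r` and `r + 1` of the sequence are `s` and `t`. -/
def gaps (k N : ℕ) : List (ℕ × ℕ × ℕ) :=
  (List.range (k + 1)).flatMap fun r => (List.range (N + 2)).flatMap fun s =>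
    (List.range (N + 2)).map fun t => (r, s, t)

theorem mem_gaps {k N : ℕ} {e : ℕ × ℕ × ℕ} :
    e ∈ gaps k N ↔ e.1 ≤ k ∧ e.2.1 ≤ N + 1 ∧ e.2.2 ≤ N + 1 := by
  obtain ⟨r, s, t⟩ := e
  simp only [gaps, List.mem_flatMap, List.mem_range, List.mem_map, Prod.mk.injEq]
  constructor
  · rintro ⟨_, h1, _, h2, _, h3, rfl, rfl, rfl⟩
    exact ⟨by omega, by omega, by omega⟩
  · rintro ⟨h1, h2, h3⟩
    exact ⟨r, by omega, s, by omega, t, by omega, rfl, rfl, rfl⟩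

/-- The gap `e` may be gap number `r`. -/
def isGap (k N r : ℕ) (e : ℕ × ℕ × ℕ) : Bool :=
  decide (e.1 = r) && (decide (e.2.1 < e.2.2) && ((!decide (r = 0) || decide (e.2.1 = 0)) &&
    (!decide (r = k) || decide (e.2.2 = N + 1))))

/-- The gap `e` is consistent with the implication "if gap `r` ends in `v`, then gap `r + 1` begins
in `v`".  The negation in it is expressed positively, since there is exactly one gap `r`. -/
def isLink (r v : ℕ) (e : ℕ × ℕ × ℕ) : Bool :=
  (decide (e.1 = r) && !decide (e.2.2 = v)) || (decide (e.1 = r + 1) && decide (e.2.1 = v))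

/-- The gap `e` makes the clause `C` true: it ends in a variable that occurs positively, or it goes
beyond a variable that occurs negatively. -/
def isWitness (V : List (List Bool)) (C : List Literal) (e : ℕ × ℕ × ℕ) : Bool :=
  C.any fun l => (List.range V.length).any fun i => decide (V.getD i [] = l.2) &&
    bif l.1 then decide (e.2.2 = i + 1) else decide (e.2.1 < i + 1) && decide (i + 1 < e.2.2)

/-- The hitting set instance for a formula and a weight.  Its columns are the gaps, and its rows say
that there is a gap of every number, that successive gaps fit together, and that the clauses are
true. -/
def hitMatrix (φ : CNF) (k : ℕ) : List (List Bool) :=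
  (List.range (k + 1)).map (fun r => (gaps k (varList φ).length).map fun e =>
    isGap k (varList φ).length r e) ++
  (List.range k).flatMap (fun r => (List.range ((varList φ).length + 2)).map fun v =>
    (gaps k (varList φ).length).map fun e => isLink r v e) ++
  φ.map fun C => (gaps k (varList φ).length).map fun e => isWitness (varList φ) C e

theorem hits_hitMatrix_iff {φ : CNF} {k : ℕ} {H : Finset ℕ} :
    Hits H (hitMatrix φ k) ↔
      (∀ r ≤ k, ∃ b ∈ H, ((gaps k (varList φ).length).map fun e =>
        isGap k (varList φ).length r e).getD b false = true) ∧
      (∀ r < k, ∀ v ≤ (varList φ).length + 1, ∃ b ∈ H,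
        ((gaps k (varList φ).length).map fun e => isLink r v e).getD b false = true) ∧
      ∀ C ∈ φ, ∃ b ∈ H,
        ((gaps k (varList φ).length).map fun e => isWitness (varList φ) C e).getD b false =
          true := by
  simp only [Hits, hitMatrix, List.forall_mem_append, List.forall_mem_map,
    List.forall_mem_flatMap, List.mem_range, Nat.lt_succ_iff, and_assoc]

theorem exists_index_of_mem_vars {φ : CNF} {w : List Bool} (hw : w ∈ φ.vars) :
    ∃ i < (varList φ).length, (varList φ).getD i [] = w := by
  obtain ⟨i, hi, h⟩ := List.getElem_of_mem (mem_varList.2 hw)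
  exact ⟨i, hi, by rw [List.getD_eq_getElem _ _ hi, h]⟩

theorem varList_getD_inj {φ : CNF} {i j : ℕ} (hi : i < (varList φ).length)
    (hj : j < (varList φ).length) (h : (varList φ).getD i [] = (varList φ).getD j []) : i = j := by
  rw [List.getD_eq_getElem _ _ hi, List.getD_eq_getElem _ _ hj] at h
  exact ((distinct_spec _).1.getElem_inj_iff).1 h

theorem isHitMatrix_hitMatrix {φ : CNF} {k : ℕ} (hφ : ∀ C ∈ φ, C ≠ []) :
    IsHitMatrix (gaps k (varList φ).length).length (hitMatrix φ k) := by
  set N := (varList φ).length with hN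
  refine ⟨List.length_pos_of_mem ((mem_gaps (e := (0, 0, 0))).2 ⟨by simp, by simp, by simp⟩), ?_⟩
  have key : ∀ f : ℕ × ℕ × ℕ → Bool, (∃ e ∈ gaps k N, f e = true) →
      ((gaps k N).map f).length = (gaps k N).length ∧ true ∈ (gaps k N).map f :=
    fun f hf => ⟨List.length_map _, List.mem_map.2 hf⟩
  simp only [hitMatrix, List.forall_mem_append, List.forall_mem_map,
    List.forall_mem_flatMap, List.mem_range, ← hN]
  refine ⟨⟨fun r hr => key _ ?_, fun r hr v hv => key _ ?_⟩, fun C hC => key _ ?_⟩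
  · exact ⟨(r, 0, N + 1), mem_gaps.2 ⟨by simp; omega, by simp, by simp⟩, by simp [isGap]⟩
  · by_cases hv : v = 0
    · exact ⟨(r, 0, 1), mem_gaps.2 ⟨by simp; omega, by simp, by simp⟩, by simp [isLink, hv]⟩
    · exact ⟨(r, 0, 0), mem_gaps.2 ⟨by simp; omega, by simp, by simp⟩,
        by simp [isLink, Ne.symm hv]⟩
  · obtain ⟨l, hl⟩ := List.exists_mem_of_ne_nil C (hφ C hC)
    obtain ⟨i, hi, hil⟩ := exists_index_of_mem_vars (CNF.mem_vars.2 ⟨C, hC, l.1, hl⟩)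
    rw [← hN] at hi
    refine ⟨(0, 0, bif l.1 then i + 1 else N + 1), mem_gaps.2 ⟨by simp, by simp, ?_⟩, ?_⟩
    · cases l.1 <;> simp
      omega
    · simp only [isWitness, List.any_eq_true, List.mem_range, Bool.and_eq_true, decide_eq_true_eq]
      refine ⟨l, hl, i, hi, hil, ?_⟩
      cases l.1 <;> simp
      omega

theorem getD_map_eq_true_iff {E : Type} {L : List E} {f : E → Bool} {b : ℕ} :
    (L.map f).getD b false = true ↔ ∃ h : b < L.length, f L[b] = true := by
  by_cases hb : b < L.length
  · rw [List.getD_eq_getElem _ _ (by simpa using hb)]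
    simp [hb]
  · rw [List.getD_eq_default _ _ (by simpa using hb)]
    simp [hb]

/-- An increasing enumeration of a set of `k` numbers between the sentinels `0` and `N + 1`. -/
theorem exists_enumeration {J : Finset ℕ} {k N : ℕ} (hJ : ∀ j ∈ J, 0 < j ∧ j < N + 1)
    (hc : J.card = k) :
    ∃ pos : ℕ → ℕ, pos 0 = 0 ∧ pos (k + 1) = N + 1 ∧ (∀ q ≤ k, pos q < pos (q + 1)) ∧
      ∀ j, j ∈ J ↔ ∃ q < k, pos (q + 1) = j := by
  set J' := insert 0 (insert (N + 1) J) with hJ'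
  have hN : N + 1 ∉ J := fun h => lt_irrefl _ (hJ _ h).2
  have h0 : 0 ∉ insert (N + 1) J := by
    rw [Finset.mem_insert, not_or]
    exact ⟨by omega, fun h => lt_irrefl _ (hJ _ h).1⟩
  have hc' : J'.card = k + 2 := by
    rw [hJ', Finset.card_insert_of_notMem h0, Finset.card_insert_of_notMem hN, hc]
  set f := J'.orderEmbOfFin hc' with hf
  have hle : ∀ j ∈ J', j ≤ N + 1 := by
    intro j hj
    rw [hJ', Finset.mem_insert, Finset.mem_insert] at hj
    rcases hj with rfl | rfl | hj
    · omega
    · omega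
    · exact (hJ j hj).2.le
  have hsurj : ∀ j ∈ J', ∃ q, f q = j := by
    intro j hj
    have : j ∈ Set.range f := by rw [hf, Finset.range_orderEmbOfFin]; exact hj
    exact this
  have hmem : ∀ q, f q ∈ J' := fun q => Finset.orderEmbOfFin_mem _ _ _
  have hf0 : f 0 = 0 := by
    obtain ⟨q, hq⟩ := hsurj 0 (Finset.mem_insert_self _ _)
    have : f 0 ≤ f q := f.monotone (Fin.zero_le q)
    omega
  have hfl : f (Fin.last (k + 1)) = N + 1 := by
    obtain ⟨q, hq⟩ := hsurj (N + 1) (by simp [hJ'])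
    have h1 : f q ≤ f (Fin.last (k + 1)) := f.monotone (Fin.le_last q)
    have h2 := hle _ (hmem (Fin.last (k + 1)))
    omega
  refine ⟨fun q => if h : q < k + 2 then f ⟨q, h⟩ else 0, ?_, ?_, ?_, ?_⟩
  · simpa using hf0
  · exact (dif_pos (Nat.lt_succ_self (k + 1))).trans hfl
  · intro q hq
    simp only [dif_pos (show q < k + 2 by omega), dif_pos (show q + 1 < k + 2 by omega)]
    exact f.strictMono (Fin.mk_lt_mk.2 (Nat.lt_succ_self q))
  · intro j
    constructor
    · intro hj
      obtain ⟨⟨q, hq⟩, hqj⟩ := hsurj j (by simp [hJ', hj])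
      have hj' := hJ j hj
      have hq0 : q ≠ 0 := by
        rintro rfl
        have : f ⟨0, hq⟩ = 0 := hf0
        omega
      have hql : q ≠ k + 1 := by
        rintro rfl
        have : f ⟨k + 1, hq⟩ = N + 1 := hfl
        omega
      refine ⟨q - 1, by omega, ?_⟩
      simp only [dif_pos (show q - 1 + 1 < k + 2 by omega)]
      convert hqj using 2
      exact Fin.ext (by simp; omega)
    · rintro ⟨q, hq, rfl⟩
      simp only [dif_pos (show q + 1 < k + 2 by omega)]
      have h1 := hmem ⟨q + 1, by omega⟩
      have h2 : f 0 < f ⟨q + 1, by omega⟩ := f.strictMono (Fin.mk_lt_mk.2 (Nat.succ_pos q))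
      have h3 : f ⟨q + 1, by omega⟩ < f (Fin.last (k + 1)) :=
        f.strictMono (Fin.mk_lt_mk.2 (by omega))
      rw [hJ', Finset.mem_insert, Finset.mem_insert] at h1
      rcases h1 with h1 | h1 | h1
      · omega
      · omega
      · exact h1

/-- A satisfying assignment of weight `k` has `k + 1` gaps, which form a hitting set. -/
theorem exists_hits_of_satisfies {φ : CNF} {k : ℕ} {A : Finset (List Bool)} (hA : A ⊆ φ.vars)
    (hc : A.card = k) (hs : φ.Satisfies A) :
    ∃ H ⊆ Finset.range (gaps k (varList φ).length).length, H.card = k + 1 ∧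
      Hits H (hitMatrix φ k) := by
  classical
  set N := (varList φ).length with hN
  set G := gaps k N with hG
  -- the numbers of the variables that are true
  set J := ((Finset.range N).filter fun i => (varList φ).getD i [] ∈ A).image (· + 1) with hJdef
  have hmemJ : ∀ i < N, i + 1 ∈ J ↔ (varList φ).getD i [] ∈ A := by
    intro i hi
    simp [hJdef, hi]
  have hJ : ∀ j ∈ J, 0 < j ∧ j < N + 1 := by
    intro j hj
    obtain ⟨i, hi, rfl⟩ := Finset.mem_image.1 hj
    have := Finset.mem_range.1 (Finset.mem_filter.1 hi).1
    omega
  have hcJ : J.card = k := by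
    rw [hJdef, Finset.card_image_of_injective _ (add_left_injective 1), ← hc]
    refine Finset.card_bij (fun i _ => (varList φ).getD i [])
      (fun i hi => (Finset.mem_filter.1 hi).2) (fun i hi j hj h => ?_) fun w hw => ?_
    · exact varList_getD_inj (Finset.mem_range.1 (Finset.mem_filter.1 hi).1)
        (Finset.mem_range.1 (Finset.mem_filter.1 hj).1) h
    · obtain ⟨i, hi, h⟩ := exists_index_of_mem_vars (hA hw)
      exact ⟨i, Finset.mem_filter.2 ⟨Finset.mem_range.2 hi, by rwa [h]⟩, h⟩
  obtain ⟨pos, hp0, hpl, hplt, hpJ⟩ := exists_enumeration hJ hcJ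
  have hple : ∀ q ≤ k + 1, pos q ≤ N + 1 := by
    intro q hq
    rw [← hpl]
    obtain ⟨d, hd⟩ : ∃ d, q + d = k + 1 := ⟨k + 1 - q, by omega⟩
    clear hq
    induction d generalizing q with
    | zero => rw [← hd]; simp
    | succ d ih => exact (hplt q (by omega)).le.trans (ih (q + 1) (by omega))
  have hmemG : ∀ r ≤ k, (r, pos r, pos (r + 1)) ∈ G := fun r hr =>
    mem_gaps.2 ⟨hr, hple _ (by omega), hple _ (by omega)⟩
  have hidx : ∀ r ≤ k, ∃ h : G.idxOf (r, pos r, pos (r + 1)) < G.length,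
      G[G.idxOf (r, pos r, pos (r + 1))] = (r, pos r, pos (r + 1)) := fun r hr =>
    ⟨List.idxOf_lt_length_of_mem (hmemG r hr), List.getElem_idxOf _⟩
  -- it suffices to find one of the chosen gaps
  have key : ∀ f : ℕ × ℕ × ℕ → Bool, (∃ r ≤ k, f (r, pos r, pos (r + 1)) = true) →
      ∃ b ∈ (Finset.range (k + 1)).image fun r => G.idxOf (r, pos r, pos (r + 1)),
        (G.map f).getD b false = true := by
    rintro f ⟨r, hr, hf⟩
    refine ⟨_, Finset.mem_image_of_mem _ (Finset.mem_range.2 (Nat.lt_succ_of_le hr)), ?_⟩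
    obtain ⟨h1, h2⟩ := hidx r hr
    exact getD_map_eq_true_iff.2 ⟨h1, by rw [h2]; exact hf⟩
  refine ⟨(Finset.range (k + 1)).image fun r => G.idxOf (r, pos r, pos (r + 1)), ?_, ?_, ?_⟩
  · intro b hb
    obtain ⟨r, hr, rfl⟩ := Finset.mem_image.1 hb
    exact Finset.mem_range.2 (hidx r (Nat.lt_succ_iff.1 (Finset.mem_range.1 hr))).1
  · rw [Finset.card_image_of_injOn, Finset.card_range]
    intro r hr r' hr' h
    simp only [Finset.coe_range, Set.mem_Iio, Nat.lt_succ_iff] at hr hr'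
    exact congrArg Prod.fst ((List.idxOf_inj (hmemG r hr)).1 h)
  · rw [hits_hitMatrix_iff, ← hN, ← hG]
    refine ⟨fun r hr => key _ ⟨r, hr, ?_⟩, fun r hr v hv => key _ ?_, fun C hC => key _ ?_⟩
    · have := hplt r hr
      simp only [isGap, Bool.and_eq_true, Bool.or_eq_true, decide_eq_true_eq, Bool.not_eq_true',
        decide_eq_false_iff_not, true_and]
      refine ⟨this, ?_, ?_⟩
      · by_cases h : r = 0
        · exact .inr (by rw [h, hp0])
        · exact .inl h
      · by_cases h : r = k
        · exact .inr (by rw [h, hpl])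
        · exact .inl h
    · by_cases h : pos (r + 1) = v
      · exact ⟨r + 1, hr, by simp [isLink, h]⟩
      · exact ⟨r, hr.le, by simp [isLink, h]⟩
    · obtain ⟨⟨s, w⟩, hl, hlA⟩ := hs C hC
      obtain ⟨i, hi, rfl⟩ := exists_index_of_mem_vars (CNF.mem_vars.2 ⟨C, hC, s, hl⟩)
      simp only at hlA
      rw [← hmemJ i hi, hpJ] at hlA
      have hw : ∀ e : ℕ × ℕ × ℕ, (bif s then decide (e.2.2 = i + 1) else
          decide (e.2.1 < i + 1) && decide (i + 1 < e.2.2)) = true →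
          isWitness (varList φ) C e = true := by
        intro e he
        simp only [isWitness, List.any_eq_true, List.mem_range, Bool.and_eq_true,
          decide_eq_true_eq]
        exact ⟨_, hl, i, hi, rfl, he⟩
      cases s with
      | true =>
        obtain ⟨q, hq, hqi⟩ := hlA.1 rfl
        exact ⟨q, hq.le, hw _ (by simpa using hqi)⟩
      | false =>
        have hno : ¬ ∃ q < k, pos (q + 1) = i + 1 := fun h => by simpa using hlA.2 h
        by_contra hcon
        -- otherwise all members of the sequence would be less than `i + 1`
        have : ∀ q ≤ k + 1, pos q < i + 1 := by
          intro q
          induction q with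
          | zero => intro _; omega
          | succ q ih =>
            intro hq
            have h1 := ih (by omega)
            by_contra h2
            have h3 : pos (q + 1) ≠ i + 1 := by
              intro h3
              by_cases hqk : q < k
              · exact hno ⟨q, hqk, h3⟩
              · rw [show q = k by omega, hpl] at h3
                omega
            exact hcon ⟨q, by omega, hw _ (by simp; omega)⟩
        have := this (k + 1) le_rfl
        omega

/-- A hitting set with at most `k + 1` elements contains exactly one gap of every number; the gaps
fit together and enclose `k` variables, which form a satisfying assignment. -/
theorem exists_satisfies_of_hits {φ : CNF} {k : ℕ} {H : Finset ℕ} (hc : H.card ≤ k + 1)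
    (hH : Hits H (hitMatrix φ k)) :
    ∃ A ⊆ φ.vars, A.card = k ∧ φ.Satisfies A := by
  classical
  rw [hits_hitMatrix_iff] at hH
  set N := (varList φ).length with hN
  set G := gaps k N with hG
  simp only [getD_map_eq_true_iff] at hH
  obtain ⟨hgap, hlink, hwit⟩ := hH
  choose! b hbH hbG hb using hgap
  simp only [isGap, Bool.and_eq_true, Bool.or_eq_true, decide_eq_true_eq, Bool.not_eq_true',
    decide_eq_false_iff_not] at hb
  -- there is no room for more than one gap with the same number
  have hinj : Set.InjOn b (Finset.range (k + 1)) := by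
    intro r hr r' hr' h
    simp only [Finset.coe_range, Set.mem_Iio, Nat.lt_succ_iff] at hr hr'
    have h1 := (hb r hr).1
    have h2 := (hb r' hr').1
    simp only [h] at h1
    omega
  have himg : (Finset.range (k + 1)).image b = H := by
    refine Finset.eq_of_subset_of_card_le ?_ ?_
    · intro c hc
      obtain ⟨r, hr, rfl⟩ := Finset.mem_image.1 hc
      exact hbH r (Nat.lt_succ_iff.1 (Finset.mem_range.1 hr))
    · rw [Finset.card_image_of_injOn hinj, Finset.card_range]
      exact hc
  have hall : ∀ c ∈ H, ∃ r ≤ k, b r = c := by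
    intro c hc
    rw [← himg] at hc
    obtain ⟨r, hr, rfl⟩ := Finset.mem_image.1 hc
    exact ⟨r, Nat.lt_succ_iff.1 (Finset.mem_range.1 hr), rfl⟩
  obtain ⟨e, he⟩ : ∃ e : ℕ → ℕ × ℕ × ℕ, ∀ r (hr : r ≤ k), G[b r]'(hbG r hr) = e r := by
    refine ⟨fun r => if h : r ≤ k then G[b r]'(hbG r h) else (0, 0, 0), fun r hr => ?_⟩
    simp only [dif_pos hr]
  have he' : ∀ r ≤ k, (e r).1 = r ∧ (e r).2.1 < (e r).2.2 ∧ (r = 0 → (e r).2.1 = 0) ∧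
      (r = k → (e r).2.2 = N + 1) ∧ (e r).2.2 ≤ N + 1 := by
    intro r hr
    have h1 := hb r hr
    have h2 := (mem_gaps.1 (List.getElem_mem (hbG r hr))).2.2
    rw [he r hr] at h1 h2
    exact ⟨h1.1, h1.2.1, fun h => h1.2.2.1.resolve_left (not_not.2 h),
      fun h => h1.2.2.2.resolve_left (not_not.2 h), h2⟩
  have hchain : ∀ r < k, (e (r + 1)).2.1 = (e r).2.2 := by
    intro r hr
    obtain ⟨c, hc, hcG, h⟩ := hlink r hr (e r).2.2 (he' r hr.le).2.2.2.2
    obtain ⟨r', hr', rfl⟩ := hall c hc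
    rw [he r' hr'] at h
    simp only [isLink, Bool.and_eq_true, Bool.or_eq_true, decide_eq_true_eq, Bool.not_eq_true',
      decide_eq_false_iff_not, (he' r' hr').1] at h
    rcases h with ⟨rfl, h⟩ | ⟨rfl, h⟩
    · exact absurd rfl h
    · exact h
  set t : ℕ → ℕ := fun r => (e r).2.2 with ht
  have hmono : ∀ r r', r < r' → r' ≤ k → t r ≤ (e r').2.1 ∧ t r < t r' := by
    intro r r' hrr hr'
    induction r', hrr using Nat.le_induction with
    | base =>
      have h1 := hchain r (by omega)
      have h2 := (he' (r + 1) hr').2.1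
      simp only [ht, Nat.succ_eq_add_one]
      omega
    | succ r' hrr ih =>
      have h0 := ih (by omega)
      have h1 := hchain r' (by omega)
      have h2 := (he' (r' + 1) hr').2.1
      simp only [ht] at h0 ⊢
      omega
  have ht1 : ∀ r < k, 0 < t r ∧ t r - 1 < N := by
    intro r hr
    have h1 := (he' r hr.le).2.1
    have h2 := (hmono r k hr le_rfl).2
    have h3 := (he' k le_rfl).2.2.2.2
    simp only [ht] at h2 ⊢
    omega
  refine ⟨(Finset.range k).image fun r => (varList φ).getD (t r - 1) [], ?_, ?_, ?_⟩
  · intro w hw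
    obtain ⟨r, hr, rfl⟩ := Finset.mem_image.1 hw
    have h := (ht1 r (Finset.mem_range.1 hr)).2
    rw [← mem_varList, List.getD_eq_getElem _ _ h]
    exact List.getElem_mem h
  · rw [Finset.card_image_of_injOn, Finset.card_range]
    intro r hr r' hr' h
    simp only [Finset.coe_range, Set.mem_Iio] at hr hr'
    have h1 := varList_getD_inj (ht1 r hr).2 (ht1 r' hr').2 h
    have h2 := (ht1 r hr).1
    have h3 := (ht1 r' hr').1
    rcases lt_trichotomy r r' with hlt | heq | hlt
    · have := (hmono r r' hlt hr'.le).2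
      omega
    · exact heq
    · have := (hmono r' r hlt hr.le).2
      omega
  · intro C hC
    obtain ⟨c, hc, hcG, h⟩ := hwit C hC
    obtain ⟨r, hr, rfl⟩ := hall c hc
    rw [he r hr] at h
    simp only [isWitness, List.any_eq_true, List.mem_range, Bool.and_eq_true,
      decide_eq_true_eq] at h
    obtain ⟨⟨s, w⟩, hl, i, hi, rfl, h⟩ := h
    refine ⟨_, hl, ?_⟩
    cases s with
    | true =>
      simp only [cond_true, decide_eq_true_eq] at h
      refine ⟨fun _ => ?_, fun _ => rfl⟩
      have hrk : r < k := by
        by_contra hrk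
        have := (he' r hr).2.2.2.1 (by omega)
        omega
      exact Finset.mem_image.2 ⟨r, Finset.mem_range.2 hrk, by simp [ht, h]⟩
    | false =>
      simp only [cond_false, Bool.and_eq_true, decide_eq_true_eq] at h
      refine ⟨fun h => (by cases h), fun hmem => ?_⟩
      exfalso
      obtain ⟨q, hq, hqi⟩ := Finset.mem_image.1 hmem
      have hq := Finset.mem_range.1 hq
      have h1 := varList_getD_inj (ht1 q hq).2 hi hqi
      have h2 := (ht1 q hq).1
      rcases lt_trichotomy q r with hlt | rfl | hlt
      · have := (hmono q r hlt hr).1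
        omega
      · simp only [ht] at h1 h2
        omega
      · have := (hmono r q hlt hq.le).2
        simp only [ht] at h1 h2 this
        omega

/-! ### Hardness -/

section

variable {α : Type} [TreeCoded α]

@[fun_prop]
theorem PolyTime.distinct {l : α → List (List Bool)} (hl : PolyTime l) :
    PolyTime fun a => distinct (l a) := by
  refine PolyTime.foldl (g := fun (_ : α) (acc : List (List Bool)) w =>
    bif acc.any (fun v => decide (v = w)) then acc else w :: acc) (by fun_prop) hl (by fun_prop)
    (B := fun a => size (l a) + 1) (hl.size_le.add (.const 1)) ?_
  intro a s w hw
  have := size_le_of_mem hw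
  cases s.any (fun v => decide (v = w)) <;> simp
  omega

@[fun_prop]
theorem PolyTime.varList {f : α → CNF} (hf : PolyTime f) : PolyTime fun a => varList (f a) := by
  unfold ParamComplexity.varList
  fun_prop

@[fun_prop]
theorem PolyTime.gaps {k N : α → ℕ} (hk : PolyTime k) (hN : PolyTime N) :
    PolyTime fun a => gaps (k a) (N a) := by
  unfold ParamComplexity.gaps
  fun_prop

@[fun_prop]
theorem PolyTime.hitMatrix {f : α → CNF} {k : α → ℕ} (hf : PolyTime f) (hk : PolyTime k) :
    PolyTime fun a => hitMatrix (f a) (k a) := by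
  unfold ParamComplexity.hitMatrix isGap isLink isWitness
  fun_prop

@[fun_prop]
theorem PolyTime.replicate_nil {n : α → ℕ} (hn : PolyTime n) :
    PolyTime fun a => List.replicate (n a) ([] : List Bool) := by
  have h : PolyTime fun a => (List.replicate (n a) ()).map (fun _ => ([] : List Bool)) :=
    hn.toUnits.map .nil
  simpa only [List.map_replicate] using h

@[fun_prop]
theorem PolyTime.uccRows {N : α → ℕ} {M : α → List (List Bool)} (hN : PolyTime N)
    (hM : PolyTime M) : PolyTime fun a => uccRows (N a) (M a) := by
  unfold ParamComplexity.uccRows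
  fun_prop

@[fun_prop]
theorem PolyTime.fdRows {N : α → ℕ} {M : α → List (List Bool)} (hN : PolyTime N)
    (hM : PolyTime M) : PolyTime fun a => fdRows (N a) (M a) := by
  unfold ParamComplexity.fdRows
  fun_prop

/-- The formula that is encoded by a string. -/
def readCNF (I : List Bool) : CNF :=
  (decodeTable I).map fun C => C.map fun w => (w.headD false, w.tail)

theorem readCNF_encode (φ : CNF) : readCNF φ.encode = φ := by
  simp only [readCNF, CNF.encode, decodeTable_encodeTable, List.map_map, Function.comp_def]
  simp

@[fun_prop]
theorem PolyTime.readCNF {f : α → List Bool} (hf : PolyTime f) :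
    PolyTime fun a => readCNF (f a) := by
  unfold ParamComplexity.readCNF
  fun_prop

end

/-- A problem is W[2]-hard, if hitting set instances can be turned into instances of the problem
in polynomial time. -/
theorem w2Hard_of_hits {P : Problem} (out : ℕ → List (List Bool) → List Bool)
    (hout : PolyTime fun x : ℕ × List (List Bool) => out x.1 x.2) (hP : ([], 0) ∉ P)
    (h1 : ∀ N M k, IsHitMatrix N M → (∃ H ⊆ Finset.range N, H.card = k ∧ Hits H M) →
      (out N M, k) ∈ P)
    (h2 : ∀ N M k, IsHitMatrix N M → (out N M, k) ∈ P →
      ∃ H ⊆ Finset.range N, H.card ≤ k ∧ Hits H M) :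
    W2Hard P := by
  intro Q hQ
  have hout' : PolyTime fun x : List Bool × ℕ =>
      out (gaps x.2 (varList (readCNF x.1)).length).length (hitMatrix (readCNF x.1) x.2) :=
    hout.comp (f := fun x : List Bool × ℕ => ((gaps x.2 (varList (readCNF x.1)).length).length,
      hitMatrix (readCNF x.1) x.2)) (by fun_prop)
  refine Reducible.trans_polyTime (P := WeightedCNFSat) hQ (red := fun I k =>
    bif decide (I = (readCNF I).encode) && (decide (0 < k) &&
      (readCNF I).all fun C => !C.isEmpty) then
      (out (gaps k (varList (readCNF I)).length).length (hitMatrix (readCNF I) k), k + 1)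
    else ([], 0)) (.cond (by fun_prop) (.pair hout' (by fun_prop)) (by fun_prop))
    (fun I k => ?_) fun I k => ?_
  · cases decide (I = (readCNF I).encode) && (decide (0 < k) &&
      (readCNF I).all fun C => !C.isEmpty) <;> simp
  · cases hI : decide (I = (readCNF I).encode) && (decide (0 < k) &&
      (readCNF I).all fun C => !C.isEmpty)
    · refine ⟨?_, fun h => absurd h hP⟩
      rintro ⟨φ, rfl, hk, A, -, -, hA⟩
      exfalso
      refine Bool.eq_false_iff.1 hI ?_
      simp only [readCNF_encode, Bool.and_eq_true, decide_eq_true_eq, List.all_eq_true,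
        Bool.not_eq_true', true_and]
      refine ⟨hk, fun C hC => ?_⟩
      obtain ⟨l, hl, -⟩ := hA C hC
      cases C
      · cases hl
      · rfl
    · simp only [Bool.and_eq_true, decide_eq_true_eq, List.all_eq_true, Bool.not_eq_true'] at hI
      obtain ⟨hI, hk, hne⟩ := hI
      have hM := isHitMatrix_hitMatrix (φ := readCNF I) (k := k) fun C hC hC' => by
        have := hne C hC
        rw [hC'] at this
        cases this
      have hiff : (I, k) ∈ WeightedCNFSat ↔ ∃ A ⊆ (readCNF I).vars, A.card = k ∧
          (readCNF I).Satisfies A := by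
        conv_lhs => rw [hI]
        rw [encode_mem_weightedCNFSat_iff]
        exact and_iff_right hk
      rw [hiff, cond_true]
      constructor
      · rintro ⟨A, hA, hc, hs⟩
        exact h1 _ _ _ hM (exists_hits_of_satisfies hA hc hs)
      · intro h
        obtain ⟨H, -, hc, hH⟩ := h2 _ _ _ hM h
        exact exists_satisfies_of_hits hc hH

theorem unary_append_ne_nil (n : ℕ) (l : List Bool) : unary n ++ l ≠ [] := by
  simp [unary]

theorem unary_append_inj {m n : ℕ} {l l' : List Bool} (h : unary m ++ l = unary n ++ l') :
    m = n ∧ l = l' := by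
  have := congrArg splitUnary h
  rw [splitUnary_unary_append, splitUnary_unary_append] at this
  exact Prod.mk.inj this

theorem encode_database_inj {n n' : ℕ} {rows rows' : List (List (List Bool))}
    (h : unary n ++ encodeTable rows = unary n' ++ encodeTable rows') :
    n = n' ∧ rows = rows' :=
  let ⟨h1, h2⟩ := unary_append_inj h
  ⟨h1, encodeTable_injective h2⟩

theorem uniqueColumnCombination_w2Hard : W2Hard UniqueColumnCombination := by
  refine w2Hard_of_hits (fun N M => unary N ++ encodeTable (uccRows N M)) (by fun_prop) ?_ ?_ ?_
  · rw [mem_uniqueColumnCombination_iff]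
    rintro ⟨n, rows, -, h, -⟩
    exact unary_append_ne_nil _ _ h.symm
  · rintro N M k hM ⟨H, hH, hc, h⟩
    exact mem_uniqueColumnCombination_iff.2 ⟨N, _, isTable_uccRows hM, rfl, H, hH, hc,
      (listUCC_uccRows_iff hM).2 h⟩
  · intro N M k hM h
    obtain ⟨n, rows, -, he, U, hU, hc, h⟩ := mem_uniqueColumnCombination_iff.1 h
    obtain ⟨rfl, rfl⟩ := encode_database_inj he
    exact ⟨U, hU, hc.le, (listUCC_uccRows_iff hM).1 h⟩

theorem fdProblem_w2Hard {p : ℕ → ℕ → Prop} (hp : ∀ k, p k k) (hp' : ∀ k c, p k c → c ≤ k) :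
    W2Hard (FDProblem p) := by
  refine w2Hard_of_hits (fun N M => unary (N + 1) ++ encodeTable (fdRows N M)) (by fun_prop)
    ?_ ?_ ?_
  · rintro ⟨n, rows, -, h, -⟩
    exact unary_append_ne_nil _ _ h.symm
  · rintro N M k hM ⟨H, hH, hc, h⟩
    exact ⟨N + 1, _, isTable_fdRows hM, rfl, N, Nat.lt_succ_self N,
      (hasFD_fdRows_iff hM (Nat.lt_succ_self N)).2 ⟨rfl, H, hH, by rw [hc]; exact hp k, h⟩⟩
  · rintro N M k hM ⟨n, rows, -, he, a, ha, h⟩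
    obtain ⟨rfl, rfl⟩ := encode_database_inj he
    obtain ⟨-, H, hH, hc, h⟩ := (hasFD_fdRows_iff hM ha).1 h
    exact ⟨H, hH, hp' _ _ hc, h⟩

theorem fdFixedProblem_w2Hard {p : ℕ → ℕ → Prop} (hp : ∀ k, p k k) (hp' : ∀ k c, p k c → c ≤ k) :
    W2Hard (FDFixedProblem p) := by
  refine w2Hard_of_hits (fun N M => unary N ++ (unary (N + 1) ++ encodeTable (fdRows N M)))
    (by fun_prop) ?_ ?_ ?_
  · rintro ⟨a, n, rows, -, h, -⟩
    exact unary_append_ne_nil _ _ h.symm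
  · rintro N M k hM ⟨H, hH, hc, h⟩
    exact ⟨N, N + 1, _, isTable_fdRows hM, rfl, Nat.lt_succ_self N,
      (hasFD_fdRows_iff hM (Nat.lt_succ_self N)).2 ⟨rfl, H, hH, by rw [hc]; exact hp k, h⟩⟩
  · rintro N M k hM ⟨a, n, rows, -, he, ha, h⟩
    obtain ⟨rfl, he'⟩ := unary_append_inj he
    obtain ⟨rfl, rfl⟩ := encode_database_inj he'
    obtain ⟨-, H, hH, hc, h⟩ := (hasFD_fdRows_iff hM ha).1 h
    exact ⟨H, hH, hp' _ _ hc, h⟩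

theorem eq_iff_exists_dummies (k c : ℕ) : c = k ↔ ∃ d ≤ 0, c + d = k := by
  simp

theorem le_iff_exists_dummies (k c : ℕ) : c ≤ k ↔ ∃ d ≤ k, c + d = k :=
  ⟨fun h => ⟨k - c, Nat.sub_le _ _, by omega⟩, fun ⟨d, _, h⟩ => by omega⟩

theorem uniqueColumnCombination_w2Complete : W2Complete UniqueColumnCombination :=
  ⟨uniqueColumnCombination_mem_W2, uniqueColumnCombination_w2Hard⟩

theorem functionalDependencyAtMost_w2Complete : W2Complete FunctionalDependencyAtMost := by
  rw [functionalDependencyAtMost_eq]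
  exact ⟨fdProblem_mem_W2 .id le_iff_exists_dummies,
    fdProblem_w2Hard (fun _ => le_rfl) fun _ _ h => h⟩

theorem fdFixedRHSAtMost_w2Complete : W2Complete FDFixedRHSAtMost := by
  rw [fdFixedRHSAtMost_eq]
  exact ⟨fdFixedProblem_mem_W2 .id le_iff_exists_dummies,
    fdFixedProblem_w2Hard (fun _ => le_rfl) fun _ _ h => h⟩

theorem functionalDependency_w2Complete : W2Complete FunctionalDependency := by
  rw [functionalDependency_eq]
  exact ⟨fdProblem_mem_W2 (.const 0) eq_iff_exists_dummies,
    fdProblem_w2Hard (fun _ => rfl) fun _ _ h => h.le⟩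

theorem fdFixedRHS_w2Complete : W2Complete FDFixedRHS := by
  rw [fdFixedRHS_eq]
  exact ⟨fdFixedProblem_mem_W2 (.const 0) eq_iff_exists_dummies,
    fdFixedProblem_w2Hard (fun _ => rfl) fun _ _ h => h.le⟩

end ParamComplexity

theorem theorem1 :
    ParamComplexity.W2Complete ParamComplexity.UniqueColumnCombination ∧
    ParamComplexity.W2Complete ParamComplexity.FunctionalDependencyAtMost ∧
    ParamComplexity.W2Complete ParamComplexity.FDFixedRHSAtMost ∧
    ParamComplexity.W2Complete ParamComplexity.FunctionalDependency ∧
    ParamComplexity.W2Complete ParamComplexity.FDFixedRHS :=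
  ⟨ParamComplexity.uniqueColumnCombination_w2Complete,
    ParamComplexity.functionalDependencyAtMost_w2Complete,
    ParamComplexity.fdFixedRHSAtMost_w2Complete,
    ParamComplexity.functionalDependency_w2Complete,
    ParamComplexity.fdFixedRHS_w2Complete⟩
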